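/- Let $m,n\ge 0$ be integers. Let $(M_1,\varphi,\xi,\eta,g_1)$ be a Sasakian space form of dimension $2m+1$ and constant $\varphi$-sectional curvature $c$; that is, $(\varphi,\xi,\eta,g_1)$ is an almost contact metric structure with $d\eta(X,Y)=g_1(X,\varphi Y)$ (where $d\eta(X,Y)=\frac12\{X\eta(Y)-Y\eta(X)-\eta([X,Y])\}$) and $(\nabla^1_X\varphi)Y=g_1(X,Y)\xi-\eta(Y)X$, and every plane spanned by $X,\varphi X$ with $0\ne X\perp\xi$ has sectional curvature $c$. Let $(M_2,J,g_2)$ be a complex space form of real dimension $2n$, i.e. a Kähler manifold of constant holomorphic sectional curvature. Let $f$ be a positive smooth function on $M_1$, let $\pi,\sigma$ be the projections of $M_1\times M_2$ onto $M_1,M_2$, and let $M_1\times_f M_2$ be the warped product with metric $g_f=\pi^*g_1+f^2\sigma^*g_2$ and Levi-Civita connection $\nabla$. Let $\psi:(M^{2(m+n)},g)\to(M_1\times_f M_2,g_f)$ be an isometric immersion of a hypersurface such that $(\xi,0)$ is tangent to $M$ at every point of $M$. Let $B$, $A$, $\nabla^\perp$ and $H=\frac{1}{2(m+n)}\,\mathrm{trace}\,B$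 be its second fundamental form, shape operator, normal connection and mean curvature vector field ($H=0$ if $m+n=0$), and suppose that $H$ is horizontal, i.e. $\sigma_*H=0$ everywhere. Then $\psi$ is biharmonic, i.e. $$\tau_2(\psi)=\mathrm{trace}\,\nabla^2\tau(\psi)-\mathrm{trace}\,R^f(d\psi(\cdot),\tau(\psi))d\psi(\cdot)=0,\qquad \tau(\psi)=\mathrm{trace}\,\nabla d\psi,$$ where $R^f(X,Y)Z=\nabla_X\nabla_YZ-\nabla_Y\nabla_XZ-\nabla_{[X,Y]}Z$, if and only if the following two equations hold on $M$: $$\Delta^\perp H=\mathrm{trace}\,B(\cdot,A_H\cdot)-\frac{c(m+1)+3m-1}{2}\,H+\frac{2n}{f}(\nabla_H\nabla f)^\perp,$$ $$-2\,\mathrm{trace}\,A_{\nabla^\perp_{(\cdot)}H}(\cdot)-(m+n)\,\mathrm{grad}|H|^2-\frac{4n}{f}(\nabla_H\nabla f)^\top=0.$$ Here $\Delta^\perp H=\mathrm{trace}\,(\nabla^\perp)^2H$, $f$ is regarded as the function $f\circ\pi$ on $M_1\times M_2$ with gradient $\nabla f$ with respect to $g_f$, and $\top,\perp$ denote the parts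 tangent and normal to $M$. -/

import Mathlib

open scoped Manifold ContDiff

noncomputable section

/-! ### Riemannian geometry in a coordinate patch

`E`, `F` are finite-dimensional real vector spaces. A metric on (an open subset of) `E` is given by
its field of bilinear forms `g : E → E →L[ℝ] E →L[ℝ] ℝ`; vectors `u v w : E` also stand for the
constant (coordinate) vector fields. -/

namespace Coord

variable {E : Type*} [NormedAddCommGroup E] [NormedSpace ℝ E] [FiniteDimensional ℝ E]
  {F : Type*} [NormedAddCommGroup F] [NormedSpace ℝ F] [FiniteDimensional ℝ F]

/-- The vector `g^{ij} e_j` of the bilinear form `b = (g_{ij})`, where `(e_j)` is a basis of `E`: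
it is the vector `w` with `b w v = v^i` for all `v`. -/
def dualVec (b : E →L[ℝ] E →L[ℝ] ℝ) (i : Fin (Module.finrank ℝ E)) : E :=
  ContinuousLinearMap.inverse b (LinearMap.toContinuousLinearMap ((Module.finBasis ℝ E).coord i))

/-- Raising the index of a linear form: `g^{ij} α(e_i) e_j`, the vector `α^♯` with
`b α^♯ v = α v` for all `v`. -/
def raise (b : E →L[ℝ] E →L[ℝ] ℝ) (α : E → ℝ) : E :=
  ∑ i, α (Module.finBasis ℝ E i) • dualVec b i

/-- The metric trace `g^{ij} T(e_i, e_j)` of a bilinear map `T`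
(the sum of `T(e_i, e_i)` over an orthonormal basis). -/
def trace (b : E →L[ℝ] E →L[ℝ] ℝ) (T : E → E → F) : F :=
  ∑ i, T (Module.finBasis ℝ E i) (dualVec b i)

/-- The Christoffel symbols `Γ(u, v) = ∇_u v` of the Levi-Civita connection of `g`:
`g(Γ(u, v), w) = (∂_u g(v, w) + ∂_v g(u, w) - ∂_w g(u, v)) / 2`. -/
def christoffel (g : E → E →L[ℝ] E →L[ℝ] ℝ) (y u v : E) : E :=
  raise (g y) fun w =>
    (fderiv ℝ g y u v w + fderiv ℝ g y v u w - fderiv ℝ g y w u v) / 2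

/-- The curvature tensor `R(u, v)w = ∇_u ∇_v w - ∇_v ∇_u w - ∇_{[u, v]} w`. -/
def curvature (g : E → E →L[ℝ] E →L[ℝ] ℝ) (y u v w : E) : E :=
  fderiv ℝ (fun z => christoffel g z v w) y u - fderiv ℝ (fun z => christoffel g z u w) y v
    + christoffel g y u (christoffel g y v w) - christoffel g y v (christoffel g y u w)

/-- The covariant derivative `(∇_u T)v = ∇_u (T v) - T (∇_u v)` of a `(1,1)`-tensor field. -/
def covDerivEndo (g : E → E →L[ℝ] E →L[ℝ] ℝ) (T : E → E →L[ℝ] E) (y u v : E) : E :=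
  fderiv ℝ T y u v + christoffel g y u (T y v) - T y (christoffel g y u v)

/-- The gradient of a function. -/
def grad (g : E → E →L[ℝ] E →L[ℝ] ℝ) (a : E → ℝ) (y : E) : E :=
  raise (g y) fun w => fderiv ℝ a y w

/-- `∇_u grad a`. -/
def covDerivGrad (g : E → E →L[ℝ] E →L[ℝ] ℝ) (a : E → ℝ) (y u : E) : E :=
  fderiv ℝ (grad g a) y u + christoffel g y u (grad g a y)

/-- The covariant derivative `∇_u V` of a vector field `V` along a map `ψ : E → F`
(the pull-back to `ψ⁻¹TF` of the Levi-Civita connection of the metric `h` on `F`). -/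
def covDerivAlong (h : F → F →L[ℝ] F →L[ℝ] ℝ) (ψ V : E → F) (x u : E) : F :=
  fderiv ℝ V x u + christoffel h (ψ x) (fderiv ℝ ψ x u) (V x)

/-- The second fundamental form `B(u, v) = (∇dψ)(u, v) = ∇_u (dψ v) - dψ(∇_u v)`
of a map `ψ` from `(E, g)` to `(F, h)`. -/
def sff (g : E → E →L[ℝ] E →L[ℝ] ℝ) (h : F → F →L[ℝ] F →L[ℝ] ℝ) (ψ : E → F) (x u v : E) : F :=
  covDerivAlong h ψ (fun z => fderiv ℝ ψ z v) x u - fderiv ℝ ψ x (christoffel g x u v)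

/-- The tension field `τ(ψ) = trace ∇dψ`. -/
def tension (g : E → E →L[ℝ] E →L[ℝ] ℝ) (h : F → F →L[ℝ] F →L[ℝ] ℝ) (ψ : E → F) (x : E) : F :=
  trace (g x) (sff g h ψ x)

/-- The Laplacian `Δ V = - trace ∇²V`, `∇²V(u, v) = ∇_u ∇_v V - ∇_{∇_u v} V`, of vector fields
along `ψ`. -/
def laplacianAlong (g : E → E →L[ℝ] E →L[ℝ] ℝ) (h : F → F →L[ℝ] F →L[ℝ] ℝ) (ψ V : E → F)
    (x : E) : F :=
  -trace (g x) fun u v =>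
    covDerivAlong h ψ (fun z => covDerivAlong h ψ V z v) x u
      - covDerivAlong h ψ V x (christoffel g x u v)

/-- The bitension field `τ₂(ψ) = -Δ τ(ψ) - trace R(dψ ·, τ(ψ)) dψ ·`. -/
def bitension (g : E → E →L[ℝ] E →L[ℝ] ℝ) (h : F → F →L[ℝ] F →L[ℝ] ℝ) (ψ : E → F) (x : E) : F :=
  -laplacianAlong g h ψ (tension g h ψ) x
    - trace (g x) fun u v =>
        curvature h (ψ x) (fderiv ℝ ψ x u) (tension g h ψ x) (fderiv ℝ ψ x v)

/-! The remaining definitions are about an isometric immersion `ψ` of `(E, g)` in `(F, h)`. -/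

/-- The tangential part `V^⊤` (as a vector of `E`) of a vector `V` at `ψ x`:
`g(V^⊤, w) = h(V, dψ w)`. -/
def tanPart (g : E → E →L[ℝ] E →L[ℝ] ℝ) (h : F → F →L[ℝ] F →L[ℝ] ℝ) (ψ : E → F) (x : E)
    (V : F) : E :=
  raise (g x) fun w => h (ψ x) V (fderiv ℝ ψ x w)

/-- The normal part `V^⊥ = V - dψ(V^⊤)`. -/
def norPart (g : E → E →L[ℝ] E →L[ℝ] ℝ) (h : F → F →L[ℝ] F →L[ℝ] ℝ) (ψ : E → F) (x : E)
    (V : F) : F :=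
  V - fderiv ℝ ψ x (tanPart g h ψ x V)

/-- The shape operator: `g(A_ν u, w) = h(B(u, w), ν)`. -/
def shape (g : E → E →L[ℝ] E →L[ℝ] ℝ) (h : F → F →L[ℝ] F →L[ℝ] ℝ) (ψ : E → F) (x : E)
    (ν : F) (u : E) : E :=
  raise (g x) fun w => h (ψ x) (sff g h ψ x u w) ν

/-- The mean curvature vector field `H = (1 / dim E) trace B`. -/
def meanCurv (g : E → E →L[ℝ] E →L[ℝ] ℝ) (h : F → F →L[ℝ] F →L[ℝ] ℝ) (ψ : E → F) (x : E) : F :=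
  (1 / (Module.finrank ℝ E : ℝ)) • trace (g x) (sff g h ψ x)

/-- The normal connection `∇^⊥_u V = (∇_u V)^⊥`. -/
def normalDeriv (g : E → E →L[ℝ] E →L[ℝ] ℝ) (h : F → F →L[ℝ] F →L[ℝ] ℝ) (ψ V : E → F)
    (x u : E) : F :=
  norPart g h ψ x (covDerivAlong h ψ V x u)

/-- The normal Laplacian
`Δ^⊥ V = trace (∇^⊥)²V`, `(∇^⊥)²V(u, v) = ∇^⊥_u ∇^⊥_v V - ∇^⊥_{∇_u v} V`. -/
def normalLaplacian (g : E → E →L[ℝ] E →L[ℝ] ℝ) (h : F → F →L[ℝ] F →L[ℝ] ℝ) (ψ V : E → F)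
    (x : E) : F :=
  trace (g x) fun u v =>
    normalDeriv g h ψ (fun z => normalDeriv g h ψ V z v) x u
      - normalDeriv g h ψ V x (christoffel g x u v)

/-- `trace B(·, A_ν ·)`. -/
def traceSffShape (g : E → E →L[ℝ] E →L[ℝ] ℝ) (h : F → F →L[ℝ] F →L[ℝ] ℝ) (ψ : E → F) (x : E)
    (ν : F) : F :=
  trace (g x) fun u v => sff g h ψ x u (shape g h ψ x ν v)

/-- `trace A_{∇^⊥_· V} ·`. -/
def traceShapeNormalDeriv (g : E → E →L[ℝ] E →L[ℝ] ℝ) (h : F → F →L[ℝ] F →L[ℝ] ℝ)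
    (ψ V : E → F) (x : E) : E :=
  trace (g x) fun u v => shape g h ψ x (normalDeriv g h ψ V x u) v

/-- `grad |V|²` for a vector field `V` along `ψ`. -/
def gradNormSq (g : E → E →L[ℝ] E →L[ℝ] ℝ) (h : F → F →L[ℝ] F →L[ℝ] ℝ) (ψ V : E → F)
    (x : E) : E :=
  grad g (fun z => h (ψ z) (V z) (V z)) x

end Coord

/-! ### Manifolds

Tensor fields on a manifold `M` (without boundary) are read in the preferred chart at a point `p`,
which is also the chart through which the tangent space at `p` is identified with the model vector
space. All the quantities below are tensorial, hence independent of the chart. -/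

namespace RiemGeom

variable {E : Type*} [NormedAddCommGroup E] [NormedSpace ℝ E]
  {H : Type*} [TopologicalSpace H] {I : ModelWithCorners ℝ E H}
  {M : Type*} [TopologicalSpace M] [ChartedSpace H M]
  {E' : Type*} [NormedAddCommGroup E'] [NormedSpace ℝ E']
  {H' : Type*} [TopologicalSpace H'] {I' : ModelWithCorners ℝ E' H'}
  {N : Type*} [TopologicalSpace N] [ChartedSpace H' N]

/-- Fields of bilinear forms on the tangent spaces. -/
abbrev BilinField (I : ModelWithCorners ℝ E H) (M : Type*) [TopologicalSpace M]
    [ChartedSpace H M] : Type _ :=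
  ∀ x : M, TangentSpace I x →L[ℝ] TangentSpace I x →L[ℝ] ℝ

/-- Fields of endomorphisms of the tangent spaces. -/
abbrev EndoField (I : ModelWithCorners ℝ E H) (M : Type*) [TopologicalSpace M]
    [ChartedSpace H M] : Type _ :=
  ∀ x : M, TangentSpace I x →L[ℝ] TangentSpace I x

/-- The differential at `y` of the inverse of the chart at `p`. -/
def chartInvDeriv (I : ModelWithCorners ℝ E H) {M : Type*} [TopologicalSpace M] [ChartedSpace H M]
    (p : M) (y : E) : E →L[ℝ] TangentSpace I ((extChartAt I p).symm y) :=
  mfderiv 𝓘(ℝ, E) I (extChartAt I p).symm y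

/-- The differential, at the point with coordinates `y`, of the chart at `p`. -/
def chartDeriv (I : ModelWithCorners ℝ E H) {M : Type*} [TopologicalSpace M] [ChartedSpace H M]
    (p : M) (y : E) : TangentSpace I ((extChartAt I p).symm y) →L[ℝ] E :=
  mfderiv I 𝓘(ℝ, E) (extChartAt I p) ((extChartAt I p).symm y)

/-- A bilinear form field, in the chart at `p`. -/
def inChartBilin (b : BilinField I M) (p : M) (y : E) : E →L[ℝ] E →L[ℝ] ℝ :=
  (ContinuousLinearMap.precomp ℝ (chartInvDeriv I p y)).comp
    ((b ((extChartAt I p).symm y)).comp (chartInvDeriv I p y))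

/-- An endomorphism field, in the chart at `p`. -/
def inChartEndo (T : EndoField I M) (p : M) (y : E) : E →L[ℝ] E :=
  (chartDeriv I p y).comp ((T ((extChartAt I p).symm y)).comp (chartInvDeriv I p y))

/-- A vector field, in the chart at `p`. -/
def inChartVec (X : ∀ x : M, TangentSpace I x) (p : M) (y : E) : E :=
  chartDeriv I p y (X ((extChartAt I p).symm y))

/-- A `1`-form, in the chart at `p`. -/
def inChartForm (α : ∀ x : M, TangentSpace I x →L[ℝ] ℝ) (p : M) (y : E) : E →L[ℝ] ℝ :=
  (α ((extChartAt I p).symm y)).comp (chartInvDeriv I p y)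

variable [FiniteDimensional ℝ E] [FiniteDimensional ℝ E']

/-- The curvature tensor `R(u, v)w = ∇_u ∇_v w - ∇_v ∇_u w - ∇_{[u, v]} w` of `g` at `p`. -/
def curvature (g : BilinField I M) (p : M) (u v w : TangentSpace I p) : TangentSpace I p :=
  Coord.curvature (E := E) (inChartBilin g p) (extChartAt I p p) u v w

/-- The sectional curvature of the plane spanned by `u` and `v`. -/
def sectionalCurvature (g : BilinField I M) (p : M) (u v : TangentSpace I p) : ℝ :=
  g p (curvature g p u v v) u / (g p u u * g p v v - g p u v ^ 2)

/-- `∇_X grad a` at `p`. -/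
def covDerivGrad (g : BilinField I M) (a : M → ℝ) (p : M) (X : TangentSpace I p) :
    TangentSpace I p :=
  Coord.covDerivGrad (E := E) (inChartBilin g p) (a ∘ (extChartAt I p).symm) (extChartAt I p p) X

/-! Maps `ψ` from `(M, g)` to `(N, h)`, read in the charts at `p` and at `ψ p`. -/

/-- The bitension field `τ₂(ψ) = -Δ τ(ψ) - trace R(dψ ·, τ(ψ)) dψ ·`. -/
def bitensionField (g : BilinField I M) (h : BilinField I' N) (ψ : M → N) (p : M) :
    TangentSpace I' (ψ p) :=
  Coord.bitension (E := E) (F := E') (inChartBilin g p) (inChartBilin h (ψ p)) (writtenInExtChartAt I I' p ψ)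
    (extChartAt I p p)

/-- `ψ` is biharmonic: `τ₂(ψ) = 0`. -/
def IsBiharmonic (g : BilinField I M) (h : BilinField I' N) (ψ : M → N) : Prop :=
  ∀ p, bitensionField g h ψ p = 0

/-- `ψ` is isometric: `g = ψ^* h` (for a Riemannian metric `g`, it is then an immersion). -/
def IsIsometric (g : BilinField I M) (h : BilinField I' N) (ψ : M → N) : Prop :=
  ∀ (p : M) (u v : TangentSpace I p),
    g p u v = h (ψ p) (mfderiv I I' ψ p u) (mfderiv I I' ψ p v)

/-- The mean curvature vector `H`. -/
def meanCurvature (g : BilinField I M) (h : BilinField I' N) (ψ : M → N) (p : M) :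
    TangentSpace I' (ψ p) :=
  Coord.meanCurv (E := E) (F := E') (inChartBilin g p) (inChartBilin h (ψ p)) (writtenInExtChartAt I I' p ψ)
    (extChartAt I p p)

/-- The tangential part of a vector at `ψ p`, as a tangent vector of `M`. -/
def tangentialPart (g : BilinField I M) (h : BilinField I' N) (ψ : M → N) (p : M)
    (V : TangentSpace I' (ψ p)) : TangentSpace I p :=
  Coord.tanPart (E := E) (F := E') (inChartBilin g p) (inChartBilin h (ψ p)) (writtenInExtChartAt I I' p ψ)
    (extChartAt I p p) V

/-- The normal part of a vector at `ψ p`. -/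
def normalPart (g : BilinField I M) (h : BilinField I' N) (ψ : M → N) (p : M)
    (V : TangentSpace I' (ψ p)) : TangentSpace I' (ψ p) :=
  Coord.norPart (E := E) (F := E') (inChartBilin g p) (inChartBilin h (ψ p)) (writtenInExtChartAt I I' p ψ)
    (extChartAt I p p) V

/-- `Δ^⊥ H`. -/
def normalLaplacianH (g : BilinField I M) (h : BilinField I' N) (ψ : M → N) (p : M) :
    TangentSpace I' (ψ p) :=
  Coord.normalLaplacian (E := E) (F := E') (inChartBilin g p) (inChartBilin h (ψ p)) (writtenInExtChartAt I I' p ψ)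
    (Coord.meanCurv (E := E) (F := E') (inChartBilin g p) (inChartBilin h (ψ p)) (writtenInExtChartAt I I' p ψ))
    (extChartAt I p p)

/-- `trace B(·, A_H ·)`. -/
def traceSffShapeH (g : BilinField I M) (h : BilinField I' N) (ψ : M → N) (p : M) :
    TangentSpace I' (ψ p) :=
  Coord.traceSffShape (E := E) (F := E') (inChartBilin g p) (inChartBilin h (ψ p)) (writtenInExtChartAt I I' p ψ)
    (extChartAt I p p) (meanCurvature g h ψ p)

/-- `trace A_{∇^⊥_· H} ·`. -/
def traceShapeNormalDerivH (g : BilinField I M) (h : BilinField I' N) (ψ : M → N) (p : M) :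
    TangentSpace I p :=
  Coord.traceShapeNormalDeriv (E := E) (F := E') (inChartBilin g p) (inChartBilin h (ψ p))
    (writtenInExtChartAt I I' p ψ)
    (Coord.meanCurv (E := E) (F := E') (inChartBilin g p) (inChartBilin h (ψ p)) (writtenInExtChartAt I I' p ψ))
    (extChartAt I p p)

/-- `grad |H|²`. -/
def gradNormSqH (g : BilinField I M) (h : BilinField I' N) (ψ : M → N) (p : M) :
    TangentSpace I p :=
  Coord.gradNormSq (E := E) (F := E') (inChartBilin g p) (inChartBilin h (ψ p)) (writtenInExtChartAt I I' p ψ)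
    (Coord.meanCurv (E := E) (F := E') (inChartBilin g p) (inChartBilin h (ψ p)) (writtenInExtChartAt I I' p ψ))
    (extChartAt I p p)

/-! ### Metrics and structures -/

/-- Smooth Riemannian metrics on a `d`-dimensional manifold. -/
abbrev RiemannianMetric (d : ℕ) (M : Type*) [TopologicalSpace M]
    [ChartedSpace (EuclideanSpace ℝ (Fin d)) M] [IsManifold (𝓡 d) ∞ M] : Type _ :=
  Bundle.ContMDiffRiemannianMetric (𝓡 d) ∞ (EuclideanSpace ℝ (Fin d))
    (fun x : M => TangentSpace (𝓡 d) x)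

/-- Smooth vector fields. -/
abbrev SmoothVectorField (d : ℕ) (M : Type*) [TopologicalSpace M]
    [ChartedSpace (EuclideanSpace ℝ (Fin d)) M] [IsManifold (𝓡 d) ∞ M] : Type _ :=
  ContMDiffSection (𝓡 d) (EuclideanSpace ℝ (Fin d)) ∞ (fun x : M => TangentSpace (𝓡 d) x)

/-- Smooth `(1,1)`-tensor fields. -/
abbrev SmoothEndoField (d : ℕ) (M : Type*) [TopologicalSpace M]
    [ChartedSpace (EuclideanSpace ℝ (Fin d)) M] [IsManifold (𝓡 d) ∞ M] : Type _ :=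
  ContMDiffSection (𝓡 d) (EuclideanSpace ℝ (Fin d) →L[ℝ] EuclideanSpace ℝ (Fin d)) ∞
    (fun x : M => TangentSpace (𝓡 d) x →L[ℝ] TangentSpace (𝓡 d) x)

/-- The warped product metric `π^* g₁ + f² σ^* g₂` on `M₁ × M₂`. -/
def warpedMetric {d₁ d₂ : ℕ}
    {M₁ : Type*} [TopologicalSpace M₁] [ChartedSpace (EuclideanSpace ℝ (Fin d₁)) M₁]
    {M₂ : Type*} [TopologicalSpace M₂] [ChartedSpace (EuclideanSpace ℝ (Fin d₂)) M₂]
    (g₁ : BilinField (𝓡 d₁) M₁) (g₂ : BilinField (𝓡 d₂) M₂) (f : M₁ → ℝ) :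
    BilinField ((𝓡 d₁).prod (𝓡 d₂)) (M₁ × M₂) := fun x =>
  (ContinuousLinearMap.precomp ℝ (mfderiv ((𝓡 d₁).prod (𝓡 d₂)) (𝓡 d₁) Prod.fst x)).comp
      ((g₁ x.1).comp (mfderiv ((𝓡 d₁).prod (𝓡 d₂)) (𝓡 d₁) Prod.fst x))
    + f x.1 ^ 2 •
      (ContinuousLinearMap.precomp ℝ (mfderiv ((𝓡 d₁).prod (𝓡 d₂)) (𝓡 d₂) Prod.snd x)).comp
        ((g₂ x.2).comp (mfderiv ((𝓡 d₁).prod (𝓡 d₂)) (𝓡 d₂) Prod.snd x))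

section Structures

variable {d : ℕ} {M : Type*} [TopologicalSpace M]
  [ChartedSpace (EuclideanSpace ℝ (Fin d)) M] [IsManifold (𝓡 d) ∞ M]

/-- `(φ, ξ, η, g)` is an almost contact metric structure. -/
structure IsAlmostContactMetric (g : RiemannianMetric d M) (φ : SmoothEndoField d M)
    (ξ : SmoothVectorField d M) (η : ∀ x : M, TangentSpace (𝓡 d) x →L[ℝ] ℝ) : Prop where
  phi_sq : ∀ (x : M) (X : TangentSpace (𝓡 d) x), φ x (φ x X) = -X + η x X • ξ x
  eta_xi : ∀ x : M, η x (ξ x) = 1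
  eta_phi : ∀ (x : M) (X : TangentSpace (𝓡 d) x), η x (φ x X) = 0
  eta_eq : ∀ (x : M) (X : TangentSpace (𝓡 d) x), η x X = g.inner x (ξ x) X
  compatible : ∀ (x : M) (X Y : TangentSpace (𝓡 d) x),
    g.inner x (φ x X) (φ x Y) = g.inner x X Y - η x X * η x Y

/-- `(φ, ξ, η, g)` is a Sasakian structure: a contact metric structure, `dη(X, Y) = g(X, φY)` with
`dη(X, Y) = (X η(Y) - Y η(X) - η([X, Y])) / 2`, such that `(∇_X φ)Y = g(X, Y)ξ - η(Y)X`. These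
identities are read at all the points of the domain of each preferred chart. -/
structure IsSasakian (g : RiemannianMetric d M) (φ : SmoothEndoField d M)
    (ξ : SmoothVectorField d M) (η : ∀ x : M, TangentSpace (𝓡 d) x →L[ℝ] ℝ) : Prop
    extends IsAlmostContactMetric g φ ξ η where
  contact : ∀ p : M, ∀ y ∈ (extChartAt (𝓡 d) p).target, ∀ X Y : EuclideanSpace ℝ (Fin d),
    (fderiv ℝ (inChartForm η p) y X Y - fderiv ℝ (inChartForm η p) y Y X) / 2
      = inChartBilin g.inner p y X (inChartEndo (fun x => φ x) p y Y)
  nabla_phi : ∀ p : M, ∀ y ∈ (extChartAt (𝓡 d) p).target, ∀ X Y : EuclideanSpace ℝ (Fin d),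
    Coord.covDerivEndo (inChartBilin g.inner p) (inChartEndo (fun x => φ x) p) y X Y
      = inChartBilin g.inner p y X Y • inChartVec (fun x => ξ x) p y
        - inChartForm η p y Y • X

/-- Sasakian space forms: Sasakian manifolds of constant `φ`-sectional curvature `c`. -/
structure IsSasakianSpaceForm (g : RiemannianMetric d M) (φ : SmoothEndoField d M)
    (ξ : SmoothVectorField d M) (η : ∀ x : M, TangentSpace (𝓡 d) x →L[ℝ] ℝ) (c : ℝ) : Prop
    extends IsSasakian g φ ξ η where
  phi_sectional : ∀ (x : M) (X : TangentSpace (𝓡 d) x), X ≠ 0 → η x X = 0 →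
    sectionalCurvature g.inner x X (φ x X) = c

/-- `(J, g)` is a Kähler structure: `J² = -1`, `g(JX, JY) = g(X, Y)` and `∇J = 0`. -/
structure IsKahler (g : RiemannianMetric d M) (J : SmoothEndoField d M) : Prop where
  J_sq : ∀ (x : M) (X : TangentSpace (𝓡 d) x), J x (J x X) = -X
  compatible : ∀ (x : M) (X Y : TangentSpace (𝓡 d) x),
    g.inner x (J x X) (J x Y) = g.inner x X Y
  nabla_J : ∀ p : M, ∀ y ∈ (extChartAt (𝓡 d) p).target, ∀ X Y : EuclideanSpace ℝ (Fin d),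
    Coord.covDerivEndo (inChartBilin g.inner p) (inChartEndo (fun x => J x) p) y X Y = 0

/-- Complex space forms: Kähler manifolds of constant holomorphic sectional curvature `k`. -/
structure IsComplexSpaceForm (g : RiemannianMetric d M) (J : SmoothEndoField d M) (k : ℝ) : Prop
    extends IsKahler g J where
  holomorphic_sectional : ∀ (x : M) (X : TangentSpace (𝓡 d) x), X ≠ 0 →
    sectionalCurvature g.inner x X (J x X) = k

end Structures

end RiemGeom

end

/-! The bitension field is tensorial, so everything happens at one point, in the charts at `p` and
`ψ p`, where the metrics are smooth fields of inner products on open sets.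

Two independent facts combine. The first holds for every isometric immersion of a manifold of
dimension d, where τ(ψ) = dH. Applying the Weingarten formula, then Gauss and Weingarten once more,
splits the rough Laplacian of H into Δ^⊥H - trace B(·, A_H ·) and a tangential part, minus trace
A_{∇^⊥H} minus the divergence of A_H. The Codazzi equation computes that divergence: it is (d/2)
grad|H|² + trace A_{∇^⊥H} plus the tangential part of trace R(dψ·, H)dψ·. Hence τ₂ is d times an
explicit normal vector plus an explicit tangent vector, and for d ≠ 0 it vanishes exactly when both
do (`trace_covDeriv_shape_meanCurv`, `neg_laplacianAlong_meanCurv`, `bitension_eq_zero_iff`).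

The second is the value of the curvature trace. On a hypersurface the trace over the tangent space
equals the trace over the whole ambient space, because the missing normal direction contributes R(H,
H)H = 0 (`traceCurv_eq_of_hypersurface`). For a horizontal vector the ambient trace is the one of M₁
plus one copy of (1/f)∇_H grad f for each of the 2n vertical directions (`trace_curvature_warp`).
Since (ξ, 0) is tangent and H is normal and horizontal, H lies in the contact distribution, on which
the Ricci operator of a Sasakian space form is a multiple of the identity
(`IsSasakianOn.trace_curvature`). That multiple comes from the classical computation:
`curvature_phi` says how far R is from commuting with φ, polarization of the φ-sectional curvature
then determines all sectional curvatures of the distribution, and `curvature_xi` settles the ξ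
direction.

Substituting the second fact in the first (`bitension_eq_zero_iff_of_warp`) gives the two equations.
The rest transfers tensors, covariant derivatives and the product metric between manifolds and
charts. -/

open scoped Manifold ContDiff

noncomputable section

set_option linter.unusedSectionVars false

namespace Coord

variable {E : Type*} [NormedAddCommGroup E] [NormedSpace ℝ E] [FiniteDimensional ℝ E]
  {F : Type*} [NormedAddCommGroup F] [NormedSpace ℝ F] [FiniteDimensional ℝ F]
  {G : Type*} [NormedAddCommGroup G] [NormedSpace ℝ G]

/-! ### Linear algebra of a positive definite bilinear form -/

/-- Symmetric positive definite bilinear forms. -/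
structure IsInner (b : E →L[ℝ] E →L[ℝ] ℝ) : Prop where
  symm : ∀ u v, b u v = b v u
  pos : ∀ u, u ≠ 0 → 0 < b u u

namespace IsInner

variable {b : E →L[ℝ] E →L[ℝ] ℝ} (hb : IsInner b)

include hb

theorem ext {u w : E} (h : ∀ v, b u v = b w v) : u = w := by
  by_contra hne
  have := hb.pos (u - w) (sub_ne_zero.2 hne)
  simp [h] at this

/-- `dualVec` is built on `ContinuousLinearMap.inverse`, whose value is a default unless the map is
invertible. Definiteness gives injectivity, and equality of the dimensions of `E` and its dual does
the rest. -/
theorem isInvertible : b.IsInvertible := by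
  have hinj : Function.Injective (b : E →ₗ[ℝ] (E →L[ℝ] ℝ)) := fun u w h =>
    hb.ext fun v => by
      have := congrArg (fun l : E →L[ℝ] ℝ => l v) h
      simpa using this
  have hfin : Module.finrank ℝ E = Module.finrank ℝ (E →L[ℝ] ℝ) := by
    rw [← (LinearMap.toContinuousLinearMap (𝕜 := ℝ) (E := E) (F' := ℝ)).finrank_eq]
    exact (Subspace.dual_finrank_eq (K := ℝ) (V := E)).symm
  let e := (LinearEquiv.ofInjectiveOfFinrankEq (b : E →ₗ[ℝ] (E →L[ℝ] ℝ)) hinj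
    hfin).toContinuousLinearEquiv
  exact ⟨e, by ext u v; rfl⟩

theorem apply_dualVec (i : Fin (Module.finrank ℝ E)) (v : E) :
    b (dualVec b i) v = (Module.finBasis ℝ E).coord i v := by
  obtain ⟨e, he⟩ := hb.isInvertible
  have : b (dualVec b i) =
      LinearMap.toContinuousLinearMap ((Module.finBasis ℝ E).coord i) := by
    unfold dualVec
    rw [← he]
    simp
  rw [this]
  rfl

theorem sum_apply_smul_dualVec (w : E) :
    ∑ i, b w (Module.finBasis ℝ E i) • dualVec b i = w := by
  refine hb.ext fun v => ?_
  conv_rhs => rw [← (Module.finBasis ℝ E).sum_repr v]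
  simp only [map_sum, map_smul, sum_apply, smul_apply,
    smul_eq_mul, hb.apply_dualVec, Module.Basis.coord_apply]
  exact Finset.sum_congr rfl fun i _ => mul_comm _ _

theorem sum_apply_dualVec_smul (w : E) :
    ∑ i, b w (dualVec b i) • Module.finBasis ℝ E i = w := by
  conv_rhs => rw [← (Module.finBasis ℝ E).sum_repr w]
  refine Finset.sum_congr rfl fun i _ => ?_
  rw [hb.symm, hb.apply_dualVec]
  rfl

theorem apply_raise {α : E → ℝ} (hα : IsLinearMap ℝ α) (v : E) : b (raise b α) v = α v := by
  have h : α v = hα.mk' α v := rfl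
  rw [h]
  conv_rhs => rw [← (Module.finBasis ℝ E).sum_repr v]
  simp only [raise, map_sum, map_smul, sum_apply,
    smul_apply, smul_eq_mul, hb.apply_dualVec, Module.Basis.coord_apply]
  exact Finset.sum_congr rfl fun i _ => mul_comm _ _

/-- Any two families that resolve the identity compute the trace, so frames adapted to the geometry
may replace the coordinate basis: a tangent frame completed by a normal, or a frame split along a
product. -/
theorem trace_eq_sum {ι : Type*} [Fintype ι] {a c : ι → E}
    (hac : ∀ v, ∑ i, b v (a i) • c i = v) {T : E → E → G} (hT : IsBilinearMap ℝ T) :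
    trace b T = ∑ i, T (a i) (c i) := by
  set T' := hT.toLinearMap
  have hT' : ∀ u v, T u v = T' u v := fun _ _ => rfl
  unfold trace
  simp only [hT']
  calc ∑ i, T' (Module.finBasis ℝ E i) (dualVec b i)
      = ∑ j, ∑ i, b (dualVec b j) (a i) • T' (Module.finBasis ℝ E j) (c i) := by
        refine Finset.sum_congr rfl fun j _ => ?_
        conv_lhs => rw [← hac (dualVec b j)]
        simp only [map_sum, map_smul]
    _ = ∑ i, ∑ j, b (dualVec b j) (a i) • T' (Module.finBasis ℝ E j) (c i) :=
        Finset.sum_comm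
    _ = ∑ i, T' (a i) (c i) := by
        refine Finset.sum_congr rfl fun i _ => ?_
        conv_rhs => rw [← hb.sum_apply_dualVec_smul (a i)]
        simp only [map_sum, map_smul, LinearMap.sum_apply, LinearMap.smul_apply]
        exact Finset.sum_congr rfl fun j _ => by rw [hb.symm]

/-- The basis and its dual play symmetric roles in the resolution of the identity; `T` itself need
not be symmetric. -/
theorem trace_comm {T : E → E → G} (hT : IsBilinearMap ℝ T) :
    trace b T = trace b fun u v => T v u := by
  rw [hb.trace_eq_sum (a := dualVec b) (c := Module.finBasis ℝ E) hb.sum_apply_dualVec_smul hT]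
  rfl

theorem trace_self : trace b (fun u v => b u v) = Module.finrank ℝ E := by
  unfold trace
  have h : ∀ i, b (Module.finBasis ℝ E i) (dualVec b i) = 1 := fun i => by
    rw [hb.symm, hb.apply_dualVec]
    simp
  simp [h]

theorem trace_rank_one {L : E → G} (hL : IsLinearMap ℝ L) (w : E) :
    trace b (fun u v => b w u • L v) = L w := by
  have h : ∀ v, L v = hL.mk' L v := fun _ => rfl
  conv_rhs => rw [← hb.sum_apply_smul_dualVec w]
  simp only [trace, h, map_sum, map_smul]

end IsInner

theorem trace_add (b : E →L[ℝ] E →L[ℝ] ℝ) (S T : E → E → G) :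
    trace b (fun u v => S u v + T u v) = trace b S + trace b T :=
  Finset.sum_add_distrib

theorem trace_sub (b : E →L[ℝ] E →L[ℝ] ℝ) (S T : E → E → G) :
    trace b (fun u v => S u v - T u v) = trace b S - trace b T :=
  Finset.sum_sub_distrib ..

theorem trace_smul (b : E →L[ℝ] E →L[ℝ] ℝ) (r : ℝ) (T : E → E → G) :
    trace b (fun u v => r • T u v) = r • trace b T :=
  Finset.smul_sum.symm

theorem trace_mul_left (b : E →L[ℝ] E →L[ℝ] ℝ) (r : ℝ) (T : E → E → ℝ) :
    trace b (fun u v => r * T u v) = r * trace b T :=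
  trace_smul b r T

theorem map_trace {G' : Type*} [NormedAddCommGroup G'] [NormedSpace ℝ G'] (L : G →L[ℝ] G')
    (b : E →L[ℝ] E →L[ℝ] ℝ) (T : E → E → G) :
    L (trace b T) = trace b fun u v => L (T u v) := by
  simp [trace]

theorem raise_add (b : E →L[ℝ] E →L[ℝ] ℝ) (α β : E → ℝ) :
    raise b (fun w => α w + β w) = raise b α + raise b β := by
  simp [raise, add_smul, Finset.sum_add_distrib]

theorem raise_smul (b : E →L[ℝ] E →L[ℝ] ℝ) (r : ℝ) (α : E → ℝ) :
    raise b (fun w => r * α w) = r • raise b α := by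
  simp [raise, mul_smul, Finset.smul_sum]

theorem contDiffAt_dualVec {g : F → E →L[ℝ] E →L[ℝ] ℝ} {x : F} (hg : ContDiffAt ℝ ∞ g x)
    (hx : IsInner (g x)) (i : Fin (Module.finrank ℝ E)) :
    ContDiffAt ℝ ∞ (fun z => dualVec (g z) i) x := by
  have : CompleteSpace E := FiniteDimensional.complete ℝ E
  unfold dualVec
  exact (hx.isInvertible.contDiffAt_map_inverse.comp x hg).clm_apply contDiffAt_const

theorem contDiffAt_raise {g : F → E →L[ℝ] E →L[ℝ] ℝ} {x : F} (hg : ContDiffAt ℝ ∞ g x)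
    (hx : IsInner (g x)) {α : F → E → ℝ} (hα : ∀ w, ContDiffAt ℝ ∞ (fun z => α z w) x) :
    ContDiffAt ℝ ∞ (fun z => raise (g z) (α z)) x :=
  ContDiffAt.sum fun i _ => (hα _).smul (contDiffAt_dualVec hg hx i)

theorem contDiffAt_trace {g : F → E →L[ℝ] E →L[ℝ] ℝ} {x : F} (hg : ContDiffAt ℝ ∞ g x)
    (hx : IsInner (g x)) {T : F → E → E → G} (hT : ∀ᶠ z in nhds x, IsBilinearMap ℝ (T z))
    (hα : ∀ u v, ContDiffAt ℝ ∞ (fun z => T z u v) x) :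
    ContDiffAt ℝ ∞ (fun z => trace (g z) (T z)) x := by
  refine ContDiffAt.sum fun i _ => ?_
  -- The moving dual vector is expanded in the fixed basis, so that smoothness of `T` on constant
  -- vectors suffices. Bilinearity is only needed near `x`.
  have h : (fun z => T z (Module.finBasis ℝ E i) (dualVec (g z) i)) =ᶠ[nhds x] fun z =>
      ∑ j, (Module.finBasis ℝ E).coord j (dualVec (g z) i) •
        T z (Module.finBasis ℝ E i) (Module.finBasis ℝ E j) := by
    filter_upwards [hT] with z hz
    have h' : ∀ u v, T z u v = hz.toLinearMap u v := fun _ _ => rfl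
    conv_lhs => rw [← (Module.finBasis ℝ E).sum_repr (dualVec (g z) i)]
    simp only [h', map_sum, map_smul, Module.Basis.coord_apply]
  refine ContDiffAt.congr_of_eventuallyEq ?_ h
  refine ContDiffAt.sum fun j _ => ContDiffAt.smul ?_ (hα _ _)
  exact (LinearMap.toContinuousLinearMap ((Module.finBasis ℝ E).coord j)).contDiff.contDiffAt.comp
    x (contDiffAt_dualVec hg hx i)

end Coord

namespace Coord

variable {E : Type*} [NormedAddCommGroup E] [NormedSpace ℝ E] [FiniteDimensional ℝ E]
  {F : Type*} [NormedAddCommGroup F] [NormedSpace ℝ F] [FiniteDimensional ℝ F]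
  {G : Type*} [NormedAddCommGroup G] [NormedSpace ℝ G]
  {G' : Type*} [NormedAddCommGroup G'] [NormedSpace ℝ G']
  {G'' : Type*} [NormedAddCommGroup G''] [NormedSpace ℝ G'']

/-! ### Calculus helpers -/

/-- A basis of `E` identifies linear maps out of `E` with finite tuples in `G`. This is how fields
known only through their values on constant vectors become smooth as fields of maps. -/
theorem contDiffAt_clm_of_apply {L : F → E →L[ℝ] G} {x : F}
    (h : ∀ v, ContDiffAt ℝ ∞ (fun z => L z v) x) : ContDiffAt ℝ ∞ L x := by
  let d := Module.finrank ℝ E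
  have hd : d = Module.finrank ℝ (Fin d → ℝ) := (Module.finrank_fin_fun ℝ).symm
  let e₁ := ContinuousLinearEquiv.ofFinrankEq hd
  let e₂ := (e₁.arrowCongr (1 : G ≃L[ℝ] G)).trans (ContinuousLinearEquiv.piRing (Fin d))
  rw [← Function.id_comp L, ← e₂.symm_comp_self]
  exact e₂.symm.contDiff.contDiffAt.comp x (contDiffAt_pi.mpr fun i => h _)

theorem contDiffAt_clm₂_of_apply {E' : Type*} [NormedAddCommGroup E'] [NormedSpace ℝ E']
    [FiniteDimensional ℝ E'] {L : F → E →L[ℝ] E' →L[ℝ] G} {x : F}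
    (h : ∀ u v, ContDiffAt ℝ ∞ (fun z => L z u v) x) : ContDiffAt ℝ ∞ L x :=
  contDiffAt_clm_of_apply fun u => contDiffAt_clm_of_apply fun v => h u v

theorem fderiv_fderiv_comm {f : E → G} {x : E} (hf : ContDiffAt ℝ ∞ f x) (u v : E) :
    fderiv ℝ (fderiv ℝ f) x u v = fderiv ℝ (fderiv ℝ f) x v u :=
  (hf.isSymmSndFDerivAt (by simpa using ENat.LEInfty.out)) u v

theorem differentiableAt_of_smooth {f : E → G} {x : E} (hf : ContDiffAt ℝ ∞ f x) :
    DifferentiableAt ℝ f x := hf.differentiableAt (by simp)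

theorem contDiffAt_fderiv {f : E → G} {x : E} (hf : ContDiffAt ℝ ∞ f x) :
    ContDiffAt ℝ ∞ (fderiv ℝ f) x := hf.fderiv_right (by simp)

theorem contDiffAt_fderiv_apply {f : E → G} {x : E} (hf : ContDiffAt ℝ ∞ f x) (v : E) :
    ContDiffAt ℝ ∞ (fun z => fderiv ℝ f z v) x :=
  (contDiffAt_fderiv hf).clm_apply contDiffAt_const

theorem fderiv_apply_const {L : E → G →L[ℝ] G'} {x : E} (hL : DifferentiableAt ℝ L x) (u : E)
    (v : G) : fderiv ℝ (fun z => L z v) x u = fderiv ℝ L x u v := by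
  rw [fderiv_clm_apply hL (differentiableAt_const v)]
  simp

theorem fderiv_apply_field {L : E → G →L[ℝ] G'} {a : E → G} {x : E}
    (hL : DifferentiableAt ℝ L x) (ha : DifferentiableAt ℝ a x) (u : E) :
    fderiv ℝ (fun z => L z (a z)) x u = fderiv ℝ L x u (a x) + L x (fderiv ℝ a x u) := by
  rw [fderiv_clm_apply hL ha]
  simp [add_comm]

theorem fderiv_apply_field₂ {L : E → G →L[ℝ] G' →L[ℝ] G''} {a : E → G} {c : E → G'} {x : E}
    (hL : DifferentiableAt ℝ L x) (ha : DifferentiableAt ℝ a x) (hc : DifferentiableAt ℝ c x)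
    (u : E) :
    fderiv ℝ (fun z => L z (a z) (c z)) x u =
      fderiv ℝ L x u (a x) (c x) + L x (fderiv ℝ a x u) (c x) + L x (a x) (fderiv ℝ c x u) := by
  rw [fderiv_apply_field (hL.clm_apply ha) hc, fderiv_apply_field hL ha]
  simp

/-! ### The Levi-Civita connection and its curvature in coordinates -/

theorem isBilinearMap_christoffel (g : E → E →L[ℝ] E →L[ℝ] ℝ) (y : E) :
    IsBilinearMap ℝ (christoffel g y) where
  add_left u₁ u₂ v := by
    unfold christoffel
    rw [← raise_add]
    congr 1; ext w
    simp only [map_add, add_apply]; ring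
  smul_left r u v := by
    unfold christoffel
    rw [← raise_smul]
    congr 1; ext w
    simp only [map_smul, smul_apply, smul_eq_mul]; ring
  add_right u v₁ v₂ := by
    unfold christoffel
    rw [← raise_add]
    congr 1; ext w
    simp only [map_add, add_apply]; ring
  smul_right r u v := by
    unfold christoffel
    rw [← raise_smul]
    congr 1; ext w
    simp only [map_smul, smul_apply, smul_eq_mul]; ring

/-- The Christoffel symbols as a field of continuous bilinear maps. -/
def chr (g : E → E →L[ℝ] E →L[ℝ] ℝ) (y : E) : E →L[ℝ] E →L[ℝ] E :=
  (isBilinearMap_christoffel g y).toContinuousBilinearMap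

theorem christoffel_eq (g : E → E →L[ℝ] E →L[ℝ] ℝ) (y u v : E) :
    christoffel g y u v = chr g y u v := rfl

/-- `g` is a smooth Riemannian metric on the open set `U`. -/
structure IsMetricOn (g : E → E →L[ℝ] E →L[ℝ] ℝ) (U : Set E) : Prop where
  isOpen : IsOpen U
  smooth : ∀ x ∈ U, ContDiffAt ℝ ∞ g x
  inner : ∀ x ∈ U, IsInner (g x)

namespace IsMetricOn

variable {g : E → E →L[ℝ] E →L[ℝ] ℝ} {U : Set E} (hg : IsMetricOn g U) {x : E} (hx : x ∈ U)

include hg hx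

theorem eventually_mem : ∀ᶠ z in nhds x, z ∈ U := hg.isOpen.mem_nhds hx

theorem differentiableAt : DifferentiableAt ℝ g x := differentiableAt_of_smooth (hg.smooth x hx)

theorem fderiv_symm (u v w : E) : fderiv ℝ g x u v w = fderiv ℝ g x u w v := by
  have h : ∀ v w, fderiv ℝ (fun z => g z v w) x u = fderiv ℝ g x u v w := fun v w => by
    rw [fderiv_apply_field₂ (hg.differentiableAt hx) (differentiableAt_const v)
      (differentiableAt_const w)]
    simp
  rw [← h, ← h]
  congr 1
  refine Filter.EventuallyEq.fderiv_eq ?_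
  filter_upwards [hg.eventually_mem hx] with z hz
  exact (hg.inner z hz).symm v w

theorem apply_chr (u v w : E) :
    g x (chr g x u v) w =
      (fderiv ℝ g x u v w + fderiv ℝ g x v u w - fderiv ℝ g x w u v) / 2 := by
  rw [← christoffel_eq]
  refine (hg.inner x hx).apply_raise ⟨fun a b => ?_, fun r a => ?_⟩ w
  · simp only [map_add, add_apply]; ring
  · simp only [map_smul, smul_apply, smul_eq_mul]; ring

theorem chr_symm (u v : E) : chr g x u v = chr g x v u := by
  refine (hg.inner x hx).ext fun w => ?_
  rw [hg.apply_chr hx, hg.apply_chr hx, hg.fderiv_symm hx w u v]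
  ring

theorem compat (u v w : E) :
    fderiv ℝ g x u v w = g x (chr g x u v) w + g x v (chr g x u w) := by
  rw [(hg.inner x hx).symm v, hg.apply_chr hx, hg.apply_chr hx, hg.fderiv_symm hx u w v,
    hg.fderiv_symm hx v u w, hg.fderiv_symm hx w u v]
  ring

theorem smooth_chr : ContDiffAt ℝ ∞ (chr g) x := by
  refine contDiffAt_clm₂_of_apply fun u v => ?_
  have h : ∀ u v w, ContDiffAt ℝ ∞ (fun z => fderiv ℝ g z u v w) x := fun u v w =>
    ((contDiffAt_fderiv_apply (hg.smooth x hx) u).clm_apply contDiffAt_const).clm_apply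
      contDiffAt_const
  have h' := contDiffAt_raise (hg.smooth x hx) (hg.inner x hx)
    (α := fun z w => (fderiv ℝ g z u v w + fderiv ℝ g z v u w - fderiv ℝ g z w u v) / 2)
    fun w => (((h u v w).add (h v u w)).sub (h w u v)).div_const 2
  exact h'

theorem curvature_eq (u v w : E) :
    curvature g x u v w = fderiv ℝ (chr g) x u v w - fderiv ℝ (chr g) x v u w
      + chr g x u (chr g x v w) - chr g x v (chr g x u w) := by
  have h : ∀ u v w, fderiv ℝ (fun z => christoffel g z v w) x u = fderiv ℝ (chr g) x u v w := by
    intro u v w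
    simp only [christoffel_eq]
    rw [fderiv_apply_field₂ (differentiableAt_of_smooth (hg.smooth_chr hx))
      (differentiableAt_const v) (differentiableAt_const w)]
    simp
  unfold curvature
  rw [h, h]
  rfl

theorem curvature_swap (u v w : E) : curvature g x u v w = -curvature g x v u w := by
  rw [hg.curvature_eq hx, hg.curvature_eq hx]
  abel

theorem fderiv_chr_symm (u v w : E) : fderiv ℝ (chr g) x u v w = fderiv ℝ (chr g) x u w v := by
  have h : ∀ v w, fderiv ℝ (fun z => chr g z v w) x u = fderiv ℝ (chr g) x u v w := fun v w => by
    rw [fderiv_apply_field₂ (differentiableAt_of_smooth (hg.smooth_chr hx))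
      (differentiableAt_const v) (differentiableAt_const w)]
    simp
  rw [← h, ← h]
  congr 1
  refine Filter.EventuallyEq.fderiv_eq ?_
  filter_upwards [hg.eventually_mem hx] with z hz
  exact hg.chr_symm hz v w

/-- Vanishing torsion is the symmetry of the Christoffel symbols and of their derivatives; with it
the cyclic sum cancels in pairs. -/
theorem bianchi (u v w : E) :
    curvature g x u v w + curvature g x v w u + curvature g x w u v = 0 := by
  rw [hg.curvature_eq hx, hg.curvature_eq hx, hg.curvature_eq hx,
    hg.fderiv_chr_symm hx u w v, hg.fderiv_chr_symm hx v u w, hg.fderiv_chr_symm hx w v u,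
    hg.chr_symm hx w v, hg.chr_symm hx w u, hg.chr_symm hx v u]
  abel

end IsMetricOn

/-- `covDerivAlong` in terms of the bundled Christoffel symbols. -/
theorem covDerivAlong_eq (h : F → F →L[ℝ] F →L[ℝ] ℝ) (ψ V : E → F) (x u : E) :
    covDerivAlong h ψ V x u = fderiv ℝ V x u + chr h (ψ x) (fderiv ℝ ψ x u) (V x) := rfl

/-! ### The pulled-back connection along a map -/

section Along

variable {h : F → F →L[ℝ] F →L[ℝ] ℝ} {U : Set F} (hh : IsMetricOn h U) {ψ : E → F} {x : E}
  (hψ : ContDiffAt ℝ ∞ ψ x) (hx : ψ x ∈ U)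

theorem covDerivAlong_add_dir (V : E → F) (u v : E) :
    covDerivAlong h ψ V x (u + v) = covDerivAlong h ψ V x u + covDerivAlong h ψ V x v := by
  simp only [covDerivAlong_eq, map_add, add_apply]; abel

theorem covDerivAlong_smul_dir (V : E → F) (r : ℝ) (u : E) :
    covDerivAlong h ψ V x (r • u) = r • covDerivAlong h ψ V x u := by
  simp only [covDerivAlong_eq, map_smul, smul_apply, smul_add]

theorem covDerivAlong_add {V W : E → F} (hV : DifferentiableAt ℝ V x)
    (hW : DifferentiableAt ℝ W x) (u : E) :
    covDerivAlong h ψ (fun z => V z + W z) x u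
      = covDerivAlong h ψ V x u + covDerivAlong h ψ W x u := by
  simp only [covDerivAlong_eq]
  rw [fderiv_fun_add hV hW]
  simp only [map_add, add_apply]; abel

theorem covDerivAlong_sub {V W : E → F} (hV : DifferentiableAt ℝ V x)
    (hW : DifferentiableAt ℝ W x) (u : E) :
    covDerivAlong h ψ (fun z => V z - W z) x u
      = covDerivAlong h ψ V x u - covDerivAlong h ψ W x u := by
  simp only [covDerivAlong_eq]
  rw [fderiv_fun_sub hV hW]
  simp only [map_sub, sub_apply]; abel

theorem covDerivAlong_const_smul {V : E → F} (r : ℝ) (u : E) :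
    covDerivAlong h ψ (fun z => r • V z) x u = r • covDerivAlong h ψ V x u := by
  simp only [covDerivAlong_eq]
  have : fderiv ℝ (fun z => r • V z) x = r • fderiv ℝ V x :=
    congrFun (fderiv_const_smul_field (f := V) r) x
  rw [this]
  simp only [map_smul, smul_apply, smul_add]

theorem covDerivAlong_smul {V : E → F} {a : E → ℝ} (ha : DifferentiableAt ℝ a x)
    (hV : DifferentiableAt ℝ V x) (u : E) :
    covDerivAlong h ψ (fun z => a z • V z) x u
      = fderiv ℝ a x u • V x + a x • covDerivAlong h ψ V x u := by
  simp only [covDerivAlong_eq]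
  rw [fderiv_fun_smul ha hV]
  simp only [map_smul, smul_apply, add_apply, smul_add, ContinuousLinearMap.smulRight_apply]
  abel

theorem covDerivAlong_congr {V W : E → F} (hVW : V =ᶠ[nhds x] W) (u : E) :
    covDerivAlong h ψ V x u = covDerivAlong h ψ W x u := by
  simp only [covDerivAlong_eq, hVW.fderiv_eq, hVW.eq_of_nhds]

include hh hψ hx

theorem smooth_covDerivAlong {V : E → F} (hV : ContDiffAt ℝ ∞ V x) (u : E) :
    ContDiffAt ℝ ∞ (fun z => covDerivAlong h ψ V z u) x :=
  (contDiffAt_fderiv_apply hV u).add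
    ((((hh.smooth_chr hx).comp x hψ).clm_apply (contDiffAt_fderiv_apply hψ u)).clm_apply hV)

/-- The connection is metric. -/
theorem fderiv_metric_along {V W : E → F} (hV : DifferentiableAt ℝ V x)
    (hW : DifferentiableAt ℝ W x) (u : E) :
    fderiv ℝ (fun z => h (ψ z) (V z) (W z)) x u
      = h (ψ x) (covDerivAlong h ψ V x u) (W x) + h (ψ x) (V x) (covDerivAlong h ψ W x u) := by
  have hψ' := differentiableAt_of_smooth hψ
  have hd := differentiableAt_of_smooth (hh.smooth _ hx)
  have hd' : DifferentiableAt ℝ (fun z => h (ψ z)) x := hd.comp x hψ'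
  rw [fderiv_apply_field₂ hd' hV hW]
  have : fderiv ℝ (fun z => h (ψ z)) x u = fderiv ℝ h (ψ x) (fderiv ℝ ψ x u) := by
    have := fderiv_comp x hd hψ'
    exact congrArg (fun L => L u) this
  rw [this, hh.compat hx]
  simp only [covDerivAlong_eq, map_add, add_apply]
  ring

/-- The curvature of the pulled-back connection. -/
theorem covDerivAlong_comm {V : E → F} (hV : ContDiffAt ℝ ∞ V x) (u v : E) :
    covDerivAlong h ψ (fun z => covDerivAlong h ψ V z v) x u
      - covDerivAlong h ψ (fun z => covDerivAlong h ψ V z u) x v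
      = curvature h (ψ x) (fderiv ℝ ψ x u) (fderiv ℝ ψ x v) (V x) := by
  have hψ' := differentiableAt_of_smooth hψ
  have hV' := differentiableAt_of_smooth hV
  have hc := differentiableAt_of_smooth (hh.smooth_chr hx)
  -- Once the second covariant derivative is expanded, the second derivatives of `V` and `ψ` and the
  -- two cross terms form a part symmetric in `u`, `v`. Antisymmetrizing leaves only the coordinate
  -- expression of the curvature.
  have key : ∀ u v, covDerivAlong h ψ (fun z => covDerivAlong h ψ V z v) x u
      = fderiv ℝ (fderiv ℝ V) x u v
        + (fderiv ℝ (chr h) (ψ x) (fderiv ℝ ψ x u) (fderiv ℝ ψ x v) (V x)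
          + chr h (ψ x) (fderiv ℝ (fderiv ℝ ψ) x u v) (V x)
          + chr h (ψ x) (fderiv ℝ ψ x v) (fderiv ℝ V x u))
        + (chr h (ψ x) (fderiv ℝ ψ x u) (fderiv ℝ V x v)
          + chr h (ψ x) (fderiv ℝ ψ x u) (chr h (ψ x) (fderiv ℝ ψ x v) (V x))) := by
    intro u v
    rw [covDerivAlong_eq]
    simp only [covDerivAlong_eq]
    have e1 : DifferentiableAt ℝ (fun z => fderiv ℝ V z v) x :=
      differentiableAt_of_smooth (contDiffAt_fderiv_apply hV v)
    have e2 : DifferentiableAt ℝ (fun z => chr h (ψ z)) x := hc.comp x hψ'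
    have e3 : DifferentiableAt ℝ (fun z => fderiv ℝ ψ z v) x :=
      differentiableAt_of_smooth (contDiffAt_fderiv_apply hψ v)
    rw [fderiv_fun_add e1 ((e2.clm_apply e3).clm_apply hV'), add_apply,
      fderiv_apply_field₂ e2 e3 hV',
      fderiv_apply_const (differentiableAt_of_smooth (contDiffAt_fderiv hV)),
      fderiv_apply_const (differentiableAt_of_smooth (contDiffAt_fderiv hψ))]
    have : fderiv ℝ (fun z => chr h (ψ z)) x u = fderiv ℝ (chr h) (ψ x) (fderiv ℝ ψ x u) := by
      have := fderiv_comp x hc hψ'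
      exact congrArg (fun L => L u) this
    rw [this, map_add]
  rw [key, key, hh.curvature_eq hx, fderiv_fderiv_comm hV u v, fderiv_fderiv_comm hψ u v]
  abel

end Along

/-! ### Algebraic symmetries of the curvature tensor -/

namespace IsMetricOn

variable {g : E → E →L[ℝ] E →L[ℝ] ℝ} {U : Set E} (hg : IsMetricOn g U) {x : E} (hx : x ∈ U)

include hg hx

/-- For constant `w`, `z` the function g(w, z) has a symmetric second derivative. Metricity expands
that derivative; the cross terms are symmetric, and what remains says that R(u, v) is skew. The
connection itself is treated as the one along the identity map. -/
theorem curvature_skew (u v w z : E) :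
    g x (curvature g x u v w) z = -g x (curvature g x u v z) w := by
  have hs : ∀ y, ContDiffAt ℝ ∞ (id : E → E) y := fun y => contDiffAt_id
  have hc : ∀ (w y : E), ContDiffAt ℝ ∞ (fun _ : E => w) y := fun w y => contDiffAt_const
  set a : E → ℝ := fun y => g (id y) w z with ha
  have ha_s : ContDiffAt ℝ ∞ a x :=
    ((hg.smooth x hx).clm_apply contDiffAt_const).clm_apply contDiffAt_const
  have h1 : ∀ v, (fun y => fderiv ℝ a y v) =ᶠ[nhds x] fun y =>
      g (id y) (covDerivAlong g id (fun _ => w) y v) z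
        + g (id y) w (covDerivAlong g id (fun _ => z) y v) := fun v => by
    filter_upwards [hg.eventually_mem hx] with y hy
    exact fderiv_metric_along hg (hs y) hy (differentiableAt_const w) (differentiableAt_const z) v
  have hD : ∀ w v, ContDiffAt ℝ ∞ (fun y => covDerivAlong g id (fun _ => w) y v) x := fun w v =>
    smooth_covDerivAlong hg (hs x) hx (hc w x) v
  have hD' := fun w v => differentiableAt_of_smooth (hD w v)
  have h2 : ∀ u v, fderiv ℝ (fderiv ℝ a) x u v =
      (g x (covDerivAlong g id (fun y => covDerivAlong g id (fun _ => w) y v) x u) z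
        + g x (covDerivAlong g id (fun _ => w) x v) (covDerivAlong g id (fun _ => z) x u))
      + (g x (covDerivAlong g id (fun _ => w) x u) (covDerivAlong g id (fun _ => z) x v)
        + g x w (covDerivAlong g id (fun y => covDerivAlong g id (fun _ => z) y v) x u)) := by
    intro u v
    rw [← fderiv_apply_const (differentiableAt_of_smooth (contDiffAt_fderiv ha_s)),
      (h1 v).fderiv_eq, fderiv_fun_add, add_apply,
      fderiv_metric_along hg (hs x) hx (hD' w v) (differentiableAt_const z),
      fderiv_metric_along hg (hs x) hx (differentiableAt_const w) (hD' z v)]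
    · rfl
    · exact ((hg.differentiableAt hx).clm_apply (hD' w v)).clm_apply (differentiableAt_const z)
    · exact ((hg.differentiableAt hx).clm_apply (differentiableAt_const w)).clm_apply (hD' z v)
  have h3 := fderiv_fderiv_comm ha_s u v
  rw [h2, h2] at h3
  have c1 := covDerivAlong_comm hg (hs x) hx (hc w x) u v
  have c2 := covDerivAlong_comm hg (hs x) hx (hc z x) u v
  simp only [fderiv_id, ContinuousLinearMap.id_apply, id] at c1 c2
  rw [← c1, ← c2, (hg.inner x hx).symm _ w]
  simp only [map_sub, sub_apply]
  linarith

/-- The classical octahedron argument: four Bianchi identities combined with the two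
skew-symmetries. -/
theorem curvature_pair (u v w z : E) :
    g x (curvature g x u v w) z = g x (curvature g x w z u) v := by
  have b : ∀ u v w z, g x (curvature g x u v w) z + g x (curvature g x v w u) z
      + g x (curvature g x w u v) z = 0 := fun u v w z => by
    rw [← add_apply, ← map_add, ← add_apply, ← map_add, hg.bianchi hx]; simp
  have s : ∀ u v w z, g x (curvature g x u v w) z = -g x (curvature g x v u w) z :=
    fun u v w z => by rw [hg.curvature_swap hx]; simp
  have k := hg.curvature_skew hx
  linarith [b u v w z, b v w z u, b w z u v, b z u v w, k u v w z, k v w u z, k w u v z,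
    k v w z u, k w z u v, k z u v w, k u v z w, s w u v z, s z v w u, s u w z v, s v z u w,
    k w z v u, k z v w u, k u w z v, k v z u w, s u v w z, s v w u z, s w z u v, s z u v w,
    k u w v z, s u w v z, k v z w u, s v z w u]

theorem curvature_add_left (u u' v w : E) :
    curvature g x (u + u') v w = curvature g x u v w + curvature g x u' v w := by
  simp only [hg.curvature_eq hx, map_add, add_apply]; abel

theorem curvature_smul_left (r : ℝ) (u v w : E) :
    curvature g x (r • u) v w = r • curvature g x u v w := by
  simp only [hg.curvature_eq hx, map_smul, smul_apply, smul_add, smul_sub]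

theorem curvature_add_mid (u v v' w : E) :
    curvature g x u (v + v') w = curvature g x u v w + curvature g x u v' w := by
  simp only [hg.curvature_eq hx, map_add, add_apply]; abel

theorem curvature_smul_mid (r : ℝ) (u v w : E) :
    curvature g x u (r • v) w = r • curvature g x u v w := by
  simp only [hg.curvature_eq hx, map_smul, smul_apply, smul_add, smul_sub]

theorem curvature_add_right (u v w w' : E) :
    curvature g x u v (w + w') = curvature g x u v w + curvature g x u v w' := by
  simp only [hg.curvature_eq hx, map_add]; abel

theorem curvature_smul_right (r : ℝ) (u v w : E) :
    curvature g x u v (r • w) = r • curvature g x u v w := by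
  simp only [hg.curvature_eq hx, map_smul, smul_add, smul_sub]

theorem curvature_self (u w : E) : curvature g x u u w = 0 := by
  rw [hg.curvature_eq hx]; abel

end IsMetricOn

end Coord

namespace Coord

variable {E : Type*} [NormedAddCommGroup E] [NormedSpace ℝ E] [FiniteDimensional ℝ E]
  {F : Type*} [NormedAddCommGroup F] [NormedSpace ℝ F] [FiniteDimensional ℝ F]

/-! ### Isometric immersions in coordinates -/

/-- `ψ` is an isometric immersion of `(U, g)` in `(U', h)`. -/
structure IsIsometricOn (g : E → E →L[ℝ] E →L[ℝ] ℝ) (h : F → F →L[ℝ] F →L[ℝ] ℝ) (ψ : E → F)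
    (U : Set E) (U' : Set F) : Prop where
  source : IsMetricOn g U
  target : IsMetricOn h U'
  smooth : ∀ x ∈ U, ContDiffAt ℝ ∞ ψ x
  mapsTo : ∀ x ∈ U, ψ x ∈ U'
  iso : ∀ x ∈ U, ∀ u v, g x u v = h (ψ x) (fderiv ℝ ψ x u) (fderiv ℝ ψ x v)

/-- The second fundamental form as a field of continuous bilinear maps. -/
def sffL (g : E → E →L[ℝ] E →L[ℝ] ℝ) (h : F → F →L[ℝ] F →L[ℝ] ℝ) (ψ : E → F) (x : E) :
    E →L[ℝ] E →L[ℝ] F :=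
  fderiv ℝ (fderiv ℝ ψ) x + (chr h (ψ x)).bilinearComp (fderiv ℝ ψ x) (fderiv ℝ ψ x)
    - (ContinuousLinearMap.compL ℝ E E F (fderiv ℝ ψ x)).comp (chr g x)

theorem sffL_apply (g : E → E →L[ℝ] E →L[ℝ] ℝ) (h : F → F →L[ℝ] F →L[ℝ] ℝ) (ψ : E → F)
    (x u v : E) :
    sffL g h ψ x u v = fderiv ℝ (fderiv ℝ ψ) x u v
      + chr h (ψ x) (fderiv ℝ ψ x u) (fderiv ℝ ψ x v) - fderiv ℝ ψ x (chr g x u v) := rfl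

theorem tension_eq_smul_meanCurv (g : E → E →L[ℝ] E →L[ℝ] ℝ) (h : F → F →L[ℝ] F →L[ℝ] ℝ)
    (ψ : E → F) (x : E) :
    tension g h ψ x = (Module.finrank ℝ E : ℝ) • meanCurv g h ψ x := by
  unfold tension meanCurv
  rw [smul_smul]
  -- In dimension zero the factor `1 / 0` is `0`, which does no harm because the trace is an empty
  -- sum.
  by_cases hd : Module.finrank ℝ E = 0
  · have : IsEmpty (Fin (Module.finrank ℝ E)) := by rw [hd]; infer_instance
    simp [trace]
  · rw [mul_one_div_cancel (by exact_mod_cast hd), one_smul]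

namespace IsIsometricOn

variable {g : E → E →L[ℝ] E →L[ℝ] ℝ} {h : F → F →L[ℝ] F →L[ℝ] ℝ} {ψ : E → F}
  {U : Set E} {U' : Set F} (S : IsIsometricOn g h ψ U U') {x : E} (hx : x ∈ U)

include S hx

theorem sff_eq (u v : E) : sff g h ψ x u v = sffL g h ψ x u v := by
  rw [sffL_apply, sff, covDerivAlong_eq, christoffel_eq,
    fderiv_apply_const (differentiableAt_of_smooth (contDiffAt_fderiv (S.smooth x hx)))]

theorem sffL_symm (u v : E) : sffL g h ψ x u v = sffL g h ψ x v u := by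
  rw [sffL_apply, sffL_apply, fderiv_fderiv_comm (S.smooth x hx),
    S.target.chr_symm (S.mapsTo x hx), S.source.chr_symm hx]

theorem smooth_dψ (v : E) : ContDiffAt ℝ ∞ (fun z => fderiv ℝ ψ z v) x :=
  contDiffAt_fderiv_apply (S.smooth x hx) v

theorem covDerivAlong_dψ (u v : E) :
    covDerivAlong h ψ (fun z => fderiv ℝ ψ z v) x u
      = sffL g h ψ x u v + fderiv ℝ ψ x (chr g x u v) := by
  rw [← S.sff_eq hx, sff, christoffel_eq]
  abel

/-- Differentiating the isometry condition expresses the derivatives of `g` through ∇_u(dψ v), which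
is symmetric in `u`, `v`. The Koszul formula then shows that the tangential part of ∇_u(dψ v) is
exactly dψ of the intrinsic Christoffel symbol. -/
theorem sffL_normal (u v w : E) : h (ψ x) (sffL g h ψ x u v) (fderiv ℝ ψ x w) = 0 := by
  have hI := (S.target.inner _ (S.mapsTo x hx))
  have key : ∀ u v w, fderiv ℝ g x u v w
      = h (ψ x) (covDerivAlong h ψ (fun z => fderiv ℝ ψ z v) x u) (fderiv ℝ ψ x w)
        + h (ψ x) (fderiv ℝ ψ x v) (covDerivAlong h ψ (fun z => fderiv ℝ ψ z w) x u) := by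
    intro u v w
    rw [← fderiv_metric_along S.target (S.smooth x hx) (S.mapsTo x hx)
      (differentiableAt_of_smooth (S.smooth_dψ hx v))
      (differentiableAt_of_smooth (S.smooth_dψ hx w))]
    have : (fun z => h (ψ z) (fderiv ℝ ψ z v) (fderiv ℝ ψ z w)) =ᶠ[nhds x]
        fun z => g z v w := by
      filter_upwards [S.source.eventually_mem hx] with z hz
      exact (S.iso z hz v w).symm
    rw [this.fderiv_eq, fderiv_apply_field₂ (S.source.differentiableAt hx)
      (differentiableAt_const v) (differentiableAt_const w)]
    simp
  have sym : ∀ u v, covDerivAlong h ψ (fun z => fderiv ℝ ψ z v) x u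
      = covDerivAlong h ψ (fun z => fderiv ℝ ψ z u) x v := fun u v => by
    rw [S.covDerivAlong_dψ hx, S.covDerivAlong_dψ hx, S.sffL_symm hx, S.source.chr_symm hx]
  have e1 : h (ψ x) (sffL g h ψ x u v) (fderiv ℝ ψ x w)
      = h (ψ x) (covDerivAlong h ψ (fun z => fderiv ℝ ψ z v) x u) (fderiv ℝ ψ x w)
        - g x (chr g x u v) w := by
    rw [S.covDerivAlong_dψ hx, S.iso x hx]
    simp only [map_add, add_apply]; ring
  rw [e1, S.source.apply_chr hx, key, key, key, sym v u, sym w v, sym w u, hI.symm _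
    (covDerivAlong h ψ (fun z => fderiv ℝ ψ z w) x u), hI.symm _
    (covDerivAlong h ψ (fun z => fderiv ℝ ψ z w) x v)]
  ring

theorem smooth_sffL : ContDiffAt ℝ ∞ (sffL g h ψ) x := by
  have h1 := contDiffAt_fderiv (S.smooth x hx)
  have h2 := contDiffAt_fderiv h1
  refine contDiffAt_clm₂_of_apply fun u v => ?_
  simp only [sffL_apply]
  refine ((((h2.clm_apply contDiffAt_const).clm_apply contDiffAt_const)).add ?_).sub ?_
  · exact (((S.target.smooth_chr (S.mapsTo x hx)).comp x (S.smooth x hx)).clm_apply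
      (S.smooth_dψ hx u)).clm_apply (S.smooth_dψ hx v)
  · exact h1.clm_apply (((S.source.smooth_chr hx).clm_apply contDiffAt_const).clm_apply
      contDiffAt_const)

theorem apply_tanPart (V : F) (w : E) :
    g x (tanPart g h ψ x V) w = h (ψ x) V (fderiv ℝ ψ x w) :=
  (S.source.inner x hx).apply_raise ⟨fun a b => by simp, fun r a => by simp⟩ w

theorem tanPart_eq {V : F} {u : E} (hu : ∀ w, h (ψ x) V (fderiv ℝ ψ x w) = g x u w) :
    tanPart g h ψ x V = u :=
  (S.source.inner x hx).ext fun w => by rw [S.apply_tanPart hx, hu]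

theorem apply_norPart (V : F) (w : E) : h (ψ x) (norPart g h ψ x V) (fderiv ℝ ψ x w) = 0 := by
  unfold norPart
  rw [map_sub, sub_apply, ← S.iso x hx, S.apply_tanPart hx, sub_self]

theorem tanPart_add (V W : F) :
    tanPart g h ψ x (V + W) = tanPart g h ψ x V + tanPart g h ψ x W :=
  S.tanPart_eq hx fun w => by simp [S.apply_tanPart hx]

theorem tanPart_smul (r : ℝ) (V : F) : tanPart g h ψ x (r • V) = r • tanPart g h ψ x V :=
  S.tanPart_eq hx fun w => by simp [S.apply_tanPart hx]

theorem norPart_add (V W : F) :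
    norPart g h ψ x (V + W) = norPart g h ψ x V + norPart g h ψ x W := by
  unfold norPart
  rw [S.tanPart_add hx, map_add]; abel

theorem norPart_smul (r : ℝ) (V : F) : norPart g h ψ x (r • V) = r • norPart g h ψ x V := by
  unfold norPart
  rw [S.tanPart_smul hx, map_smul, smul_sub]

theorem tanPart_of_normal {V : F} (hV : ∀ w, h (ψ x) V (fderiv ℝ ψ x w) = 0) :
    tanPart g h ψ x V = 0 :=
  S.tanPart_eq hx fun w => by simp [hV]

theorem norPart_of_normal {V : F} (hV : ∀ w, h (ψ x) V (fderiv ℝ ψ x w) = 0) :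
    norPart g h ψ x V = V := by
  unfold norPart
  rw [S.tanPart_of_normal hx hV]; simp

theorem apply_shape (ν : F) (u w : E) :
    g x (shape g h ψ x ν u) w = h (ψ x) (sffL g h ψ x u w) ν := by
  rw [← S.sff_eq hx]
  refine (S.source.inner x hx).apply_raise (α := fun w => h (ψ x) (sff g h ψ x u w) ν)
    ⟨fun a b => ?_, fun r a => ?_⟩ w
  · simp [S.sff_eq hx]
  · simp [S.sff_eq hx]

theorem isBilinearMap_shape : IsBilinearMap ℝ (fun ν u => shape g h ψ x ν u) where
  add_left a b c := (S.source.inner x hx).ext fun w => by simp [S.apply_shape hx]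
  smul_left a b c := (S.source.inner x hx).ext fun w => by simp [S.apply_shape hx]
  add_right a b c := (S.source.inner x hx).ext fun w => by simp [S.apply_shape hx]
  smul_right a b c := (S.source.inner x hx).ext fun w => by simp [S.apply_shape hx]

theorem smooth_shape {ν : E → F} (hν : ContDiffAt ℝ ∞ ν x) (u : E) :
    ContDiffAt ℝ ∞ (fun z => shape g h ψ z (ν z) u) x := by
  have h1 : (fun z => shape g h ψ z (ν z) u) =ᶠ[nhds x]
      fun z => raise (g z) fun w => h (ψ z) (sffL g h ψ z u w) (ν z) := by
    filter_upwards [S.source.eventually_mem hx] with z hz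
    simp only [shape, S.sff_eq hz]
  refine ContDiffAt.congr_of_eventuallyEq ?_ h1
  refine contDiffAt_raise (S.source.smooth x hx) (S.source.inner x hx) fun w => ?_
  exact ((((S.target.smooth _ (S.mapsTo x hx)).comp x (S.smooth x hx)).clm_apply
    (((S.smooth_sffL hx).clm_apply contDiffAt_const).clm_apply contDiffAt_const))).clm_apply hν

theorem smooth_norPart {V : E → F} (hV : ContDiffAt ℝ ∞ V x) :
    ContDiffAt ℝ ∞ (fun z => norPart g h ψ z (V z)) x := by
  refine hV.sub ((contDiffAt_fderiv (S.smooth x hx)).clm_apply ?_)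
  refine contDiffAt_raise (S.source.smooth x hx) (S.source.inner x hx) fun w => ?_
  exact (((S.target.smooth _ (S.mapsTo x hx)).comp x (S.smooth x hx)).clm_apply hV).clm_apply
    (S.smooth_dψ hx w)

theorem smooth_normalDeriv {V : E → F} (hV : ContDiffAt ℝ ∞ V x) (u : E) :
    ContDiffAt ℝ ∞ (fun z => normalDeriv g h ψ V z u) x :=
  S.smooth_norPart hx (smooth_covDerivAlong S.target (S.smooth x hx) (S.mapsTo x hx) hV u)

theorem smooth_meanCurv : ContDiffAt ℝ ∞ (meanCurv g h ψ) x := by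
  refine contDiffAt_const.smul ?_
  refine contDiffAt_trace (S.source.smooth x hx) (S.source.inner x hx) ?_ fun u v => ?_
  · filter_upwards [S.source.eventually_mem hx] with z hz
    constructor <;> intros <;> simp [S.sff_eq hz]
  · have h1 : (fun z => sff g h ψ z u v) =ᶠ[nhds x] fun z => sffL g h ψ z u v := by
      filter_upwards [S.source.eventually_mem hx] with z hz
      exact S.sff_eq hz u v
    exact ContDiffAt.congr_of_eventuallyEq
      (((S.smooth_sffL hx).clm_apply contDiffAt_const).clm_apply contDiffAt_const) h1

theorem meanCurv_normal (w : E) : h (ψ x) (meanCurv g h ψ x) (fderiv ℝ ψ x w) = 0 := by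
  unfold meanCurv trace
  simp [S.sff_eq hx, S.sffL_normal hx]

/-- The Gauss formula for the vector field `dψ Y`. -/
theorem covDerivAlong_dψ_field {Y : E → E} (hY : DifferentiableAt ℝ Y x) (u : E) :
    covDerivAlong h ψ (fun z => fderiv ℝ ψ z (Y z)) x u
      = sffL g h ψ x u (Y x) + fderiv ℝ ψ x (fderiv ℝ Y x u + chr g x u (Y x)) := by
  rw [covDerivAlong_eq,
    fderiv_apply_field (differentiableAt_of_smooth (contDiffAt_fderiv (S.smooth x hx))) hY,
    sffL_apply, map_add]
  abel

/-- The Weingarten formula. -/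
theorem covDerivAlong_normal {ν : E → F} (hν : ContDiffAt ℝ ∞ ν x)
    (hn : ∀ᶠ z in nhds x, ∀ w, h (ψ z) (ν z) (fderiv ℝ ψ z w) = 0) (u : E) :
    covDerivAlong h ψ ν x u
      = normalDeriv g h ψ ν x u - fderiv ℝ ψ x (shape g h ψ x (ν x) u) := by
  have ht : tanPart g h ψ x (covDerivAlong h ψ ν x u) = -shape g h ψ x (ν x) u := by
    refine S.tanPart_eq hx fun w => ?_
    -- The tangential part is read off by differentiating h(ν, dψ w) = 0, with the Gauss formula for
    -- ∇(dψ w).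
    have h0 : (fun z => h (ψ z) (ν z) (fderiv ℝ ψ z w)) =ᶠ[nhds x] fun _ => 0 := by
      filter_upwards [hn] with z hz
      exact hz w
    have h1 := fderiv_metric_along S.target (S.smooth x hx) (S.mapsTo x hx)
      (differentiableAt_of_smooth hν) (differentiableAt_of_smooth (S.smooth_dψ hx w)) u
    rw [h0.fderiv_eq, S.covDerivAlong_dψ hx] at h1
    simp only [fderiv_fun_const, Pi.zero_apply, zero_apply, map_add, hn.self_of_nhds] at h1
    rw [map_neg, neg_apply, S.apply_shape hx, (S.target.inner _ (S.mapsTo x hx)).symm _ (ν x)]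
    linarith
  unfold normalDeriv norPart
  rw [ht]
  simp

theorem normalDeriv_normal (V : E → F) (u w : E) :
    h (ψ x) (normalDeriv g h ψ V x u) (fderiv ℝ ψ x w) = 0 :=
  S.apply_norPart hx _ w

theorem isLinearMap_normalDeriv (V : E → F) : IsLinearMap ℝ (normalDeriv g h ψ V x) where
  map_add a b := by
    unfold normalDeriv
    rw [covDerivAlong_add_dir, S.norPart_add hx]
  map_smul r a := by
    unfold normalDeriv
    rw [covDerivAlong_smul_dir, S.norPart_smul hx]

/-- The second covariant derivative of a normal field. -/
theorem second_covDerivAlong_normal {ν : E → F} (hν : ∀ z ∈ U, ContDiffAt ℝ ∞ ν z)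
    (hn : ∀ z ∈ U, ∀ w, h (ψ z) (ν z) (fderiv ℝ ψ z w) = 0) (u v : E) :
    covDerivAlong h ψ (fun z => covDerivAlong h ψ ν z v) x u
        - covDerivAlong h ψ ν x (chr g x u v)
      = (normalDeriv g h ψ (fun z => normalDeriv g h ψ ν z v) x u
          - normalDeriv g h ψ ν x (chr g x u v))
        - sffL g h ψ x u (shape g h ψ x (ν x) v)
        - fderiv ℝ ψ x (shape g h ψ x (normalDeriv g h ψ ν x v) u
            + (fderiv ℝ (fun z => shape g h ψ z (ν z) v) x u
              + chr g x u (shape g h ψ x (ν x) v) - shape g h ψ x (ν x) (chr g x u v))) := by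
  have hn' : ∀ z ∈ U, ∀ᶠ z in nhds z, ∀ w, h (ψ z) (ν z) (fderiv ℝ ψ z w) = 0 := fun z hz => by
    filter_upwards [S.source.eventually_mem hz] with y hy
    exact hn y hy
  -- Weingarten is needed on a neighbourhood, since its right-hand side is differentiated again: by
  -- Gauss for the tangential term and by Weingarten for the normal one.
  have h1 : (fun z => covDerivAlong h ψ ν z v) =ᶠ[nhds x] fun z =>
      normalDeriv g h ψ ν z v - fderiv ℝ ψ z (shape g h ψ z (ν z) v) := by
    filter_upwards [S.source.eventually_mem hx] with z hz
    exact S.covDerivAlong_normal hz (hν z hz) (hn' z hz) v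
  have hA := S.smooth_shape hx (hν x hx) v
  have hN := S.smooth_normalDeriv hx (hν x hx) v
  rw [covDerivAlong_congr h1, covDerivAlong_sub (differentiableAt_of_smooth hN)
    (differentiableAt_of_smooth ((contDiffAt_fderiv (S.smooth x hx)).clm_apply hA)),
    S.covDerivAlong_dψ_field hx (differentiableAt_of_smooth hA),
    S.covDerivAlong_normal hx (hν x hx) (hn' x hx),
    S.covDerivAlong_normal hx hN (by
      filter_upwards [S.source.eventually_mem hx] with z hz
      exact S.normalDeriv_normal hz ν v)]
  simp only [map_add, map_sub]
  abel

/-- The covariant derivative of the shape operator. -/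
theorem apply_covDeriv_shape {ν : E → F} (hν : ∀ z ∈ U, ContDiffAt ℝ ∞ ν z)
    (hn : ∀ z ∈ U, ∀ w, h (ψ z) (ν z) (fderiv ℝ ψ z w) = 0) (u v w : E) :
    g x (fderiv ℝ (fun z => shape g h ψ z (ν z) v) x u
        + chr g x u (shape g h ψ x (ν x) v) - shape g h ψ x (ν x) (chr g x u v)) w
      = h (ψ x) (covDerivAlong h ψ (fun z => sffL g h ψ z v w) x u
          - sffL g h ψ x (chr g x u v) w - sffL g h ψ x v (chr g x u w)) (ν x)
        + g x (shape g h ψ x (normalDeriv g h ψ ν x u) v) w := by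
  have hA := differentiableAt_of_smooth (S.smooth_shape hx (hν x hx) v)
  have hB : ContDiffAt ℝ ∞ (fun z => sffL g h ψ z v w) x :=
    ((S.smooth_sffL hx).clm_apply contDiffAt_const).clm_apply contDiffAt_const
  -- The defining identity g(A_ν v, w) = h(B(v, w), ν) is differentiated along `u`; the tangential
  -- part of ∇_u ν drops out against the normal vector B(v, w).
  have h1 : (fun z => g z (shape g h ψ z (ν z) v) w) =ᶠ[nhds x]
      fun z => h (ψ z) (sffL g h ψ z v w) (ν z) := by
    filter_upwards [S.source.eventually_mem hx] with z hz
    exact S.apply_shape hz _ v w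
  have h2 := congrArg (fun L : E →L[ℝ] ℝ => L u) h1.fderiv_eq
  rw [fderiv_metric_along S.target (S.smooth x hx) (S.mapsTo x hx)
    (differentiableAt_of_smooth hB) (differentiableAt_of_smooth (hν x hx)),
    fderiv_apply_field₂ (S.source.differentiableAt hx) hA (differentiableAt_const w),
    S.source.compat hx, S.covDerivAlong_normal hx (hν x hx) (by
      filter_upwards [S.source.eventually_mem hx] with y hy
      exact hn y hy)] at h2
  simp only [fderiv_fun_const, Pi.zero_apply, zero_apply, map_sub, map_zero, S.sffL_normal hx,
    S.apply_shape hx] at h2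
  simp only [map_sub, map_add, sub_apply, add_apply, S.apply_shape hx]
  linarith

/-- The Codazzi equation. -/
theorem codazzi {ν : F} (hn : ∀ w, h (ψ x) ν (fderiv ℝ ψ x w) = 0) (u v w : E) :
    h (ψ x) (covDerivAlong h ψ (fun z => sffL g h ψ z v w) x u
          - sffL g h ψ x (chr g x u v) w - sffL g h ψ x v (chr g x u w)) ν
      = h (ψ x) (covDerivAlong h ψ (fun z => sffL g h ψ z u v) x w
          - sffL g h ψ x (chr g x w u) v - sffL g h ψ x u (chr g x w v)) ν
        + h (ψ x) (curvature h (ψ x) (fderiv ℝ ψ x u) (fderiv ℝ ψ x w) (fderiv ℝ ψ x v)) ν := by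
  have hchr : ∀ a b, ContDiffAt ℝ ∞ (fun z => chr g z a b) x := fun a b =>
    ((S.source.smooth_chr hx).clm_apply contDiffAt_const).clm_apply contDiffAt_const
  have hD : ∀ a b, ContDiffAt ℝ ∞ (fun z => covDerivAlong h ψ (fun y => fderiv ℝ ψ y b) z a) x :=
    fun a b => smooth_covDerivAlong S.target (S.smooth x hx) (S.mapsTo x hx)
      (S.smooth_dψ hx b) a
  -- Writing B(b, e) = ∇_b(dψ e) - dψ(∇_b e) turns the derivative of B into a second covariant
  -- derivative of dψ e; pairing with the normal `ν` keeps only the B term of the Gauss formula.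
  have key : ∀ a b e, h (ψ x) (covDerivAlong h ψ (fun z => sffL g h ψ z b e) x a) ν
      = h (ψ x) (covDerivAlong h ψ
          (fun z => covDerivAlong h ψ (fun y => fderiv ℝ ψ y e) z b) x a) ν
        - h (ψ x) (sffL g h ψ x a (chr g x b e)) ν := by
    intro a b e
    have h1 : (fun z => sffL g h ψ z b e) =ᶠ[nhds x] fun z =>
        covDerivAlong h ψ (fun y => fderiv ℝ ψ y e) z b - fderiv ℝ ψ z (chr g z b e) := by
      filter_upwards [S.source.eventually_mem hx] with z hz
      rw [S.covDerivAlong_dψ hz]; abel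
    rw [covDerivAlong_congr h1, covDerivAlong_sub (differentiableAt_of_smooth (hD b e))
      (differentiableAt_of_smooth ((contDiffAt_fderiv (S.smooth x hx)).clm_apply (hchr b e))),
      S.covDerivAlong_dψ_field hx (differentiableAt_of_smooth (hchr b e))]
    simp only [map_sub, map_add, sub_apply, add_apply]
    have := hn (fderiv ℝ (fun z => chr g z b e) x a + chr g x a (chr g x b e))
    rw [(S.target.inner _ (S.mapsTo x hx)).symm, map_add, map_add, add_apply] at this
    linarith
  -- The symmetry of B brings `w` to the slot of a differentiation direction, so that exchanging `u`
  -- and `w` commutes two covariant derivatives of dψ v and produces the curvature.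
  have hs : (fun z => sffL g h ψ z v w) =ᶠ[nhds x] fun z => sffL g h ψ z w v := by
    filter_upwards [S.source.eventually_mem hx] with z hz
    exact S.sffL_symm hz v w
  rw [covDerivAlong_congr hs, ← covDerivAlong_comm S.target (S.smooth x hx) (S.mapsTo x hx)
    (S.smooth_dψ hx v) u w]
  simp only [map_sub, sub_apply, key]
  rw [S.sffL_symm hx v (chr g x u w), S.source.chr_symm hx w u, S.source.chr_symm hx w v,
    S.source.chr_symm hx v w, S.sffL_symm hx (chr g x u v) w]
  ring

/-- The covariant derivative commutes with the trace. -/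
theorem covDerivAlong_trace_sff (w : E) :
    covDerivAlong h ψ (tension g h ψ) x w
      = trace (g x) fun u v => covDerivAlong h ψ (fun z => sffL g h ψ z u v) x w
          - sffL g h ψ x (chr g x w u) v - sffL g h ψ x u (chr g x w v) := by
  have hI := S.source.inner x hx
  have hdual : ∀ i, ContDiffAt ℝ ∞ (fun z => dualVec (g z) i) x := fun i =>
    contDiffAt_dualVec (S.source.smooth x hx) hI i
  have h1 : tension g h ψ =ᶠ[nhds x] fun z =>
      ∑ i, sffL g h ψ z (Module.finBasis ℝ E i) (dualVec (g z) i) := by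
    filter_upwards [S.source.eventually_mem hx] with z hz
    unfold tension trace
    simp only [S.sff_eq hz]
  have hB : ∀ u, ContDiffAt ℝ ∞ (fun z => sffL g h ψ z u) x := fun u =>
    (S.smooth_sffL hx).clm_apply contDiffAt_const
  -- The derivative of the dual frame comes from differentiating g(e^i, v) = v^i, whose right-hand
  -- side is constant.
  have h2 : ∀ i, fderiv ℝ (fun z => dualVec (g z) i) x w
      = -chr g x w (dualVec (g x) i)
        - ∑ j, g x (dualVec (g x) i) (chr g x w (Module.finBasis ℝ E j)) • dualVec (g x) j := by
    intro i
    refine hI.ext fun v => ?_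
    have h3 : (fun z => g z (dualVec (g z) i) v) =ᶠ[nhds x]
        fun _ => (Module.finBasis ℝ E).coord i v := by
      filter_upwards [S.source.eventually_mem hx] with z hz
      exact (S.source.inner z hz).apply_dualVec i v
    have h4 := congrArg (fun L : E →L[ℝ] ℝ => L w) h3.fderiv_eq
    rw [fderiv_apply_field₂ (S.source.differentiableAt hx) (differentiableAt_of_smooth (hdual i))
      (differentiableAt_const v), S.source.compat hx] at h4
    simp only [fderiv_fun_const, Pi.zero_apply, zero_apply, map_zero, add_zero] at h4
    have h5 : g x (∑ j, g x (dualVec (g x) i) (chr g x w (Module.finBasis ℝ E j))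
        • dualVec (g x) j) v = g x (dualVec (g x) i) (chr g x w v) := by
      conv_rhs => rw [← (Module.finBasis ℝ E).sum_repr v]
      simp only [map_sum, map_smul, sum_apply, smul_apply, smul_eq_mul, hI.apply_dualVec,
        Module.Basis.coord_apply]
      exact Finset.sum_congr rfl fun j _ => mul_comm _ _
    rw [map_sub, sub_apply, h5, map_neg, neg_apply]
    linarith
  -- The resolution of the identity moves the Christoffel term from the dual slot to the basis slot,
  -- where it is the correction of the first argument of B.
  have h6 : ∑ i, sffL g h ψ x (Module.finBasis ℝ E i) (∑ j, g x (dualVec (g x) i)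
      (chr g x w (Module.finBasis ℝ E j)) • dualVec (g x) j)
      = ∑ j, sffL g h ψ x (chr g x w (Module.finBasis ℝ E j)) (dualVec (g x) j) := by
    simp only [map_sum, map_smul]
    rw [Finset.sum_comm]
    refine Finset.sum_congr rfl fun j _ => ?_
    conv_rhs => rw [← hI.sum_apply_dualVec_smul (chr g x w (Module.finBasis ℝ E j))]
    simp only [map_sum, map_smul, sum_apply, smul_apply]
    exact Finset.sum_congr rfl fun i _ => by rw [hI.symm]
  rw [covDerivAlong_congr h1]
  have h7 : fderiv ℝ (fun z => ∑ i, sffL g h ψ z (Module.finBasis ℝ E i) (dualVec (g z) i)) x w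
      = ∑ i, (fderiv ℝ (fun z => sffL g h ψ z (Module.finBasis ℝ E i)) x w (dualVec (g x) i)
        + sffL g h ψ x (Module.finBasis ℝ E i) (fderiv ℝ (fun z => dualVec (g z) i) x w)) := by
    rw [fderiv_fun_sum fun i _ => (differentiableAt_of_smooth (hB _)).clm_apply
      (differentiableAt_of_smooth (hdual i)), sum_apply]
    exact Finset.sum_congr rfl fun i _ => fderiv_apply_field (differentiableAt_of_smooth (hB _))
      (differentiableAt_of_smooth (hdual i)) w
  rw [covDerivAlong_eq, h7]
  unfold trace
  simp only [covDerivAlong_eq, h2, map_sub, map_neg, Finset.sum_add_distrib,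
    Finset.sum_sub_distrib, Finset.sum_neg_distrib]
  rw [h6, map_sum]
  have h8 : ∀ u v, fderiv ℝ (fun z => sffL g h ψ z u v) x w
      = fderiv ℝ (fun z => sffL g h ψ z u) x w v := fun u v =>
    fderiv_apply_const (differentiableAt_of_smooth (hB u)) w v
  simp only [h8]
  abel

end IsIsometricOn

end Coord

namespace Coord

variable {E : Type*} [NormedAddCommGroup E] [NormedSpace ℝ E] [FiniteDimensional ℝ E]
  {F : Type*} [NormedAddCommGroup F] [NormedSpace ℝ F] [FiniteDimensional ℝ F]

/-! ### The bitension field of an isometric immersion -/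

theorem laplacianAlong_const_smul (g : E → E →L[ℝ] E →L[ℝ] ℝ) (h : F → F →L[ℝ] F →L[ℝ] ℝ)
    (ψ V : E → F) (r : ℝ) (x : E) :
    laplacianAlong g h ψ (fun z => r • V z) x = r • laplacianAlong g h ψ V x := by
  unfold laplacianAlong
  simp only [covDerivAlong_const_smul, ← smul_sub]
  rw [trace_smul, smul_neg]

/-- The trace `trace R(dψ ·, ν) dψ ·`. -/
def traceCurv (g : E → E →L[ℝ] E →L[ℝ] ℝ) (h : F → F →L[ℝ] F →L[ℝ] ℝ) (ψ : E → F) (x : E)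
    (ν : F) : F :=
  trace (g x) fun u v => curvature h (ψ x) (fderiv ℝ ψ x u) ν (fderiv ℝ ψ x v)

namespace IsIsometricOn

variable {g : E → E →L[ℝ] E →L[ℝ] ℝ} {h : F → F →L[ℝ] F →L[ℝ] ℝ} {ψ : E → F}
  {U : Set E} {U' : Set F} (S : IsIsometricOn g h ψ U U') {x : E} (hx : x ∈ U)

include S hx

theorem apply_gradNormSq (w : E) :
    g x (gradNormSq g h ψ (meanCurv g h ψ) x) w
      = 2 * h (ψ x) (covDerivAlong h ψ (meanCurv g h ψ) x w) (meanCurv g h ψ x) := by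
  have hH := differentiableAt_of_smooth (S.smooth_meanCurv hx)
  have h1 : g x (gradNormSq g h ψ (meanCurv g h ψ) x) w
      = fderiv ℝ (fun z => h (ψ z) (meanCurv g h ψ z) (meanCurv g h ψ z)) x w :=
    (S.source.inner x hx).apply_raise ⟨fun a b => by simp, fun r a => by simp⟩ w
  rw [h1, fderiv_metric_along S.target (S.smooth x hx) (S.mapsTo x hx) hH hH,
    (S.target.inner _ (S.mapsTo x hx)).symm (meanCurv g h ψ x)]
  ring

theorem isBilinearMap_curvature_dψ (ν : F) : IsBilinearMap ℝ fun u v =>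
    curvature h (ψ x) (fderiv ℝ ψ x u) ν (fderiv ℝ ψ x v) where
  add_left a b c := by rw [map_add, S.target.curvature_add_left (S.mapsTo x hx)]
  smul_left a b c := by rw [map_smul, S.target.curvature_smul_left (S.mapsTo x hx)]
  add_right a b c := by rw [map_add, S.target.curvature_add_right (S.mapsTo x hx)]
  smul_right a b c := by rw [map_smul, S.target.curvature_smul_right (S.mapsTo x hx)]

/-- The divergence of the shape operator of the mean curvature vector field. -/
theorem trace_covDeriv_shape_meanCurv :
    trace (g x) (fun u v => fderiv ℝ (fun z => shape g h ψ z (meanCurv g h ψ z) v) x u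
        + chr g x u (shape g h ψ x (meanCurv g h ψ x) v)
        - shape g h ψ x (meanCurv g h ψ x) (chr g x u v))
      = ((Module.finrank ℝ E : ℝ) / 2) • gradNormSq g h ψ (meanCurv g h ψ) x
        + tanPart g h ψ x (traceCurv g h ψ x (meanCurv g h ψ x))
        + traceShapeNormalDeriv g h ψ (meanCurv g h ψ) x := by
  set H := meanCurv g h ψ with hH
  have hI := S.source.inner x hx
  have hI' := S.target.inner _ (S.mapsTo x hx)
  refine hI.ext fun w => ?_
  have e0 : ∀ T : E → E → E, g x (trace (g x) T) w = trace (g x) fun u v => g x (T u v) w :=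
    fun T => by
      have := map_trace ((g x).flip w) (g x) T
      simpa using this
  have e1 : ∀ T : E → E → F, ∀ ν, h (ψ x) (trace (g x) T) ν
      = trace (g x) fun u v => h (ψ x) (T u v) ν := fun T ν => by
    have := map_trace ((h (ψ x)).flip ν) (g x) T
    simpa using this
  have e2 := S.covDerivAlong_trace_sff hx w
  have e3 : covDerivAlong h ψ (tension g h ψ) x w
      = (Module.finrank ℝ E : ℝ) • covDerivAlong h ψ H x w := by
    rw [← covDerivAlong_const_smul]
    congr 1
    funext z
    exact tension_eq_smul_meanCurv g h ψ z
  have e4 := S.apply_covDeriv_shape hx (ν := H) (fun z hz => S.smooth_meanCurv hz)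
    (fun z hz => S.meanCurv_normal hz)
  have e5 := S.codazzi hx (ν := H x) (S.meanCurv_normal hx)
  rw [e0]
  -- Codazzi makes `w` the direction of differentiation and leaves `u`, `v` as arguments of B. The
  -- trace is then ∇_w τ = d ∇_w H, and pairing with H yields (d/2) w|H|².
  simp only [fun u v => (e4 u v w).trans (congrArg (· + _) (e5 u v w))]
  rw [trace_add, trace_add, ← e1, ← e2, e3, map_add, map_add, add_apply, add_apply,
    map_smul, map_smul, smul_apply, smul_apply, S.apply_gradNormSq hx, S.apply_tanPart hx]
  congr 1
  · congr 1
    · simp only [smul_eq_mul]; ring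
    · unfold traceCurv
      -- Exchanging the traced slots and using pair symmetry matches the Codazzi term R(dψ u, dψ
      -- w)dψ v against H with R(dψ ·, H)dψ · against dψ w.
      rw [hI.trace_comm (S.isBilinearMap_curvature_dψ hx (H x)), e1]
      congr 1
      funext u v
      rw [S.target.curvature_pair (S.mapsTo x hx)]
  · unfold traceShapeNormalDeriv
    rw [e0]

/-- The rough Laplacian of the mean curvature vector field. -/
theorem neg_laplacianAlong_meanCurv :
    -laplacianAlong g h ψ (meanCurv g h ψ) x
      = normalLaplacian g h ψ (meanCurv g h ψ) x - traceSffShape g h ψ x (meanCurv g h ψ x)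
        - fderiv ℝ ψ x ((2 : ℝ) • traceShapeNormalDeriv g h ψ (meanCurv g h ψ) x
          + ((Module.finrank ℝ E : ℝ) / 2) • gradNormSq g h ψ (meanCurv g h ψ) x
          + tanPart g h ψ x (traceCurv g h ψ x (meanCurv g h ψ x))) := by
  have hI := S.source.inner x hx
  -- The second derivative produces A_{∇^⊥_v H} u, with the slots opposite to those of
  -- `traceShapeNormalDeriv`; bilinearity allows the exchange.
  have hb : IsBilinearMap ℝ fun u v =>
      shape g h ψ x (normalDeriv g h ψ (meanCurv g h ψ) x v) u := by
    have hs := S.isBilinearMap_shape hx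
    have hn := S.isLinearMap_normalDeriv hx (meanCurv g h ψ)
    constructor
    · intro a b c; exact hs.add_right _ _ _
    · intro a b c; exact hs.smul_right _ _ _
    · intro a b c; rw [hn.map_add]; exact hs.add_left _ _ _
    · intro a b c; rw [hn.map_smul]; exact hs.smul_left _ _ _
  unfold laplacianAlong
  rw [neg_neg]
  simp only [christoffel_eq]
  simp only [S.second_covDerivAlong_normal hx (fun z hz => S.smooth_meanCurv hz)
    (fun z hz => S.meanCurv_normal hz)]
  rw [trace_sub, trace_sub, ← map_trace, trace_add, hI.trace_comm hb,
    S.trace_covDeriv_shape_meanCurv hx]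
  unfold traceSffShape normalLaplacian
  simp only [S.sff_eq hx, christoffel_eq]
  congr 2
  unfold traceShapeNormalDeriv
  -- One copy of this trace comes from Weingarten, the other from the divergence of the shape
  -- operator.
  rw [two_smul]
  abel

/-- The tangential and normal parts of the bitension field. -/
theorem bitension_eq :
    bitension g h ψ x = (Module.finrank ℝ E : ℝ) •
      ((normalLaplacian g h ψ (meanCurv g h ψ) x - traceSffShape g h ψ x (meanCurv g h ψ x)
          - norPart g h ψ x (traceCurv g h ψ x (meanCurv g h ψ x)))
        + fderiv ℝ ψ x ((-2 : ℝ) • traceShapeNormalDeriv g h ψ (meanCurv g h ψ) x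
          - ((Module.finrank ℝ E : ℝ) / 2) • gradNormSq g h ψ (meanCurv g h ψ) x
          - (2 : ℝ) • tanPart g h ψ x (traceCurv g h ψ x (meanCurv g h ψ x)))) := by
  have h1 : tension g h ψ = fun z => (Module.finrank ℝ E : ℝ) • meanCurv g h ψ z :=
    funext (tension_eq_smul_meanCurv g h ψ)
  unfold bitension
  rw [h1]
  simp only [S.target.curvature_smul_mid (S.mapsTo x hx)]
  rw [laplacianAlong_const_smul, trace_smul, ← smul_neg, ← smul_sub,
    S.neg_laplacianAlong_meanCurv hx]
  congr 1
  change _ - traceCurv g h ψ x (meanCurv g h ψ x) = _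
  -- The tangential curvature trace already present in the Laplacian is joined by the one in the
  -- curvature term of τ₂, whence the factor 2.
  have h2 : norPart g h ψ x (traceCurv g h ψ x (meanCurv g h ψ x))
      = traceCurv g h ψ x (meanCurv g h ψ x)
        - fderiv ℝ ψ x (tanPart g h ψ x (traceCurv g h ψ x (meanCurv g h ψ x))) := rfl
  rw [h2]
  simp only [map_add, map_sub, map_smul]
  module

/-- The bitension field vanishes iff its normal and tangential parts do. -/
theorem bitension_eq_zero_iff (hd : Module.finrank ℝ E ≠ 0) :
    bitension g h ψ x = 0 ↔
      normalLaplacian g h ψ (meanCurv g h ψ) x = traceSffShape g h ψ x (meanCurv g h ψ x)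
          + norPart g h ψ x (traceCurv g h ψ x (meanCurv g h ψ x)) ∧
      (-2 : ℝ) • traceShapeNormalDeriv g h ψ (meanCurv g h ψ) x
          - ((Module.finrank ℝ E : ℝ) / 2) • gradNormSq g h ψ (meanCurv g h ψ) x
          - (2 : ℝ) • tanPart g h ψ x (traceCurv g h ψ x (meanCurv g h ψ x)) = 0 := by
  have hI := S.source.inner x hx
  set N := normalLaplacian g h ψ (meanCurv g h ψ) x with hN
  set B := traceSffShape g h ψ x (meanCurv g h ψ x) with hB
  set R := norPart g h ψ x (traceCurv g h ψ x (meanCurv g h ψ x)) with hR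
  set t := (-2 : ℝ) • traceShapeNormalDeriv g h ψ (meanCurv g h ψ) x
          - ((Module.finrank ℝ E : ℝ) / 2) • gradNormSq g h ψ (meanCurv g h ψ) x
          - (2 : ℝ) • tanPart g h ψ x (traceCurv g h ψ x (meanCurv g h ψ x)) with ht
  have e1 : bitension g h ψ x = (Module.finrank ℝ E : ℝ) • ((N - B - R) + fderiv ℝ ψ x t) :=
    S.bitension_eq hx
  have hn : ∀ w, h (ψ x) (N - B - R) (fderiv ℝ ψ x w) = 0 := by
    intro w
    have n1 : h (ψ x) N (fderiv ℝ ψ x w) = 0 := by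
      rw [hN, normalLaplacian, trace, map_sum, sum_apply]
      refine Finset.sum_eq_zero fun i _ => ?_
      rw [map_sub, sub_apply, S.normalDeriv_normal hx, S.normalDeriv_normal hx, sub_zero]
    have n2 : h (ψ x) B (fderiv ℝ ψ x w) = 0 := by
      rw [hB, traceSffShape, trace, map_sum, sum_apply]
      refine Finset.sum_eq_zero fun i _ => ?_
      rw [S.sff_eq hx, S.sffL_normal hx]
    have n3 : h (ψ x) R (fderiv ℝ ψ x w) = 0 := S.apply_norPart hx _ w
    simp only [map_sub, sub_apply, n1, n2, n3, sub_zero]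
  have hd' : (Module.finrank ℝ E : ℝ) ≠ 0 := by exact_mod_cast hd
  rw [e1, smul_eq_zero_iff_right hd']
  constructor
  · intro h0
    -- Pairing with dψ w annihilates the normal summand and isolates `t`.
    have ht0 : t = 0 := hI.ext fun w => by
      have := congrArg (fun V => h (ψ x) V (fderiv ℝ ψ x w)) h0
      simp only [map_add, add_apply, hn, zero_add, map_zero, zero_apply] at this
      rw [S.iso x hx, this]; simp
    refine ⟨?_, ht0⟩
    rw [ht0, map_zero, add_zero, sub_sub] at h0
    exact sub_eq_zero.1 h0
  · rintro ⟨h1, h2⟩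
    rw [h1, h2]; simp

end IsIsometricOn

end Coord

namespace Coord

variable {E : Type*} [NormedAddCommGroup E] [NormedSpace ℝ E] [FiniteDimensional ℝ E]
  {F : Type*} [NormedAddCommGroup F] [NormedSpace ℝ F] [FiniteDimensional ℝ F]

/-! ### Hypersurfaces -/

/-- In codimension one a nonzero normal `ν` completes a tangent frame to an ambient one, and the
term it adds to the trace is a multiple of R(ν, ν)ν = 0. -/
theorem IsIsometricOn.traceCurv_eq_of_hypersurface {g : E → E →L[ℝ] E →L[ℝ] ℝ}
    {h : F → F →L[ℝ] F →L[ℝ] ℝ} {ψ : E → F} {U : Set E} {U' : Set F}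
    (S : IsIsometricOn g h ψ U U') {x : E} (hx : x ∈ U)
    (hdim : Module.finrank ℝ F = Module.finrank ℝ E + 1) {ν : F}
    (hν : ∀ w, h (ψ x) ν (fderiv ℝ ψ x w) = 0) :
    traceCurv g h ψ x ν = trace (h (ψ x)) fun u v => curvature h (ψ x) u ν v := by
  have hy := S.mapsTo x hx
  have hI := S.source.inner x hx
  have hI' := S.target.inner _ hy
  by_cases h0 : ν = 0
  · have : ∀ u v, curvature h (ψ x) u ν v = 0 := fun u v => by
      simpa [h0] using S.target.curvature_smul_mid hy 0 u 0 v
    simp [traceCurv, trace, this]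
  have hpos := hI'.pos ν h0
  -- The splitting of the ambient space into tangent space and normal line; a dimension count
  -- upgrades injectivity to surjectivity.
  let L : (E × ℝ) →ₗ[ℝ] F :=
    (fderiv ℝ ψ x : E →ₗ[ℝ] F).coprod (LinearMap.toSpanSingleton ℝ F ν)
  have hL : ∀ p, L p = fderiv ℝ ψ x p.1 + p.2 • ν := fun p => by simp [L]
  have hLinj : Function.Injective L := by
    rw [injective_iff_map_eq_zero]
    intro p hp
    rw [hL] at hp
    have h1 : p.2 = 0 := by
      have := congrArg (h (ψ x) ν) hp
      rw [map_add, hν, map_smul, map_zero, zero_add, smul_eq_mul] at this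
      exact (mul_eq_zero.1 this).resolve_right hpos.ne'
    have h2 : p.1 = 0 := hI.ext fun w => by
      rw [h1, zero_smul, add_zero] at hp
      rw [S.iso x hx, hp]; simp
    exact Prod.ext h2 h1
  have hLsurj : Function.Surjective L :=
    (LinearMap.injective_iff_surjective_of_finrank_eq_finrank (by simp [hdim])).1 hLinj
  let a : Option (Fin (Module.finrank ℝ E)) → F := fun o =>
    o.elim ν fun i => fderiv ℝ ψ x (Module.finBasis ℝ E i)
  -- The dual frame carries the factor 1/h(ν, ν), so `ν` need not be normalized.
  let c : Option (Fin (Module.finrank ℝ E)) → F := fun o =>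
    o.elim ((h (ψ x) ν ν)⁻¹ • ν) fun i => fderiv ℝ ψ x (dualVec (g x) i)
  have hb : IsBilinearMap ℝ fun u v => curvature h (ψ x) u ν v :=
    ⟨fun _ _ _ => S.target.curvature_add_left hy .., fun _ _ _ => S.target.curvature_smul_left hy ..,
      fun _ _ _ => S.target.curvature_add_right hy ..,
      fun _ _ _ => S.target.curvature_smul_right hy ..⟩
  rw [hI'.trace_eq_sum (a := a) (c := c) ?_ hb, Fintype.sum_option]
  · have : curvature h (ψ x) (a none) ν (c none) = 0 := S.target.curvature_self hy _ _
    rw [this, zero_add]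
    rfl
  · intro V
    rw [Fintype.sum_option]
    have h1 : ∑ i, h (ψ x) V (a (some i)) • c (some i) = fderiv ℝ ψ x (tanPart g h ψ x V) := by
      simp [a, c, tanPart, raise]
    rw [h1]
    refine hI'.ext fun W => ?_
    obtain ⟨p, rfl⟩ := hLsurj W
    rw [hL]
    simp only [a, c, Option.elim_none, map_add, add_apply, map_smul, smul_apply, smul_eq_mul, hν]
    rw [← S.iso x hx, S.apply_tanPart hx, hI'.symm (fderiv ℝ ψ x _) ν, hν, hI'.symm V ν]
    field_simp
    ring

/-! ### Warped products -/

variable {E₁ : Type*} [NormedAddCommGroup E₁] [NormedSpace ℝ E₁] [FiniteDimensional ℝ E₁]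
  {E₂ : Type*} [NormedAddCommGroup E₂] [NormedSpace ℝ E₂] [FiniteDimensional ℝ E₂]

/-- The warped product metric in coordinates. -/
def warp (g₁ : E₁ → E₁ →L[ℝ] E₁ →L[ℝ] ℝ) (g₂ : E₂ → E₂ →L[ℝ] E₂ →L[ℝ] ℝ) (f : E₁ → ℝ)
    (y : E₁ × E₂) : (E₁ × E₂) →L[ℝ] (E₁ × E₂) →L[ℝ] ℝ :=
  (g₁ y.1).bilinearComp (ContinuousLinearMap.fst ℝ E₁ E₂) (ContinuousLinearMap.fst ℝ E₁ E₂)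
    + f y.1 ^ 2 •
      (g₂ y.2).bilinearComp (ContinuousLinearMap.snd ℝ E₁ E₂) (ContinuousLinearMap.snd ℝ E₁ E₂)

theorem warp_apply (g₁ : E₁ → E₁ →L[ℝ] E₁ →L[ℝ] ℝ) (g₂ : E₂ → E₂ →L[ℝ] E₂ →L[ℝ] ℝ) (f : E₁ → ℝ)
    (y a b : E₁ × E₂) :
    warp g₁ g₂ f y a b = g₁ y.1 a.1 b.1 + f y.1 ^ 2 * g₂ y.2 a.2 b.2 := rfl

/-- The data of a warped product metric on `U₁ × U₂`. -/
structure IsWarpedOn (g₁ : E₁ → E₁ →L[ℝ] E₁ →L[ℝ] ℝ) (g₂ : E₂ → E₂ →L[ℝ] E₂ →L[ℝ] ℝ)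
    (f : E₁ → ℝ) (U₁ : Set E₁) (U₂ : Set E₂) : Prop where
  fst : IsMetricOn g₁ U₁
  snd : IsMetricOn g₂ U₂
  smooth : ∀ x ∈ U₁, ContDiffAt ℝ ∞ f x
  pos : ∀ x ∈ U₁, 0 < f x

theorem IsMetricOn.apply_grad {g : E → E →L[ℝ] E →L[ℝ] ℝ} {U : Set E} (hg : IsMetricOn g U)
    {x : E} (hx : x ∈ U) (a : E → ℝ) (w : E) : g x (grad g a x) w = fderiv ℝ a x w :=
  (hg.inner x hx).apply_raise ⟨fun a b => by simp, fun r a => by simp⟩ w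

theorem IsMetricOn.smooth_grad {g : E → E →L[ℝ] E →L[ℝ] ℝ} {U : Set E} (hg : IsMetricOn g U)
    {x : E} (hx : x ∈ U) {a : E → ℝ} (ha : ContDiffAt ℝ ∞ a x) : ContDiffAt ℝ ∞ (grad g a) x :=
  contDiffAt_raise (hg.smooth x hx) (hg.inner x hx) fun w => contDiffAt_fderiv_apply ha w

theorem covDerivGrad_eq (g : E → E →L[ℝ] E →L[ℝ] ℝ) (a : E → ℝ) (y u : E) :
    covDerivGrad g a y u = fderiv ℝ (grad g a) y u + chr g y u (grad g a y) := rfl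

theorem fderiv_comp_fst {G : Type*} [NormedAddCommGroup G] [NormedSpace ℝ G] {a : E₁ → G}
    {y : E₁ × E₂} (ha : DifferentiableAt ℝ a y.1) (u : E₁ × E₂) :
    fderiv ℝ (fun z : E₁ × E₂ => a z.1) y u = fderiv ℝ a y.1 u.1 := by
  have : fderiv ℝ (fun z : E₁ × E₂ => a z.1) y
      = (fderiv ℝ a y.1).comp (ContinuousLinearMap.fst ℝ E₁ E₂) :=
    (ha.hasFDerivAt.comp y hasFDerivAt_fst).fderiv
  rw [this]; rfl

theorem fderiv_comp_snd {G : Type*} [NormedAddCommGroup G] [NormedSpace ℝ G] {a : E₂ → G}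
    {y : E₁ × E₂} (ha : DifferentiableAt ℝ a y.2) (u : E₁ × E₂) :
    fderiv ℝ (fun z : E₁ × E₂ => a z.2) y u = fderiv ℝ a y.2 u.2 := by
  have : fderiv ℝ (fun z : E₁ × E₂ => a z.2) y
      = (fderiv ℝ a y.2).comp (ContinuousLinearMap.snd ℝ E₁ E₂) :=
    (ha.hasFDerivAt.comp y hasFDerivAt_snd).fderiv
  rw [this]; rfl

theorem fderiv_comp_fst_prod_zero {a : E₁ → E₁} {y : E₁ × E₂} (ha : DifferentiableAt ℝ a y.1)
    (u : E₁ × E₂) :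
    fderiv ℝ (fun z : E₁ × E₂ => (a z.1, (0 : E₂))) y u = (fderiv ℝ a y.1 u.1, 0) := by
  have h1 : DifferentiableAt ℝ (fun z : E₁ × E₂ => a z.1) y := ha.comp y differentiableAt_fst
  rw [h1.fderiv_prodMk (differentiableAt_const 0)]
  simp [fderiv_comp_fst ha]

namespace IsWarpedOn

variable {g₁ : E₁ → E₁ →L[ℝ] E₁ →L[ℝ] ℝ} {g₂ : E₂ → E₂ →L[ℝ] E₂ →L[ℝ] ℝ} {f : E₁ → ℝ}
  {U₁ : Set E₁} {U₂ : Set E₂} (W : IsWarpedOn g₁ g₂ f U₁ U₂)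

include W

theorem smooth_f_fst {y : E₁ × E₂} (hy : y ∈ U₁ ×ˢ U₂) :
    ContDiffAt ℝ ∞ (fun z : E₁ × E₂ => f z.1) y := (W.smooth _ hy.1).comp y contDiffAt_fst

theorem isMetricOn : IsMetricOn (warp g₁ g₂ f) (U₁ ×ˢ U₂) where
  isOpen := W.fst.isOpen.prod W.snd.isOpen
  smooth y hy := by
    refine contDiffAt_clm₂_of_apply fun u v => ?_
    simp only [warp_apply]
    have h1 : ContDiffAt ℝ ∞ (fun z : E₁ × E₂ => g₁ z.1) y :=
      (W.fst.smooth _ hy.1).comp y contDiffAt_fst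
    have h2 : ContDiffAt ℝ ∞ (fun z : E₁ × E₂ => g₂ z.2) y :=
      (W.snd.smooth _ hy.2).comp y contDiffAt_snd
    exact ((h1.clm_apply contDiffAt_const).clm_apply contDiffAt_const).add
      (((W.smooth_f_fst hy).pow 2).mul
        ((h2.clm_apply contDiffAt_const).clm_apply contDiffAt_const))
  inner y hy := by
    have i1 := W.fst.inner _ hy.1
    have i2 := W.snd.inner _ hy.2
    have hf := W.pos _ hy.1
    refine ⟨fun u v => ?_, fun u hu => ?_⟩
    · rw [warp_apply, warp_apply, i1.symm, i2.symm]
    · rw [warp_apply]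
      have n1 : 0 ≤ g₁ y.1 u.1 u.1 := by
        by_cases h : u.1 = 0
        · simp [h]
        · exact (i1.pos _ h).le
      by_cases h : u.2 = 0
      · have : u.1 ≠ 0 := fun h' => hu (Prod.ext h' h)
        have := i1.pos _ this
        simpa [h] using this
      · have := i2.pos _ h
        positivity

theorem fderiv_warp {y : E₁ × E₂} (hy : y ∈ U₁ ×ˢ U₂) (a b c : E₁ × E₂) :
    fderiv ℝ (warp g₁ g₂ f) y a b c = fderiv ℝ g₁ y.1 a.1 b.1 c.1
      + 2 * f y.1 * fderiv ℝ f y.1 a.1 * g₂ y.2 b.2 c.2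
      + f y.1 ^ 2 * fderiv ℝ g₂ y.2 a.2 b.2 c.2 := by
  have hd := differentiableAt_of_smooth (W.isMetricOn.smooth y hy)
  have h0 := fderiv_apply_field₂ hd (differentiableAt_const b) (differentiableAt_const c) a
  simp only [fderiv_fun_const, Pi.zero_apply, zero_apply, map_zero, add_zero] at h0
  rw [← h0]
  simp only [warp_apply]
  have s1 : DifferentiableAt ℝ (fun z : E₁ => g₁ z b.1 c.1) y.1 :=
    ((W.fst.differentiableAt hy.1).clm_apply (differentiableAt_const _)).clm_apply
      (differentiableAt_const _)
  have s2 : DifferentiableAt ℝ (fun z : E₂ => g₂ z b.2 c.2) y.2 :=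
    ((W.snd.differentiableAt hy.2).clm_apply (differentiableAt_const _)).clm_apply
      (differentiableAt_const _)
  have s3 := differentiableAt_of_smooth (W.smooth _ hy.1)
  have d1 : DifferentiableAt ℝ (fun z : E₁ × E₂ => g₁ z.1 b.1 c.1) y :=
    s1.comp y differentiableAt_fst
  have d2 : DifferentiableAt ℝ (fun z : E₁ × E₂ => g₂ z.2 b.2 c.2) y :=
    s2.comp y differentiableAt_snd
  have d3 : DifferentiableAt ℝ (fun z : E₁ × E₂ => f z.1) y := s3.comp y differentiableAt_fst
  rw [fderiv_fun_add d1 ((d3.fun_pow 2).fun_mul d2), add_apply, fderiv_fun_mul (d3.fun_pow 2) d2,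
    fderiv_comp_fst s1, fderiv_fun_pow _ d3]
  simp only [add_apply, smul_apply, fderiv_comp_fst s3, fderiv_comp_snd s2]
  rw [fderiv_apply_field₂ (W.fst.differentiableAt hy.1) (differentiableAt_const _)
      (differentiableAt_const _),
    fderiv_apply_field₂ (W.snd.differentiableAt hy.2) (differentiableAt_const _)
      (differentiableAt_const _)]
  simp
  ring

/-- O'Neill's connection formulas in one line. Nondegeneracy reduces them to the Koszul identity, in
which the derivative of f² supplies both the grad f term and the df terms. -/
theorem chr_warp {y : E₁ × E₂} (hy : y ∈ U₁ ×ˢ U₂) (a b : E₁ × E₂) :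
    chr (warp g₁ g₂ f) y a b
      = (chr g₁ y.1 a.1 b.1 - (f y.1 * g₂ y.2 a.2 b.2) • grad g₁ f y.1,
        chr g₂ y.2 a.2 b.2
          + (f y.1)⁻¹ • (fderiv ℝ f y.1 a.1 • b.2 + fderiv ℝ f y.1 b.1 • a.2)) := by
  have hf := (W.pos _ hy.1).ne'
  refine (W.isMetricOn.inner y hy).ext fun w => ?_
  rw [W.isMetricOn.apply_chr hy, W.fderiv_warp hy, W.fderiv_warp hy, W.fderiv_warp hy, warp_apply]
  simp only [map_sub, map_add, map_smul, sub_apply, add_apply, smul_apply, smul_eq_mul,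
    W.fst.apply_grad hy.1, W.fst.apply_chr hy.1, W.snd.apply_chr hy.2]
  field_simp
  ring

/-- The leaves M₁ × {pt} are totally geodesic: the Christoffel symbols of horizontal vectors are
those of `g₁`, independently of the second coordinate. -/
theorem curvature_warp_horizontal {y : E₁ × E₂} (hy : y ∈ U₁ ×ˢ U₂) (a X b : E₁) :
    curvature (warp g₁ g₂ f) y (a, 0) (X, 0) (b, 0) = (curvature g₁ y.1 a X b, 0) := by
  have h1 : ∀ a b : E₁, (fun z => christoffel (warp g₁ g₂ f) z (a, 0) (b, 0)) =ᶠ[nhds y]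
      fun z => (chr g₁ z.1 a b, 0) := fun a b => by
    filter_upwards [W.isMetricOn.eventually_mem hy] with z hz
    rw [christoffel_eq, W.chr_warp hz]
    simp
  have h2 : ∀ a b : E₁, chr (warp g₁ g₂ f) y (a, 0) (b, 0) = (chr g₁ y.1 a b, 0) := fun a b =>
    (h1 a b).eq_of_nhds
  have h3 : ∀ a b : E₁, DifferentiableAt ℝ (fun z => chr g₁ z a b) y.1 := fun a b =>
    differentiableAt_of_smooth
      (((W.fst.smooth_chr hy.1).clm_apply contDiffAt_const).clm_apply contDiffAt_const)
  unfold curvature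
  rw [(h1 X b).fderiv_eq, (h1 a b).fderiv_eq, fderiv_comp_fst_prod_zero (h3 X b),
    fderiv_comp_fst_prod_zero (h3 a b)]
  simp only [christoffel_eq, h2, Prod.mk_add_mk, Prod.mk_sub_mk, add_zero, sub_zero]

/-- The Hessian arises from differentiating -f g₂(a, b) grad f along `X`. The accompanying X(f)
term, and the whole vertical component, cancel against the quadratic Christoffel terms. -/
theorem curvature_warp_mixed {y : E₁ × E₂} (hy : y ∈ U₁ ×ˢ U₂) (a b : E₂) (X : E₁) :
    curvature (warp g₁ g₂ f) y (0, a) (X, 0) (0, b)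
      = ((f y.1 * g₂ y.2 a b) • covDerivGrad g₁ f y.1 X, 0) := by
  have hf := (W.pos _ hy.1).ne'
  have h1 : (fun z => christoffel (warp g₁ g₂ f) z (X, 0) (0, b)) =ᶠ[nhds y]
      fun z => (0, ((f z.1)⁻¹ * fderiv ℝ f z.1 X) • b) := by
    filter_upwards [W.isMetricOn.eventually_mem hy] with z hz
    rw [christoffel_eq, W.chr_warp hz]
    simp [smul_smul]
  have h2 : (fun z => christoffel (warp g₁ g₂ f) z (0, a) (0, b)) =ᶠ[nhds y]
      fun z => (-((f z.1 * g₂ z.2 a b) • grad g₁ f z.1), chr g₂ z.2 a b) := by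
    filter_upwards [W.isMetricOn.eventually_mem hy] with z hz
    rw [christoffel_eq, W.chr_warp hz]
    simp
  have sf := differentiableAt_of_smooth (W.smooth _ hy.1)
  have sgr := differentiableAt_of_smooth (W.fst.smooth_grad hy.1 (W.smooth _ hy.1))
  have df : DifferentiableAt ℝ (fun z : E₁ × E₂ => f z.1) y := sf.comp y differentiableAt_fst
  have dgr : DifferentiableAt ℝ (fun z : E₁ × E₂ => grad g₁ f z.1) y :=
    sgr.comp y differentiableAt_fst
  have sg : DifferentiableAt ℝ (fun z => g₂ z a b) y.2 :=
    ((W.snd.differentiableAt hy.2).clm_apply (differentiableAt_const _)).clm_apply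
      (differentiableAt_const _)
  have dg : DifferentiableAt ℝ (fun z : E₁ × E₂ => g₂ z.2 a b) y := sg.comp y differentiableAt_snd
  have sc : DifferentiableAt ℝ (fun z => chr g₂ z a b) y.2 := differentiableAt_of_smooth
    (((W.snd.smooth_chr hy.2).clm_apply contDiffAt_const).clm_apply contDiffAt_const)
  have dc : DifferentiableAt ℝ (fun z : E₁ × E₂ => chr g₂ z.2 a b) y :=
    sc.comp y differentiableAt_snd
  have sk : DifferentiableAt ℝ (fun z => (f z)⁻¹ * fderiv ℝ f z X) y.1 :=
    (sf.inv hf).mul (differentiableAt_of_smooth (contDiffAt_fderiv_apply (W.smooth _ hy.1) X))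
  have dk : DifferentiableAt ℝ (fun z : E₁ × E₂ => ((f z.1)⁻¹ * fderiv ℝ f z.1 X)) y :=
    sk.comp y differentiableAt_fst
  have f1 : fderiv ℝ (fun z : E₁ × E₂ => ((0 : E₁), ((f z.1)⁻¹ * fderiv ℝ f z.1 X) • b)) y (0, a)
      = 0 := by
    rw [(differentiableAt_const (0 : E₁)).fderiv_prodMk (dk.smul_const b),
      fderiv_smul_const dk]
    simp [fderiv_comp_fst sk]
  have f2 : fderiv ℝ (fun z : E₁ × E₂ =>
      (-((f z.1 * g₂ z.2 a b) • grad g₁ f z.1), chr g₂ z.2 a b)) y (X, 0)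
      = (-((fderiv ℝ f y.1 X * g₂ y.2 a b) • grad g₁ f y.1
          + (f y.1 * g₂ y.2 a b) • fderiv ℝ (grad g₁ f) y.1 X), 0) := by
    have dm := (df.fun_mul dg).fun_smul dgr
    rw [dm.fun_neg.fderiv_prodMk dc, fderiv_fun_neg, fderiv_fun_smul (df.fun_mul dg) dgr,
      fderiv_fun_mul df dg]
    simp only [ContinuousLinearMap.prod_apply, neg_apply, add_apply, smul_apply,
      ContinuousLinearMap.smulRight_apply, fderiv_comp_fst sf, fderiv_comp_fst sgr,
      fderiv_comp_snd sg, fderiv_comp_snd sc, map_zero, smul_eq_mul, mul_zero, zero_add]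
    congr 2
    rw [add_comm, mul_comm (g₂ y.2 a b)]
  unfold curvature
  rw [h1.fderiv_eq, h2.fderiv_eq, f1, f2, h1.eq_of_nhds, h2.eq_of_nhds, christoffel_eq,
    christoffel_eq, W.chr_warp hy, W.chr_warp hy, covDerivGrad_eq]
  refine Prod.ext ?_ ?_
  · simp only [map_zero, map_neg, map_smul, zero_apply, zero_sub, Prod.fst_add, Prod.fst_neg,
      Prod.fst_sub, smul_eq_mul, mul_zero, zero_smul, sub_zero, neg_neg, smul_add]
    have : f y.1 * ((f y.1)⁻¹ * fderiv ℝ f y.1 X * g₂ y.2 a b)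
        = fderiv ℝ f y.1 X * g₂ y.2 a b := by
      field_simp
    rw [this]
    abel
  · simp only [map_zero, map_neg, map_smul, zero_apply, Prod.snd_add, Prod.snd_sub, Prod.snd_zero,
      smul_zero, zero_smul, add_zero, zero_add, smul_smul, sub_self, zero_mul, mul_zero]

/-- The gradient of a function of the first factor is horizontal, and horizontal leaves are totally
geodesic. -/
theorem covDerivGrad_warp {y : E₁ × E₂} (hy : y ∈ U₁ ×ˢ U₂) (X : E₁) :
    covDerivGrad (warp g₁ g₂ f) (fun z => f z.1) y (X, 0) = (covDerivGrad g₁ f y.1 X, 0) := by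
  have h1 : grad (warp g₁ g₂ f) (fun z => f z.1) =ᶠ[nhds y] fun z => (grad g₁ f z.1, 0) := by
    filter_upwards [W.isMetricOn.eventually_mem hy] with z hz
    refine (W.isMetricOn.inner z hz).ext fun w => ?_
    rw [W.isMetricOn.apply_grad hz, warp_apply, W.fst.apply_grad hz.1,
      fderiv_comp_fst (differentiableAt_of_smooth (W.smooth _ hz.1))]
    simp
  have sgr := differentiableAt_of_smooth (W.fst.smooth_grad hy.1 (W.smooth _ hy.1))
  rw [covDerivGrad_eq, covDerivGrad_eq, h1.fderiv_eq, h1.eq_of_nhds,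
    fderiv_comp_fst_prod_zero sgr, W.chr_warp hy]
  simp

theorem trace_curvature_warp {y : E₁ × E₂} (hy : y ∈ U₁ ×ˢ U₂) (X : E₁) :
    trace (warp g₁ g₂ f y) (fun u v => curvature (warp g₁ g₂ f) y u (X, 0) v)
      = (trace (g₁ y.1) (fun u v => curvature g₁ y.1 u X v), 0)
        + ((Module.finrank ℝ E₂ : ℝ) / f y.1) •
          covDerivGrad (warp g₁ g₂ f) (fun z => f z.1) y (X, 0) := by
  have hf := (W.pos _ hy.1).ne'
  have hM := W.isMetricOn
  have i1 := W.fst.inner _ hy.1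
  have i2 := W.snd.inner _ hy.2
  let a : Fin (Module.finrank ℝ E₁) ⊕ Fin (Module.finrank ℝ E₂) → E₁ × E₂ :=
    Sum.elim (fun i => (Module.finBasis ℝ E₁ i, 0)) (fun j => (0, Module.finBasis ℝ E₂ j))
  let c : Fin (Module.finrank ℝ E₁) ⊕ Fin (Module.finrank ℝ E₂) → E₁ × E₂ :=
    -- Vertical dual vectors are scaled by f⁻², since the metric there is f² g₂. Against the factor
    -- f of the mixed curvature, each vertical direction contributes 1/f.
    Sum.elim (fun i => (dualVec (g₁ y.1) i, 0))
      (fun j => (0, (f y.1 ^ 2)⁻¹ • dualVec (g₂ y.2) j))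
  have hb : IsBilinearMap ℝ fun u v => curvature (warp g₁ g₂ f) y u (X, 0) v :=
    ⟨fun _ _ _ => hM.curvature_add_left hy .., fun _ _ _ => hM.curvature_smul_left hy ..,
      fun _ _ _ => hM.curvature_add_right hy .., fun _ _ _ => hM.curvature_smul_right hy ..⟩
  rw [(hM.inner y hy).trace_eq_sum (a := a) (c := c) ?_ hb, Fintype.sum_sum_type]
  · simp only [a, c, Sum.elim_inl, Sum.elim_inr, W.curvature_warp_horizontal hy,
      W.curvature_warp_mixed hy]
    rw [W.covDerivGrad_warp hy]
    have h1 : ∀ j, g₂ y.2 (Module.finBasis ℝ E₂ j) ((f y.1 ^ 2)⁻¹ • dualVec (g₂ y.2) j)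
        = (f y.1 ^ 2)⁻¹ := fun j => by
      rw [map_smul, i2.symm, i2.apply_dualVec]
      simp
    simp only [h1]
    congr 1
    · refine Prod.ext ?_ ?_
      · simp [trace, Prod.fst_sum]
      · simp [Prod.snd_sum]
    · rw [Finset.sum_const, Finset.card_univ, Fintype.card_fin]
      refine Prod.ext ?_ ?_
      · simp only [Prod.smul_mk, ← Nat.cast_smul_eq_nsmul ℝ, smul_smul]
        congr 1
        field_simp
      · simp
  · intro V
    rw [Fintype.sum_sum_type]
    simp only [a, c, Sum.elim_inl, Sum.elim_inr, warp_apply, map_zero, mul_zero, add_zero, zero_add,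
      Prod.smul_mk, smul_zero, smul_smul]
    refine Prod.ext ?_ ?_
    · simp only [Prod.fst_add, Prod.fst_sum, Finset.sum_const_zero, add_zero]
      exact i1.sum_apply_smul_dualVec V.1
    · simp only [Prod.snd_add, Prod.snd_sum, Finset.sum_const_zero, zero_add]
      conv_rhs => rw [← i2.sum_apply_smul_dualVec V.2]
      refine Finset.sum_congr rfl fun j _ => ?_
      congr 1
      field_simp

end IsWarpedOn

end Coord

namespace Coord

variable {E : Type*} [NormedAddCommGroup E] [NormedSpace ℝ E] [FiniteDimensional ℝ E]

/-! ### Sasakian structures in coordinates -/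

/-- `(φ, ξ, g(ξ, ·), g)` is an almost contact metric structure on `U` with
`(∇_X φ)Y = g(X, Y)ξ - η(Y)X`. -/
structure IsSasakianOn (g : E → E →L[ℝ] E →L[ℝ] ℝ) (φ : E → E →L[ℝ] E) (ξ : E → E)
    (U : Set E) : Prop where
  metric : IsMetricOn g U
  smooth_phi : ∀ x ∈ U, ContDiffAt ℝ ∞ φ x
  smooth_xi : ∀ x ∈ U, ContDiffAt ℝ ∞ ξ x
  phi_sq : ∀ x ∈ U, ∀ v, φ x (φ x v) = -v + g x (ξ x) v • ξ x
  eta_xi : ∀ x ∈ U, g x (ξ x) (ξ x) = 1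
  eta_phi : ∀ x ∈ U, ∀ v, g x (ξ x) (φ x v) = 0
  compatible : ∀ x ∈ U, ∀ u v,
    g x (φ x u) (φ x v) = g x u v - g x (ξ x) u * g x (ξ x) v
  nabla_phi : ∀ x ∈ U, ∀ u v,
    covDerivEndo g φ x u v = g x u v • ξ x - g x (ξ x) v • u

namespace IsSasakianOn

variable {g : E → E →L[ℝ] E →L[ℝ] ℝ} {φ : E → E →L[ℝ] E} {ξ : E → E} {U : Set E}
  (S : IsSasakianOn g φ ξ U) {x : E} (hx : x ∈ U)

include S hx

theorem phi_xi : φ x (ξ x) = 0 := by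
  by_contra h
  have := (S.metric.inner x hx).pos _ h
  rw [S.compatible x hx, S.eta_xi x hx] at this
  norm_num at this

theorem phi_skew (u v : E) : g x (φ x u) v = -g x u (φ x v) := by
  have h := S.compatible x hx u (φ x v)
  rw [S.phi_sq x hx, S.eta_phi x hx, map_add, map_neg, map_smul,
    (S.metric.inner x hx).symm _ (ξ x), S.eta_phi x hx] at h
  simp at h
  linarith

theorem covDeriv_phi {W : E → E} (hW : DifferentiableAt ℝ W x) (u : E) :
    covDerivAlong g id (fun z => φ z (W z)) x u
      = φ x (covDerivAlong g id W x u) + g x u (W x) • ξ x - g x (ξ x) (W x) • u := by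
  have h1 := S.nabla_phi x hx u (W x)
  rw [covDerivEndo, christoffel_eq, christoffel_eq] at h1
  rw [covDerivAlong_eq, covDerivAlong_eq,
    fderiv_apply_field (differentiableAt_of_smooth (S.smooth_phi x hx)) hW, add_sub_assoc, ← h1,
    map_add]
  simp only [fderiv_id, ContinuousLinearMap.id_apply, id]
  abel

/-- Differentiating φξ = 0 gives φ(∇_u ξ) = u - η(u)ξ. Applying φ recovers ∇_u ξ, because |ξ| = 1
makes it orthogonal to ξ. -/
theorem covDeriv_xi (u : E) : covDerivAlong g id ξ x u = -φ x u := by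
  have hI := S.metric.inner x hx
  have hd := differentiableAt_of_smooth (S.smooth_xi x hx)
  set D := covDerivAlong g id ξ x u with hD
  have h1 : g x (ξ x) D = 0 := by
    have e : (fun z => g (id z) (ξ z) (ξ z)) =ᶠ[nhds x] fun _ => 1 := by
      filter_upwards [S.metric.eventually_mem hx] with z hz
      exact S.eta_xi z hz
    have := fderiv_metric_along S.metric (ψ := id) contDiffAt_id hx hd hd u
    rw [e.fderiv_eq, ← hD] at this
    simp only [fderiv_fun_const, Pi.zero_apply, zero_apply, id] at this
    linarith [hI.symm D (ξ x)]
  have h2 := S.covDeriv_phi hx hd u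
  have e : (fun z => φ z (ξ z)) =ᶠ[nhds x] fun _ => 0 := by
    filter_upwards [S.metric.eventually_mem hx] with z hz
    exact S.phi_xi hz
  rw [covDerivAlong_congr e, S.eta_xi x hx, ← hD, covDerivAlong_eq] at h2
  simp only [fderiv_fun_const, Pi.zero_apply, zero_apply, map_zero, add_zero, one_smul] at h2
  have h3 := congrArg (φ x) h2.symm
  rw [map_sub, map_add, map_smul, S.phi_xi hx, S.phi_sq x hx, h1, map_zero] at h3
  simp only [zero_smul, smul_zero, add_zero] at h3
  rw [sub_eq_zero] at h3
  rw [← h3, neg_neg]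

/-- The Ricci identity for ξ: with ∇ξ = -φ, the commutator of second derivatives is the
antisymmetrization of ∇φ. -/
theorem curvature_xi (u v : E) :
    curvature g x u v (ξ x) = g x (ξ x) v • u - g x (ξ x) u • v := by
  have hI := S.metric.inner x hx
  have h1 : ∀ u v, covDerivAlong g id (fun z => covDerivAlong g id ξ z v) x u
      = -(φ x (chr g x u v) + g x u v • ξ x - g x (ξ x) v • u) := by
    intro u v
    have e : (fun z => covDerivAlong g id ξ z v) =ᶠ[nhds x] fun z => (-1 : ℝ) • φ z v := by
      filter_upwards [S.metric.eventually_mem hx] with z hz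
      rw [S.covDeriv_xi hz]; simp
    rw [covDerivAlong_congr e, covDerivAlong_const_smul,
      S.covDeriv_phi hx (differentiableAt_const v), covDerivAlong_eq]
    simp
  have h2 := covDerivAlong_comm S.metric (ψ := id) contDiffAt_id hx (S.smooth_xi x hx) u v
  simp only [fderiv_id, ContinuousLinearMap.id_apply, id] at h2
  rw [← h2]
  have h3 := h1 u v
  have h4 := h1 v u
  rw [h3, h4, S.metric.chr_symm hx v u, hI.symm v u]
  abel

/-- Differentiating the Sasakian formula for ∇φ once more, with ∇ξ = -φ, and antisymmetrizing: the
failure of R(u, v) to commute with φ is purely metric. -/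
theorem curvature_phi (u v w : E) :
    curvature g x u v (φ x w) = φ x (curvature g x u v w)
      - g x v w • φ x u + g x (φ x u) w • v + g x u w • φ x v - g x (φ x v) w • u := by
  have hI := S.metric.inner x hx
  have hchr : ∀ a b, ContDiffAt ℝ ∞ (fun z => chr g z a b) x := fun a b =>
    ((S.metric.smooth_chr hx).clm_apply contDiffAt_const).clm_apply contDiffAt_const
  have hφ : ContDiffAt ℝ ∞ (fun z => φ z w) x := (S.smooth_phi x hx).clm_apply contDiffAt_const
  have hgc : ∀ v, DifferentiableAt ℝ (fun z => g z v w) x := fun v =>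
    ((S.metric.differentiableAt hx).clm_apply (differentiableAt_const _)).clm_apply
      (differentiableAt_const _)
  have hξ := differentiableAt_of_smooth (S.smooth_xi x hx)
  have hη : DifferentiableAt ℝ (fun z => g z (ξ z) w) x :=
    ((S.metric.differentiableAt hx).clm_apply hξ).clm_apply (differentiableAt_const _)
  have hconst : ∀ a b, covDerivAlong g id (fun _ => b) x a = chr g x a b := fun a b => by
    rw [covDerivAlong_eq]; simp
  have h1 : ∀ u v, covDerivAlong g id (fun z => covDerivAlong g id (fun z => φ z w) z v) x u
      = φ x (covDerivAlong g id (fun z => covDerivAlong g id (fun _ => w) z v) x u)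
        + g x u (chr g x v w) • ξ x - g x (ξ x) (chr g x v w) • u
        + ((g x (chr g x u v) w + g x v (chr g x u w)) • ξ x - g x v w • φ x u)
        - ((-g x (φ x u) w + g x (ξ x) (chr g x u w)) • v + g x (ξ x) w • chr g x u v) := by
    intro u v
    have e : (fun z => covDerivAlong g id (fun z => φ z w) z v) =ᶠ[nhds x] fun z =>
        φ z (chr g z v w) + g z v w • ξ z - g z (ξ z) w • v := by
      filter_upwards [S.metric.eventually_mem hx] with z hz
      rw [S.covDeriv_phi hz (differentiableAt_const w), covDerivAlong_eq]
      simp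
    have e' : (fun z => covDerivAlong g id (fun _ => w) z v) = fun z => chr g z v w := by
      funext z
      rw [covDerivAlong_eq]; simp
    have d1 : DifferentiableAt ℝ (fun z => φ z (chr g z v w)) x :=
      differentiableAt_of_smooth ((S.smooth_phi x hx).clm_apply (hchr v w))
    have m1 : fderiv ℝ (fun z => g z v w) x u = g x (chr g x u v) w + g x v (chr g x u w) := by
      rw [fderiv_apply_field₂ (S.metric.differentiableAt hx) (differentiableAt_const v)
        (differentiableAt_const w), S.metric.compat hx]
      simp
    have m2 : fderiv ℝ (fun z => g z (ξ z) w) x u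
        = -g x (φ x u) w + g x (ξ x) (chr g x u w) := by
      have := fderiv_metric_along S.metric (ψ := id) contDiffAt_id hx hξ
        (differentiableAt_const w) u
      rw [S.covDeriv_xi hx, hconst] at this
      simpa using this
    rw [covDerivAlong_congr e, covDerivAlong_sub (d1.fun_add ((hgc v).fun_smul hξ))
      (hη.fun_smul (differentiableAt_const v)), covDerivAlong_add d1 ((hgc v).fun_smul hξ),
      S.covDeriv_phi hx (differentiableAt_of_smooth (hchr v w)), covDerivAlong_smul (hgc v) hξ,
      covDerivAlong_smul hη (differentiableAt_const v), S.covDeriv_xi hx, hconst, m1, m2, e',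
      smul_neg, ← sub_eq_add_neg]
  have h2 := covDerivAlong_comm S.metric (ψ := id) contDiffAt_id hx hφ u v
  have h3 := covDerivAlong_comm S.metric (ψ := id) contDiffAt_id hx
    (contDiffAt_const (c := w)) u v
  simp only [fderiv_id, ContinuousLinearMap.id_apply, id] at h2 h3
  rw [← h2, ← h3]
  have h4 := h1 u v
  have h5 := h1 v u
  rw [h4, h5, S.metric.chr_symm hx v u, map_sub]
  module

/-- Polarization of the `φ`-sectional curvature. -/
theorem sectional_of_phi_sectional_aux {c : ℝ}
    (hc : ∀ X, g x (ξ x) X = 0 →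
      g x (curvature g x X (φ x X) (φ x X)) X = c * g x X X ^ 2)
    {X Y : E} (hX : g x (ξ x) X = 0) (hY : g x (ξ x) Y = 0) :
    6 * g x (curvature g x X (φ x Y) (φ x Y)) X + 2 * g x (curvature g x X Y Y) X
      = 2 * (c + 3) * (g x X X * g x Y Y) + (4 * c - 6) * g x X Y ^ 2
        - 6 * g x X (φ x Y) ^ 2 := by
  have hI := S.metric.inner x hx
  have hM := S.metric
  set b := g x with hb
  set R := fun a b c d => g x (curvature g x a b c) d with hR
  have swap : ∀ p q r s, R p q r s = -R q p r s := fun p q r s => by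
    simp only [hR]; rw [hM.curvature_swap hx]; simp
  have skew : ∀ p q r s, R p q r s = -R p q s r := hM.curvature_skew hx
  have pair : ∀ p q r s, R p q r s = R r s p q := hM.curvature_pair hx
  have bian : ∀ p q r s, R p q r s + R q r p s + R r p q s = 0 := fun p q r s => by
    simp only [hR]
    rw [← add_apply, ← map_add, ← add_apply, ← map_add, hM.bianchi hx]; simp
  have phi : ∀ p q r s, R p q (φ x r) s + R p q r (φ x s)
      = -b q r * b (φ x p) s + b (φ x p) r * b q s + b p r * b (φ x q) s
        - b (φ x q) r * b p s := fun p q r s => by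
    simp only [hR]
    rw [S.curvature_phi hx]
    simp only [map_add, map_sub, map_smul, add_apply, sub_apply, smul_apply, smul_eq_mul]
    rw [S.phi_skew hx (curvature g x p q r) s]
    ring
  have sq : φ x (φ x Y) = -Y := by rw [S.phi_sq x hx, hY]; simp
  have sqX : φ x (φ x X) = -X := by rw [S.phi_sq x hx, hX]; simp
  have k1 := hc X hX
  have k2 := hc Y hY
  -- The hypothesis is quartic. Adding its values at X + Y and X - Y cancels the terms of odd
  -- degree, and subtracting the pure ones leaves the part of bidegree (2, 2), recorded in `expand`.
  have k3 := hc (X + Y) (by rw [map_add, hX, hY, add_zero])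
  have k4 := hc (X + (-1 : ℝ) • Y) (by rw [map_add, map_smul, hX, hY]; simp)
  simp only [map_add, map_smul, hM.curvature_add_left hx, hM.curvature_add_mid hx,
    hM.curvature_add_right hx, hM.curvature_smul_left hx, hM.curvature_smul_mid hx,
    hM.curvature_smul_right hx, add_apply, smul_apply, smul_eq_mul] at k3 k4
  set P := φ x X with hP
  set Q := φ x Y with hQ
  change R X P P X = _ at k1
  change R Y Q Q Y = _ at k2
  have expand : R Y Q P X + R Y P Q X + R Y P P Y + R X Q Q X + R X Q P Y + R X P Q Y
      = c * (2 * (b X X * b Y Y) + 4 * b X Y ^ 2) := by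
    simp only [hR] at k1 k2 ⊢
    rw [hI.symm Y X] at k3 k4
    linear_combination (k3 + k4 - 2 * k1 - 2 * k2) / 2
  have g1 : b P X = 0 := by
    have := S.phi_skew hx X X
    rw [hI.symm X] at this
    change b P X = - b P X at this
    linarith
  have g2 : b Q Y = 0 := by
    have := S.phi_skew hx Y Y
    rw [hI.symm Y] at this
    change b Q Y = - b Q Y at this
    linarith
  have g3 : b P Y = -b X Q := S.phi_skew hx X Y
  have g4 : b P Q = b X Y := by
    rw [hb, hP, hQ, S.compatible x hx, hX, hY]; ring
  have s1 : b Q X = b X Q := hI.symm _ _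
  have s3 : b Y X = b X Y := hI.symm _ _
  have s5 : b Y Q = b Q Y := hI.symm _ _
  have g6 : b Q Q = b Y Y := by
    rw [hb, hQ, S.compatible x hx, hY]; ring
  -- Moving φ across slots reduces the terms of `expand`, modulo metric terms and up to Bianchi for
  -- R(X, P, Q, Y), to the two unknowns R(X, φY, φY, X) and R(X, Y, Y, X).
  have p1 := phi X Q Y X
  have p2 := phi Y P X Y
  have p3 := phi X Y X Q
  have p4 := phi X Q X Y
  rw [← hQ, ← hP] at p1 p2 p4
  rw [← hP, ← hQ] at p3
  have n1 : R X Y X (φ x Q) = -R X Y X Y := by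
    simp only [hR]; rw [sq, map_neg]
  have n2 : ∀ z, b (φ x Q) z = -b Y z := fun z => by rw [sq, map_neg, neg_apply]
  have n3 : ∀ z, b (φ x P) z = -b X z := fun z => by rw [sqX, map_neg, neg_apply]
  rw [n1] at p3
  simp only [n2, n3, s1, s3, s5, g1, g2, g3, g4, g6] at p1 p2 p3 p4
  have t1 := pair Y Q P X
  have t2 := pair Y P Q X
  have t3 := swap P X Y Q
  have t4 := skew X P Y Q
  have t5 := swap Q X Y P
  have t6 := skew X Q Y P
  have t7 := bian X P Q Y
  have t8 := swap Q X P Y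
  have t9 := pair P Q X Y
  have t10 := skew X Y X Y
  have t11 := skew X Q X Q
  have t12 := pair X Q Y P
  change 6 * R X Q Q X + 2 * R X Y Y X = _
  linarith

/-- The sectional curvatures of planes in the contact distribution. -/
theorem sectional_of_phi_sectional {c : ℝ}
    (hc : ∀ X, g x (ξ x) X = 0 →
      g x (curvature g x X (φ x X) (φ x X)) X = c * g x X X ^ 2)
    {X Y : E} (hX : g x (ξ x) X = 0) (hY : g x (ξ x) Y = 0) :
    g x (curvature g x Y X X) Y
      = (c + 3) / 4 * (g x X X * g x Y Y - g x X Y ^ 2)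
        + 3 * (c - 1) / 4 * g x (φ x X) Y ^ 2 := by
  have h1 := S.sectional_of_phi_sectional_aux hx hc hX hY
  -- Replacing Y by φY exchanges the two unknowns, as φ²Y = -Y. The resulting linear system, with
  -- coefficients 6, 2 and 2, 6, determines both.
  have h2 := S.sectional_of_phi_sectional_aux hx hc hX (Y := φ x Y) (S.eta_phi x hx Y)
  have sq : φ x (φ x Y) = -Y := by rw [S.phi_sq x hx, hY]; simp
  have e : curvature g x X (-Y) (-Y) = curvature g x X Y Y := by
    rw [← neg_one_smul ℝ Y, S.metric.curvature_smul_mid hx, S.metric.curvature_smul_right hx,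
      smul_smul]
    simp
  rw [sq, e, S.compatible x hx Y Y, hY, map_neg] at h2
  rw [S.phi_skew hx X Y, S.metric.curvature_pair hx]
  linarith

/-- The form `Y ↦ R(Y, X, X, Y)` for `X` in the contact distribution. -/
theorem curvature_quadratic {c : ℝ}
    (hc : ∀ X, g x (ξ x) X = 0 →
      g x (curvature g x X (φ x X) (φ x X)) X = c * g x X X ^ 2)
    {X : E} (hX : g x (ξ x) X = 0) (Y : E) :
    g x (curvature g x Y X X) Y
      = (c + 3) / 4 * (g x X X * (g x Y Y - g x (ξ x) Y ^ 2) - g x X Y ^ 2)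
        + 3 * (c - 1) / 4 * g x (φ x X) Y ^ 2 + g x (ξ x) Y ^ 2 * g x X X := by
  have hI := S.metric.inner x hx
  have hM := S.metric
  set t := g x (ξ x) Y with ht
  -- Y is split along ξ. By `curvature_xi` the cross terms vanish and the ξ-part contributes t²|X|².
  set Z := Y + (-t) • ξ x with hZ
  have hZ0 : g x (ξ x) Z = 0 := by
    rw [hZ, map_add, map_smul, S.eta_xi x hx, ← ht]; simp
  have hY : Y = Z + t • ξ x := by rw [hZ]; module
  have h1 := S.sectional_of_phi_sectional hx hc hX hZ0
  have e1 : ∀ W, g x (curvature g x W X X) (ξ x) = g x (ξ x) W * g x X X := fun W => by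
    rw [hM.curvature_skew hx, S.curvature_xi hx, hX]
    simp
  have e2 : g x (curvature g x (ξ x) X X) Z = 0 := by
    rw [hM.curvature_pair hx, hM.curvature_swap hx, map_neg, neg_apply,
      hM.curvature_skew hx, neg_neg]
    have := e1 Z
    rwa [hZ0, zero_mul] at this
  have e3 : g x X (ξ x) = 0 := by rw [hI.symm, hX]
  have e4 : g x (φ x X) (ξ x) = 0 := by rw [hI.symm, S.eta_phi x hx]
  have e5 : g x Z (ξ x) = 0 := by rw [hI.symm, hZ0]
  conv_lhs => rw [hY]
  have e6 : g x Y Y = g x Z Z + t ^ 2 := by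
    conv_lhs => rw [hY]
    simp only [map_add, map_smul, add_apply, smul_apply, smul_eq_mul, hZ0, e5, S.eta_xi x hx]
    ring
  have e7 : g x X Y = g x X Z := by
    conv_lhs => rw [hY]
    rw [map_add, map_smul, e3]; simp
  have e8 : g x (φ x X) Y = g x (φ x X) Z := by
    conv_lhs => rw [hY]
    rw [map_add, map_smul, e4]; simp
  rw [e6, e7, e8]
  simp only [hM.curvature_add_left hx, hM.curvature_smul_left hx, map_add, map_smul, add_apply,
    smul_apply, smul_eq_mul, e1, e2, h1, hZ0, S.eta_xi x hx]
  ring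

theorem isBilinearMap_curvature (X : E) :
    IsBilinearMap ℝ fun u v => curvature g x u X v :=
  ⟨fun _ _ _ => S.metric.curvature_add_left hx .., fun _ _ _ => S.metric.curvature_smul_left hx ..,
    fun _ _ _ => S.metric.curvature_add_right hx ..,
    fun _ _ _ => S.metric.curvature_smul_right hx ..⟩

theorem apply_trace_curvature (X W : E) :
    g x (trace (g x) fun u v => curvature g x u X v) W
      = trace (g x) fun u v => g x (curvature g x u X v) W := by
  simpa using map_trace ((g x).flip W) (g x) fun u v => curvature g x u X v

/-- The Ricci curvature in a direction of the contact distribution. -/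
theorem ricci_self {c : ℝ}
    (hc : ∀ X, g x (ξ x) X = 0 →
      g x (curvature g x X (φ x X) (φ x X)) X = c * g x X X ^ 2)
    {X : E} (hX : g x (ξ x) X = 0) :
    g x (trace (g x) fun u v => curvature g x u X v) X
      = -((c + 3) / 4 * (Module.finrank ℝ E - 2) + 3 * (c - 1) / 4 + 1) * g x X X := by
  have hI := S.metric.inner x hx
  have hM := S.metric
  -- A trace needs the bilinear form, not only its quadratic form; pair symmetry makes the form
  -- symmetric, hence recoverable by polarization.
  have polar : ∀ u v, g x (curvature g x u X v) X
      = -((c + 3) / 4 * (g x X X * (g x u v - g x (ξ x) u * g x (ξ x) v) - g x X u * g x X v)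
        + 3 * (c - 1) / 4 * (g x (φ x X) u * g x (φ x X) v)
        + g x (ξ x) u * g x (ξ x) v * g x X X) := fun u v => by
    have h1 := S.curvature_quadratic hx hc hX (u + v)
    have h2 := S.curvature_quadratic hx hc hX u
    have h3 := S.curvature_quadratic hx hc hX v
    simp only [hM.curvature_add_left hx, map_add, add_apply] at h1
    have h4 : g x (curvature g x v X X) u = g x (curvature g x u X X) v := by
      rw [hM.curvature_pair hx, hM.curvature_swap hx, map_neg, neg_apply,
        hM.curvature_skew hx, neg_neg]
    rw [h4, hI.symm v u] at h1
    rw [hM.curvature_skew hx]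
    linarith
  rw [S.apply_trace_curvature hx]
  simp only [polar]
  have r : ∀ w, trace (g x) (fun u v => g x w u * g x w v) = g x w w := fun w =>
    hI.trace_rank_one (L := fun v => g x w v) ⟨fun a b => by simp, fun a b => by simp⟩ w
  -- The form becomes a combination of g and of squares of the 1-forms dual to ξ, X and φX, whose
  -- traces are the dimension, 1, |X|² and |X|².
  have e : (fun u v : E =>
      -((c + 3) / 4 * (g x X X * (g x u v - g x (ξ x) u * g x (ξ x) v) - g x X u * g x X v)
        + 3 * (c - 1) / 4 * (g x (φ x X) u * g x (φ x X) v)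
        + g x (ξ x) u * g x (ξ x) v * g x X X))
      = fun u v => (-((c + 3) / 4 * g x X X)) * g x u v
        + (((c + 3) / 4 * g x X X - g x X X) * (g x (ξ x) u * g x (ξ x) v)
        + ((c + 3) / 4 * (g x X u * g x X v)
        + (-(3 * (c - 1) / 4)) * (g x (φ x X) u * g x (φ x X) v))) := by
    funext u v
    ring
  rw [e, trace_add, trace_add, trace_add, trace_mul_left, trace_mul_left, trace_mul_left,
    trace_mul_left, hI.trace_self, r, r, r, S.compatible x hx, hX, S.eta_xi x hx]
  ring

/-- The Ricci operator on the contact distribution. -/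
theorem trace_curvature {c : ℝ}
    (hc : ∀ X, g x (ξ x) X = 0 →
      g x (curvature g x X (φ x X) (φ x X)) X = c * g x X X ^ 2)
    {X : E} (hX : g x (ξ x) X = 0) :
    (trace (g x) fun u v => curvature g x u X v)
      = -((c + 3) / 4 * (Module.finrank ℝ E - 2) + 3 * (c - 1) / 4 + 1) • X := by
  have hI := S.metric.inner x hx
  have hM := S.metric
  set C : ℝ := (c + 3) / 4 * (Module.finrank ℝ E - 2) + 3 * (c - 1) / 4 + 1 with hC
  set ρ : E → E := fun X => trace (g x) fun u v => curvature g x u X v with hρ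
  have radd : ∀ X Y, ρ (X + Y) = ρ X + ρ Y := fun X Y => by
    simp only [hρ, hM.curvature_add_mid hx, trace_add]
  have rsymm : ∀ X Y, g x (ρ X) Y = g x (ρ Y) X := fun X Y => by
    simp only [hρ]
    rw [hI.trace_comm (S.isBilinearMap_curvature hx X)]
    have := map_trace ((g x).flip Y) (g x) fun u v => curvature g x v X u
    simp only [ContinuousLinearMap.flip_apply] at this
    rw [this, S.apply_trace_curvature hx]
    congr 1
    funext u v
    rw [hM.curvature_pair hx]
  -- The Ricci form is symmetric, so `ricci_self` polarizes on the contact distribution; `rξ` then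
  -- excludes a component of ρ(X) along ξ.
  have rD : ∀ Y, g x (ξ x) Y = 0 → g x (ρ X) Y = -C * g x X Y := fun Y hY => by
    have h1 := S.ricci_self hx hc hX
    have h2 := S.ricci_self hx hc hY
    have h3 := S.ricci_self hx hc (X := X + Y) (by rw [map_add, hX, hY, add_zero])
    change g x (ρ X) X = -C * _ at h1
    change g x (ρ Y) Y = -C * _ at h2
    change g x (ρ (X + Y)) (X + Y) = -C * _ at h3
    rw [radd] at h3
    simp only [map_add, add_apply] at h3
    rw [rsymm Y X, hI.symm Y X] at h3
    linarith
  have rξ : g x (ρ X) (ξ x) = 0 := by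
    simp only [hρ]
    rw [S.apply_trace_curvature hx]
    have e : ∀ u v, g x (curvature g x u X v) (ξ x) = g x (ξ x) u * g x X v := fun u v => by
      rw [hM.curvature_skew hx, S.curvature_xi hx, hX]
      simp
    simp only [e]
    have := hI.trace_rank_one (L := fun v => g x X v)
      ⟨fun a b => by simp, fun a b => by simp⟩ (ξ x)
    simp only [smul_eq_mul] at this
    rw [this, hI.symm, hX]
  refine hI.ext fun Y => ?_
  have hY : Y = (Y + (-g x (ξ x) Y) • ξ x) + g x (ξ x) Y • ξ x := by module
  have hZ0 : g x (ξ x) (Y + (-g x (ξ x) Y) • ξ x) = 0 := by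
    rw [map_add, map_smul, S.eta_xi x hx]; simp
  have h1 := rD _ hZ0
  have e3 : g x X (ξ x) = 0 := by rw [hI.symm, hX]
  rw [map_add, map_add, map_smul, map_smul, rξ, e3, smul_zero, add_zero, add_zero] at h1
  rw [map_smul, smul_apply, smul_eq_mul]
  exact h1

end IsSasakianOn

end Coord

namespace RiemGeom

/-! ### Tensor fields in a chart -/

section Charts

variable {E : Type*} [NormedAddCommGroup E] [NormedSpace ℝ E] [FiniteDimensional ℝ E]
  {H : Type*} [TopologicalSpace H] {I : ModelWithCorners ℝ E H} [I.Boundaryless]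
  {M : Type*} [TopologicalSpace M] [ChartedSpace H M] [IsManifold I ∞ M]

theorem isManifold_one : IsManifold I 1 M := IsManifold.of_le (n := ∞) (by simp)

theorem chartInvDeriv_eq (p : M) (y : E) :
    chartInvDeriv I p y = mfderivWithin 𝓘(ℝ, E) I (extChartAt I p).symm (Set.range I) y := by
  rw [I.range_eq_univ, mfderivWithin_univ]
  rfl

theorem chartDeriv_chartInvDeriv {p : M} {y : E} (hy : y ∈ (extChartAt I p).target) (v : E) :
    chartDeriv I p y (chartInvDeriv I p y v) = v := by
  have := isManifold_one (I := I) (M := M)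
  have h := mfderiv_extChartAt_comp_mfderivWithin_extChartAt_symm (I := I) hy
  rw [← chartInvDeriv_eq] at h
  exact congrArg (fun L : E →L[ℝ] E => L v) h

theorem chartInvDeriv_chartDeriv {p : M} {y : E} (hy : y ∈ (extChartAt I p).target)
    (v : TangentSpace I ((extChartAt I p).symm y)) :
    chartInvDeriv I p y (chartDeriv I p y v) = v := by
  have := isManifold_one (I := I) (M := M)
  have h := mfderivWithin_extChartAt_symm_comp_mfderiv_extChartAt (I := I) hy
  rw [← chartInvDeriv_eq] at h
  exact congrArg (fun L : E →L[ℝ] E => L v) h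

/-- The tangent space at `p` is identified with `E` through this same chart, so pointwise statements
about the manifold and about the chart agree literally at the base point. -/
theorem chartInvDeriv_self (p : M) (v : E) :
    (chartInvDeriv I p (extChartAt I p p) v : E) = v := by
  have := isManifold_one (I := I) (M := M)
  have h := mfderivWithin_range_extChartAt_symm (I := I) (x := p)
  rw [← chartInvDeriv_eq] at h
  exact congrArg (fun L : E →L[ℝ] E => L v) h

theorem chartDeriv_self (p : M) (v : E) :
    (chartDeriv I p (extChartAt I p p) v : E) = v := by
  have h := chartDeriv_chartInvDeriv (I := I) (mem_extChartAt_target p) v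
  have h' : chartDeriv I p (extChartAt I p p)
    (chartInvDeriv I p (extChartAt I p p) v : E) = v := h
  rw [chartInvDeriv_self] at h'
  exact h'

/-- Chart round trips return to the same point only propositionally; the fibres are all `E`, so
values can still be compared. -/
theorem bilinField_congr (b : BilinField I M) {p q : M} (h : p = q) (u v : E) :
    (b p : E →L[ℝ] E →L[ℝ] ℝ) u v = (b q : E →L[ℝ] E →L[ℝ] ℝ) u v := by
  subst h; rfl

theorem inChartBilin_apply (b : BilinField I M) (p : M) (y u v : E) :
    inChartBilin b p y u v
      = b ((extChartAt I p).symm y) (chartInvDeriv I p y u) (chartInvDeriv I p y v) := rfl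

theorem inChartBilin_self (b : BilinField I M) (p : M) (u v : E) :
    inChartBilin b p (extChartAt I p p) u v = (b p : E →L[ℝ] E →L[ℝ] ℝ) u v := by
  rw [inChartBilin_apply, ← bilinField_congr b (extChartAt_to_inv (I := I) p)]
  have h1 := chartInvDeriv_self (I := I) p u
  have h2 := chartInvDeriv_self (I := I) p v
  exact congrArg₂ (fun a c : E =>
    (b ((extChartAt I p).symm (extChartAt I p p)) : E →L[ℝ] E →L[ℝ] ℝ) a c) h1 h2

theorem inChartEndo_apply (T : EndoField I M) (p : M) (y u : E) :
    inChartEndo T p y u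
      = chartDeriv I p y (T ((extChartAt I p).symm y) (chartInvDeriv I p y u)) := rfl

theorem inChartEndo_self (T : EndoField I M) (p : M) (u : E) :
    inChartEndo T p (extChartAt I p p) u = (T p : E →L[ℝ] E) u := by
  have h0 : ∀ q, q = p → (T q : E →L[ℝ] E) u = (T p : E →L[ℝ] E) u := by
    rintro q rfl; rfl
  have h1 := chartInvDeriv_self (I := I) p u
  have h2 : inChartEndo T p (extChartAt I p p) u
      = (T ((extChartAt I p).symm (extChartAt I p p)) : E →L[ℝ] E)
        (chartInvDeriv I p (extChartAt I p p) u : E) :=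
    chartDeriv_self (I := I) p _
  rw [h2, h1]
  exact h0 _ (extChartAt_to_inv p)

theorem inChartVec_self (X : ∀ x : M, TangentSpace I x) (p : M) :
    inChartVec X p (extChartAt I p p) = (X p : E) := by
  have h0 : ∀ q, q = p → (X q : E) = (X p : E) := by
    rintro q rfl; rfl
  exact (chartDeriv_self (I := I) p _).trans (h0 _ (extChartAt_to_inv p))

theorem contMDiffAt_symm {p : M} {y : E} (hy : y ∈ (extChartAt I p).target) :
    ContMDiffAt 𝓘(ℝ, E) I ∞ (extChartAt I p).symm y :=
  (contMDiffOn_extChartAt_symm p).contMDiffAt ((isOpen_extChartAt_target p).mem_nhds hy)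

/-- The coordinate vector fields are smooth. -/
theorem contMDiffAt_chartInvDeriv {p : M} {y : E} (hy : y ∈ (extChartAt I p).target) (v : E) :
    ContMDiffAt 𝓘(ℝ, E) I.tangent ∞ (fun z => Bundle.TotalSpace.mk' E
      (E := (TangentSpace I : M → Type _)) ((extChartAt I p).symm z) (chartInvDeriv I p z v)) y := by
  have := isManifold_one (I := I) (M := M)
  have ho := isOpen_extChartAt_target (I := I) p
  -- A coordinate field is the image of a constant field under the tangent map of the inverse chart.
  have h1 := ((contMDiffOn_extChartAt_symm (I := I) (n := ∞) p).contMDiffOn_tangentMapWithin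
    (m := ∞) (by simp) ho.uniqueMDiffOn)
  have h2 : ContMDiffAt 𝓘(ℝ, E) 𝓘(ℝ, E).tangent ∞
      (fun z : E => (⟨z, v⟩ : TangentBundle 𝓘(ℝ, E) E)) y :=
    contMDiffAt_vectorSpace_iff_contDiffAt.2 contDiffAt_const
  have h3 : ContMDiffAt 𝓘(ℝ, E) I.tangent ∞ (fun z : E => tangentMapWithin 𝓘(ℝ, E) I
      (extChartAt I p).symm (extChartAt I p).target (⟨z, v⟩ : TangentBundle 𝓘(ℝ, E) E)) y := by
    have ho' := ho.preimage
      (FiberBundle.continuous_proj E (TangentSpace 𝓘(ℝ, E) : E → Type _))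
    exact (h1.contMDiffAt (ho'.mem_nhds
      (show (⟨y, v⟩ : TangentBundle 𝓘(ℝ, E) E) ∈ _ from hy))).comp y h2
  refine h3.congr_of_eventuallyEq ?_
  filter_upwards [ho.mem_nhds hy] with z hz
  simp only [tangentMapWithin]
  rw [mfderivWithin_of_isOpen ho hz]
  rfl

theorem contDiffAt_chartDeriv_section {p : M} {y : E} (hy : y ∈ (extChartAt I p).target)
    {X : ∀ z : E, TangentSpace I ((extChartAt I p).symm z)}
    (hX : ContMDiffAt 𝓘(ℝ, E) I.tangent ∞ (fun z => Bundle.TotalSpace.mk' E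
      (E := (TangentSpace I : M → Type _)) ((extChartAt I p).symm z) (X z)) y) :
    ContDiffAt ℝ ∞ (fun z => (chartDeriv I p z (X z) : E)) y := by
  have := isManifold_one (I := I) (M := M)
  have hs : (extChartAt I p).symm y ∈ (chartAt H p).source := by
    rw [← extChartAt_source (I := I)]
    exact (extChartAt I p).map_target hy
  have ho := (chartAt H p).open_source
  have h1 := ((contMDiffOn_extChartAt (I := I) (n := ∞) (x := p)).contMDiffOn_tangentMapWithin
    (m := ∞) (by simp) ho.uniqueMDiffOn)
  have ho' := ho.preimage (FiberBundle.continuous_proj E (TangentSpace I : M → Type _))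
  have h2 := (h1.contMDiffAt (x := Bundle.TotalSpace.mk' E
      (E := (TangentSpace I : M → Type _)) ((extChartAt I p).symm y) (X y))
      (ho'.mem_nhds hs)).comp y hX
  have h3 := ((contMDiff_snd_tangentBundle_modelSpace (n := ∞) E 𝓘(ℝ, E)).contMDiffAt.comp y
    h2).contDiffAt
  refine h3.congr_of_eventuallyEq ?_
  have hc : ∀ᶠ z in nhds y, (extChartAt I p).symm z ∈ (chartAt H p).source :=
    (contMDiffAt_symm hy).continuousAt.preimage_mem_nhds (ho.mem_nhds hs)
  filter_upwards [hc] with z hz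
  have e := mfderivWithin_of_isOpen (I := I) (I' := 𝓘(ℝ, E)) (f := extChartAt I p) ho hz
  exact (congrArg (fun L : E →L[ℝ] E => L (X z)) e).symm

theorem contDiffAt_inChartBilin {b : BilinField I M}
    (hb : ContMDiff I (I.prod 𝓘(ℝ, E →L[ℝ] E →L[ℝ] ℝ)) ∞
      (fun x => Bundle.TotalSpace.mk' (E →L[ℝ] E →L[ℝ] ℝ)
        (E := fun x : M => TangentSpace I x →L[ℝ] TangentSpace I x →L[ℝ] ℝ) x (b x)))
    {p : M} {y : E} (hy : y ∈ (extChartAt I p).target) :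
    ContDiffAt ℝ ∞ (inChartBilin b p) y := by
  refine Coord.contDiffAt_clm₂_of_apply fun u v => ?_
  have h1 := (hb.contMDiffAt (x := (extChartAt I p).symm y)).comp y (contMDiffAt_symm hy)
  have h2 : ContMDiffAt 𝓘(ℝ, E) (I.prod 𝓘(ℝ)) ∞
      (fun z => Bundle.TotalSpace.mk' ℝ (E := Bundle.Trivial M ℝ) ((extChartAt I p).symm z)
        (b ((extChartAt I p).symm z) (chartInvDeriv I p z u) (chartInvDeriv I p z v))) y := by
    apply ContMDiffAt.clm_bundle_apply₂ (F₁ := E) (F₂ := E)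
    · exact h1
    · exact contMDiffAt_chartInvDeriv hy u
    · exact contMDiffAt_chartInvDeriv hy v
  rw [Bundle.contMDiffAt_totalSpace] at h2
  exact h2.2.contDiffAt

theorem contDiffAt_inChartEndo {T : EndoField I M}
    (hT : ContMDiff I (I.prod 𝓘(ℝ, E →L[ℝ] E)) ∞
      (fun x => Bundle.TotalSpace.mk' (E →L[ℝ] E)
        (E := fun x : M => TangentSpace I x →L[ℝ] TangentSpace I x) x (T x)))
    {p : M} {y : E} (hy : y ∈ (extChartAt I p).target) :
    ContDiffAt ℝ ∞ (inChartEndo T p) y := by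
  refine Coord.contDiffAt_clm_of_apply fun u => ?_
  have h1 := (hT.contMDiffAt (x := (extChartAt I p).symm y)).comp y (contMDiffAt_symm hy)
  exact contDiffAt_chartDeriv_section hy
    (ContMDiffAt.clm_bundle_apply h1 (contMDiffAt_chartInvDeriv hy u))

theorem contDiffAt_inChartVec {X : ∀ x : M, TangentSpace I x}
    (hX : ContMDiff I I.tangent ∞ (fun x => Bundle.TotalSpace.mk' E
      (E := (TangentSpace I : M → Type _)) x (X x)))
    {p : M} {y : E} (hy : y ∈ (extChartAt I p).target) :
    ContDiffAt ℝ ∞ (inChartVec X p) y :=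
  contDiffAt_chartDeriv_section hy
    ((hX.contMDiffAt (x := (extChartAt I p).symm y)).comp y (contMDiffAt_symm hy))

end Charts

end RiemGeom

namespace Coord

variable {E : Type*} [NormedAddCommGroup E] [NormedSpace ℝ E] [FiniteDimensional ℝ E]

/-! ### Locality of the coordinate expressions -/

theorem IsMetricOn.congr {g g' : E → E →L[ℝ] E →L[ℝ] ℝ} {U : Set E} (hg : IsMetricOn g U)
    (h : ∀ x ∈ U, g' x = g x) : IsMetricOn g' U where
  isOpen := hg.isOpen
  smooth x hx := (hg.smooth x hx).congr_of_eventuallyEq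
    (Filter.eventuallyEq_of_mem (hg.isOpen.mem_nhds hx) h)
  inner x hx := by rw [h x hx]; exact hg.inner x hx

theorem christoffel_congr {g g' : E → E →L[ℝ] E →L[ℝ] ℝ} {y : E} (h : g =ᶠ[nhds y] g')
    (u v : E) : (fun z => christoffel g z u v) =ᶠ[nhds y] fun z => christoffel g' z u v := by
  filter_upwards [h, h.fderiv (𝕜 := ℝ)] with z h1 h2
  unfold christoffel
  rw [h1, h2]

/-- Curvature depends only on the germ of the metric, which matters because the product metric
agrees with `warp` only on the chart target. -/
theorem curvature_congr {g g' : E → E →L[ℝ] E →L[ℝ] ℝ} {y : E} (h : g =ᶠ[nhds y] g')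
    (u v w : E) : curvature g y u v w = curvature g' y u v w := by
  have e : ∀ u v, christoffel g y u v = christoffel g' y u v := fun u v =>
    (christoffel_congr h u v).eq_of_nhds
  unfold curvature
  rw [(christoffel_congr h v w).fderiv_eq, (christoffel_congr h u w).fderiv_eq]
  simp only [e]

theorem covDerivGrad_congr {g g' : E → E →L[ℝ] E →L[ℝ] ℝ} {a a' : E → ℝ} {y : E}
    (h : g =ᶠ[nhds y] g') (ha : a =ᶠ[nhds y] a') (u : E) :
    covDerivGrad g a y u = covDerivGrad g' a' y u := by
  have e : grad g a =ᶠ[nhds y] grad g' a' := by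
    filter_upwards [h, ha.fderiv (𝕜 := ℝ)] with z h1 h2
    unfold grad
    rw [h1, h2]
  unfold covDerivGrad
  rw [e.fderiv_eq, e.eq_of_nhds, (christoffel_congr h u _).eq_of_nhds]

end Coord

namespace RiemGeom

/-! ### Coordinate expressions of maps between manifolds -/

section Charts

variable {E : Type*} [NormedAddCommGroup E] [NormedSpace ℝ E] [FiniteDimensional ℝ E]
  {H : Type*} [TopologicalSpace H] {I : ModelWithCorners ℝ E H} [I.Boundaryless]
  {M : Type*} [TopologicalSpace M] [ChartedSpace H M] [IsManifold I ∞ M]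
  {E' : Type*} [NormedAddCommGroup E'] [NormedSpace ℝ E'] [FiniteDimensional ℝ E']
  {H' : Type*} [TopologicalSpace H'] {I' : ModelWithCorners ℝ E' H'} [I'.Boundaryless]
  {N : Type*} [TopologicalSpace N] [ChartedSpace H' N] [IsManifold I' ∞ N]

theorem chartInvDeriv_ne_zero {p : M} {y : E} (hy : y ∈ (extChartAt I p).target) {u : E}
    (hu : u ≠ 0) : chartInvDeriv I p y u ≠ 0 := fun h => hu <| by
  rw [← chartDeriv_chartInvDeriv (I := I) hy u, h, map_zero]

theorem isMetricOn_inChartBilin {b : BilinField I M}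
    (hb : ContMDiff I (I.prod 𝓘(ℝ, E →L[ℝ] E →L[ℝ] ℝ)) ∞
      (fun x => Bundle.TotalSpace.mk' (E →L[ℝ] E →L[ℝ] ℝ)
        (E := fun x : M => TangentSpace I x →L[ℝ] TangentSpace I x →L[ℝ] ℝ) x (b x)))
    (hsymm : ∀ x u v, b x u v = b x v u) (hpos : ∀ x u, u ≠ 0 → 0 < b x u u) (p : M) :
    Coord.IsMetricOn (inChartBilin b p) (extChartAt I p).target where
  isOpen := isOpen_extChartAt_target p
  smooth _ hy := contDiffAt_inChartBilin hb hy
  inner _ hy := ⟨fun _ _ => hsymm _ _ _, fun _ hu => hpos _ _ (chartInvDeriv_ne_zero hy hu)⟩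

/-- The domain of the coordinate expression of `ψ` at `p`. -/
def chartDomain (I : ModelWithCorners ℝ E H) (I' : ModelWithCorners ℝ E' H') (ψ : M → N) (p : M) :
    Set E :=
  (extChartAt I p).target ∩ (extChartAt I p).symm ⁻¹' (ψ ⁻¹' (extChartAt I' (ψ p)).source)

theorem isOpen_chartDomain {ψ : M → N} (hψ : Continuous ψ) (p : M) :
    IsOpen (chartDomain I I' ψ p) :=
  (continuousOn_extChartAt_symm p).isOpen_inter_preimage (isOpen_extChartAt_target p)
    ((isOpen_extChartAt_source (ψ p)).preimage hψ)

theorem mem_chartDomain (ψ : M → N) (p : M) : extChartAt I p p ∈ chartDomain I I' ψ p := by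
  refine ⟨mem_extChartAt_target p, ?_⟩
  simp only [Set.mem_preimage, extChartAt_to_inv]
  exact mem_extChartAt_source (ψ p)

variable {ψ : M → N} (hψ : ContMDiff I I' ∞ ψ) {p : M} {x : E} (hx : x ∈ chartDomain I I' ψ p)

include hψ

include hx in
theorem contMDiffAt_written :
    ContMDiffAt 𝓘(ℝ, E) 𝓘(ℝ, E') ∞ (writtenInExtChartAt I I' p ψ) x := by
  have h1 : ContMDiffAt I' 𝓘(ℝ, E') ∞ (extChartAt I' (ψ p)) (ψ ((extChartAt I p).symm x)) :=
    contMDiffAt_extChartAt' (by rw [← extChartAt_source (I := I')]; exact hx.2)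
  exact h1.comp x (hψ.contMDiffAt.comp x (contMDiffAt_symm hx.1))

theorem fderiv_written_self (p : M) (u : E) :
    fderiv ℝ (writtenInExtChartAt I I' p ψ) (extChartAt I p p) u
      = (mfderiv I I' ψ p u : E') := by
  have h : MDifferentiableAt I I' ψ p := hψ.mdifferentiable (by simp) p
  have h1 : mfderiv I I' ψ p
      = fderivWithin ℝ (writtenInExtChartAt I I' p ψ) (Set.range I) (extChartAt I p p) :=
    h.mfderiv
  rw [I.range_eq_univ, fderivWithin_univ] at h1
  exact (congrArg (fun L : E →L[ℝ] E' => L u) h1).symm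

include hx

theorem written_mem : writtenInExtChartAt I I' p ψ x ∈ (extChartAt I' (ψ p)).target :=
  (extChartAt I' (ψ p)).map_source hx.2

theorem symm_written : (extChartAt I' (ψ p)).symm (writtenInExtChartAt I I' p ψ x)
    = ψ ((extChartAt I p).symm x) :=
  (extChartAt I' (ψ p)).left_inv hx.2

/-- The chain rule for the two factorizations of the same map near `x`: coordinate expression
followed by the inverse chart of the target, or inverse chart of the source followed by `ψ`. -/
theorem chartInvDeriv_fderiv_written (u : E) :
    (chartInvDeriv I' (ψ p) (writtenInExtChartAt I I' p ψ x)
        (fderiv ℝ (writtenInExtChartAt I I' p ψ) x u) : E')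
      = (mfderiv I I' ψ ((extChartAt I p).symm x) (chartInvDeriv I p x u) : E') := by
  have hw := contMDiffAt_written hψ hx
  have d1 : MDifferentiableAt 𝓘(ℝ, E) I (extChartAt I p).symm x :=
    (contMDiffAt_symm hx.1).mdifferentiableAt (by simp)
  have d2 : MDifferentiableAt I I' ψ ((extChartAt I p).symm x) :=
    hψ.mdifferentiable (by simp) _
  have d3 : MDifferentiableAt 𝓘(ℝ, E) 𝓘(ℝ, E') (writtenInExtChartAt I I' p ψ) x :=
    hw.mdifferentiableAt (by simp)
  have d4 : MDifferentiableAt 𝓘(ℝ, E') I' (extChartAt I' (ψ p)).symm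
      (writtenInExtChartAt I I' p ψ x) :=
    (contMDiffAt_symm (written_mem hψ hx)).mdifferentiableAt (by simp)
  have e : (extChartAt I' (ψ p)).symm ∘ writtenInExtChartAt I I' p ψ =ᶠ[nhds x]
      ψ ∘ (extChartAt I p).symm := by
    filter_upwards [(isOpen_chartDomain (I := I) (I' := I') hψ.continuous p).mem_nhds hx] with z hz
    exact symm_written hψ hz
  have c1 := mfderiv_comp x d4 d3
  have c2 := mfderiv_comp x d2 d1
  have c3 := e.mfderiv_eq (I := 𝓘(ℝ, E)) (I' := I')
  rw [mfderiv_eq_fderiv] at c1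
  have c4 := (c1.symm.trans c3).trans c2
  exact congrArg (fun L : E →L[ℝ] E' => L u) c4

end Charts

end RiemGeom

namespace RiemGeom

/-! ### Isometric maps in charts and the projections of a product -/

section Charts

variable {E : Type*} [NormedAddCommGroup E] [NormedSpace ℝ E] [FiniteDimensional ℝ E]
  {H : Type*} [TopologicalSpace H] {I : ModelWithCorners ℝ E H} [I.Boundaryless]
  {M : Type*} [TopologicalSpace M] [ChartedSpace H M] [IsManifold I ∞ M]
  {E' : Type*} [NormedAddCommGroup E'] [NormedSpace ℝ E'] [FiniteDimensional ℝ E']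
  {H' : Type*} [TopologicalSpace H'] {I' : ModelWithCorners ℝ E' H'} [I'.Boundaryless]
  {N : Type*} [TopologicalSpace N] [ChartedSpace H' N] [IsManifold I' ∞ N]

/-- An isometric map is isometric in charts. -/
theorem isIsometricOn_written {g : BilinField I M} {h : BilinField I' N} {ψ : M → N}
    (hψ : ContMDiff I I' ∞ ψ) (hiso : IsIsometric g h ψ) (p : M)
    (hg : Coord.IsMetricOn (inChartBilin g p) (extChartAt I p).target)
    (hh : Coord.IsMetricOn (inChartBilin h (ψ p)) (extChartAt I' (ψ p)).target) :
    Coord.IsIsometricOn (inChartBilin g p) (inChartBilin h (ψ p))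
      (writtenInExtChartAt I I' p ψ) (chartDomain I I' ψ p) (extChartAt I' (ψ p)).target where
  source := ⟨isOpen_chartDomain hψ.continuous p, fun x hx => hg.smooth x hx.1,
    fun x hx => hg.inner x hx.1⟩
  target := hh
  smooth x hx := (contMDiffAt_written hψ hx).contDiffAt
  mapsTo x hx := written_mem hψ hx
  iso x hx u v := by
    rw [inChartBilin_apply, inChartBilin_apply, hiso]
    have h1 := chartInvDeriv_fderiv_written hψ hx u
    have h2 := chartInvDeriv_fderiv_written hψ hx v
    have h3 := bilinField_congr h (symm_written hψ hx)
    refine (h3 _ _).symm.trans ?_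
    exact (congrArg₂ (fun a c : E' => (h ((extChartAt I' (ψ p)).symm
      (writtenInExtChartAt I I' p ψ x)) : E' →L[ℝ] E' →L[ℝ] ℝ) a c) h1 h2).symm

theorem mfderiv_fst_chartInvDeriv {q : M × N} {y : E × E'}
    (hy : y ∈ (extChartAt (I.prod I') q).target) (u : E × E') :
    (mfderiv (I.prod I') I Prod.fst ((extChartAt (I.prod I') q).symm y)
      (chartInvDeriv (I.prod I') q y u) : E) = chartInvDeriv I q.1 y.1 u.1 := by
  have hy1 : y.1 ∈ (extChartAt I q.1).target := by
    rw [extChartAt_prod] at hy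
    exact hy.1
  have d1 : MDifferentiableAt 𝓘(ℝ, E × E') (I.prod I') (extChartAt (I.prod I') q).symm y :=
    (contMDiffAt_symm hy).mdifferentiableAt (by simp)
  have d2 : MDifferentiableAt (I.prod I') I (Prod.fst : M × N → M)
      ((extChartAt (I.prod I') q).symm y) := mdifferentiableAt_fst
  have d3 : MDifferentiableAt 𝓘(ℝ, E × E') 𝓘(ℝ, E) (Prod.fst : E × E' → E) y :=
    differentiableAt_fst.mdifferentiableAt
  have d4 : MDifferentiableAt 𝓘(ℝ, E) I (extChartAt I q.1).symm y.1 :=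
    (contMDiffAt_symm hy1).mdifferentiableAt (by simp)
  have c1 := mfderiv_comp y d2 d1
  have c2 := mfderiv_comp (f := (Prod.fst : E × E' → E)) y d4 d3
  have e : (Prod.fst : M × N → M) ∘ (extChartAt (I.prod I') q).symm
      = (extChartAt I q.1).symm ∘ (Prod.fst : E × E' → E) := by
    rw [extChartAt_prod]; rfl
  rw [e] at c1
  rw [mfderiv_eq_fderiv, fderiv_fst] at c2
  exact congrArg (fun L : (E × E') →L[ℝ] E => L u) (c1.symm.trans c2)

theorem mfderiv_snd_chartInvDeriv {q : M × N} {y : E × E'}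
    (hy : y ∈ (extChartAt (I.prod I') q).target) (u : E × E') :
    (mfderiv (I.prod I') I' Prod.snd ((extChartAt (I.prod I') q).symm y)
      (chartInvDeriv (I.prod I') q y u) : E') = chartInvDeriv I' q.2 y.2 u.2 := by
  have hy2 : y.2 ∈ (extChartAt I' q.2).target := by
    rw [extChartAt_prod] at hy
    exact hy.2
  have d1 : MDifferentiableAt 𝓘(ℝ, E × E') (I.prod I') (extChartAt (I.prod I') q).symm y :=
    (contMDiffAt_symm hy).mdifferentiableAt (by simp)
  have d2 : MDifferentiableAt (I.prod I') I' (Prod.snd : M × N → N)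
      ((extChartAt (I.prod I') q).symm y) := mdifferentiableAt_snd
  have d3 : MDifferentiableAt 𝓘(ℝ, E × E') 𝓘(ℝ, E') (Prod.snd : E × E' → E') y :=
    differentiableAt_snd.mdifferentiableAt
  have d4 : MDifferentiableAt 𝓘(ℝ, E') I' (extChartAt I' q.2).symm y.2 :=
    (contMDiffAt_symm hy2).mdifferentiableAt (by simp)
  have c1 := mfderiv_comp y d2 d1
  have c2 := mfderiv_comp (f := (Prod.snd : E × E' → E')) y d4 d3
  have e : (Prod.snd : M × N → N) ∘ (extChartAt (I.prod I') q).symm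
      = (extChartAt I' q.2).symm ∘ (Prod.snd : E × E' → E') := by
    rw [extChartAt_prod]; rfl
  rw [e] at c1
  rw [mfderiv_eq_fderiv, fderiv_snd] at c2
  exact congrArg (fun L : (E × E') →L[ℝ] E' => L u) (c1.symm.trans c2)

end Charts

/-! ### Warped product metrics in product charts -/

section Warped

variable {d₁ d₂ : ℕ}
  {M₁ : Type*} [TopologicalSpace M₁] [ChartedSpace (EuclideanSpace ℝ (Fin d₁)) M₁]
  [IsManifold (𝓡 d₁) ∞ M₁]
  {M₂ : Type*} [TopologicalSpace M₂] [ChartedSpace (EuclideanSpace ℝ (Fin d₂)) M₂]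
  [IsManifold (𝓡 d₂) ∞ M₂]

/-- The warped product metric in a product chart. -/
theorem inChartBilin_warpedMetric (g₁ : BilinField (𝓡 d₁) M₁) (g₂ : BilinField (𝓡 d₂) M₂)
    (f : M₁ → ℝ) (q : M₁ × M₂) {y : EuclideanSpace ℝ (Fin d₁) × EuclideanSpace ℝ (Fin d₂)}
    (hy : y ∈ (extChartAt ((𝓡 d₁).prod (𝓡 d₂)) q).target) :
    inChartBilin (warpedMetric g₁ g₂ f) q y
      = Coord.warp (inChartBilin g₁ q.1) (inChartBilin g₂ q.2)
        (f ∘ (extChartAt (𝓡 d₁) q.1).symm) y := by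
  refine ContinuousLinearMap.ext fun u => ContinuousLinearMap.ext fun v => ?_
  have a1 := mfderiv_fst_chartInvDeriv hy u
  have a2 := mfderiv_fst_chartInvDeriv hy v
  have b1 := mfderiv_snd_chartInvDeriv hy u
  have b2 := mfderiv_snd_chartInvDeriv hy v
  have e : (extChartAt ((𝓡 d₁).prod (𝓡 d₂)) q).symm y
      = ((extChartAt (𝓡 d₁) q.1).symm y.1, (extChartAt (𝓡 d₂) q.2).symm y.2) := by
    rw [extChartAt_prod]; rfl
  have e1 : ((extChartAt ((𝓡 d₁).prod (𝓡 d₂)) q).symm y).1 = (extChartAt (𝓡 d₁) q.1).symm y.1 :=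
    congrArg Prod.fst e
  have e2 : ((extChartAt ((𝓡 d₁).prod (𝓡 d₂)) q).symm y).2 = (extChartAt (𝓡 d₂) q.2).symm y.2 :=
    congrArg Prod.snd e
  have t1 := (congrArg₂ (fun a c : EuclideanSpace ℝ (Fin d₁) =>
    (g₁ ((extChartAt ((𝓡 d₁).prod (𝓡 d₂)) q).symm y).1 : EuclideanSpace ℝ (Fin d₁) →L[ℝ]
      EuclideanSpace ℝ (Fin d₁) →L[ℝ] ℝ) a c) a1 a2).trans (bilinField_congr g₁ e1 _ _)
  have t2 := (congrArg₂ (fun a c : EuclideanSpace ℝ (Fin d₂) =>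
    (g₂ ((extChartAt ((𝓡 d₁).prod (𝓡 d₂)) q).symm y).2 : EuclideanSpace ℝ (Fin d₂) →L[ℝ]
      EuclideanSpace ℝ (Fin d₂) →L[ℝ] ℝ) a c) b1 b2).trans (bilinField_congr g₂ e2 _ _)
  exact congrArg₂ (fun a c : ℝ => a + c) t1 (congrArg₂ (fun a c : ℝ => a ^ 2 * c)
    (congrArg f e1) t2)

theorem RiemannianMetric.isMetricOn {d : ℕ} {M : Type*} [TopologicalSpace M]
    [ChartedSpace (EuclideanSpace ℝ (Fin d)) M] [IsManifold (𝓡 d) ∞ M]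
    (g : RiemannianMetric d M) (p : M) :
    Coord.IsMetricOn (inChartBilin g.inner p) (extChartAt (𝓡 d) p).target :=
  isMetricOn_inChartBilin g.contMDiff g.symm g.pos p

theorem isWarpedOn_inChart (g₁ : RiemannianMetric d₁ M₁) (g₂ : RiemannianMetric d₂ M₂)
    {f : M₁ → ℝ} (hf : ContMDiff (𝓡 d₁) 𝓘(ℝ, ℝ) ∞ f) (hpos : ∀ x, 0 < f x) (q : M₁ × M₂) :
    Coord.IsWarpedOn (inChartBilin g₁.inner q.1) (inChartBilin g₂.inner q.2)
      (f ∘ (extChartAt (𝓡 d₁) q.1).symm) (extChartAt (𝓡 d₁) q.1).target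
      (extChartAt (𝓡 d₂) q.2).target where
  fst := g₁.isMetricOn q.1
  snd := g₂.isMetricOn q.2
  smooth x hx := (hf.contMDiffAt.comp x (contMDiffAt_symm hx)).contDiffAt
  pos _ _ := hpos _

end Warped

/-! ### Sasakian space forms in charts -/

section Sasakian

variable {d : ℕ} {M : Type*} [TopologicalSpace M]
  [ChartedSpace (EuclideanSpace ℝ (Fin d)) M] [IsManifold (𝓡 d) ∞ M]
  {g : RiemannianMetric d M} {φ : SmoothEndoField d M} {ξ : SmoothVectorField d M}
  {η : ∀ x : M, TangentSpace (𝓡 d) x →L[ℝ] ℝ}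

/-- Sasakian structures in a chart. -/
theorem IsSasakian.isSasakianOn (S : IsSasakian g φ ξ η) (p : M) :
    Coord.IsSasakianOn (inChartBilin g.inner p) (inChartEndo (fun x => φ x) p)
      (inChartVec (fun x => ξ x) p) (extChartAt (𝓡 d) p).target := by
  -- The coordinate structure has no separate contact form: η is read as g(ξ, ·).
  have hform : ∀ y ∈ (extChartAt (𝓡 d) p).target, ∀ v,
      inChartBilin g.inner p y (inChartVec (fun x => ξ x) p y) v
        = η ((extChartAt (𝓡 d) p).symm y) (chartInvDeriv (𝓡 d) p y v) := fun y hy v => by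
    rw [inChartBilin_apply, inChartVec, chartInvDeriv_chartDeriv hy, S.eta_eq]
  refine ⟨g.isMetricOn p, fun y hy => contDiffAt_inChartEndo φ.contMDiff hy,
    fun y hy => contDiffAt_inChartVec ξ.contMDiff hy, fun y hy v => ?_, fun y hy => ?_,
    fun y hy v => ?_, fun y hy u v => ?_, fun y hy u v => ?_⟩
  · rw [hform y hy, inChartEndo_apply, inChartEndo_apply, chartInvDeriv_chartDeriv hy, S.phi_sq,
      map_add, map_neg, map_smul, chartDeriv_chartInvDeriv hy]
    rfl
  · rw [hform y hy, inChartVec, chartInvDeriv_chartDeriv hy, S.eta_xi]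
  · rw [hform y hy, inChartEndo_apply, chartInvDeriv_chartDeriv hy, S.eta_phi]
  · rw [hform y hy, hform y hy, inChartBilin_apply, inChartEndo_apply, inChartEndo_apply,
      chartInvDeriv_chartDeriv hy, chartInvDeriv_chartDeriv hy, S.compatible]
    rfl
  · rw [hform y hy, S.nabla_phi p y hy]
    rfl

/-- For X in the contact distribution, φX is orthogonal to X and of the same length, so the
denominator of the sectional curvature is |X|⁴. Cleared of it, the condition is polynomial and also
covers X = 0. -/
theorem IsSasakianSpaceForm.phi_sectional_inChart {c : ℝ} (S : IsSasakianSpaceForm g φ ξ η c)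
    (p : M) (X : EuclideanSpace ℝ (Fin d))
    (hX : inChartBilin g.inner p (extChartAt (𝓡 d) p p)
      (inChartVec (fun x => ξ x) p (extChartAt (𝓡 d) p p)) X = 0) :
    inChartBilin g.inner p (extChartAt (𝓡 d) p p)
      (Coord.curvature (inChartBilin g.inner p) (extChartAt (𝓡 d) p p) X
        (inChartEndo (fun x => φ x) p (extChartAt (𝓡 d) p p) X)
        (inChartEndo (fun x => φ x) p (extChartAt (𝓡 d) p p) X)) X
      = c * inChartBilin g.inner p (extChartAt (𝓡 d) p p) X X ^ 2 := by
  have hy := mem_extChartAt_target (I := 𝓡 d) p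
  have S' := S.toIsSasakian.isSasakianOn p
  set y := extChartAt (𝓡 d) p p with hyd
  by_cases h0 : X = 0
  · simp [h0]
  have hη : η p X = 0 := by
    rw [S.eta_eq p X]
    rw [inChartBilin_self, inChartVec_self] at hX
    exact hX
  have h1 := S.phi_sectional p X h0 hη
  have h2 : sectionalCurvature g.inner p X (φ p X)
      = inChartBilin g.inner p y (Coord.curvature (inChartBilin g.inner p) y X
          (inChartEndo (fun x => φ x) p y X) (inChartEndo (fun x => φ x) p y X)) X
        / (inChartBilin g.inner p y X X
            * inChartBilin g.inner p y (inChartEndo (fun x => φ x) p y X)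
              (inChartEndo (fun x => φ x) p y X)
          - inChartBilin g.inner p y X (inChartEndo (fun x => φ x) p y X) ^ 2) := by
    have hZ : inChartEndo (fun x => φ x) p y X = (φ p X : EuclideanSpace ℝ (Fin d)) :=
      inChartEndo_self _ p X
    have key : ∀ u v : EuclideanSpace ℝ (Fin d),
        (g.inner p : EuclideanSpace ℝ (Fin d) →L[ℝ] EuclideanSpace ℝ (Fin d) →L[ℝ] ℝ) u v
          = inChartBilin g.inner p y u v := fun u v => (inChartBilin_self g.inner p u v).symm
    rw [hZ]
    exact congrArg₂ (· / ·) (key _ _) (congrArg₂ (· - ·) (congrArg₂ (· * ·) (key _ _) (key _ _))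
      (congrArg (· ^ 2) (key _ _)))
  have hI := S'.metric.inner y hy
  have h3 : inChartBilin g.inner p y X (inChartEndo (fun x => φ x) p y X) = 0 := by
    have := S'.phi_skew hy X X
    rw [hI.symm] at this
    linarith
  have h4 := hI.pos X h0
  rw [h2, S'.compatible y hy, hX, h3, div_eq_iff (by
    have := mul_pos h4 h4
    simp only [mul_zero, sub_zero]
    nlinarith)] at h1
  rw [h1]
  ring

end Sasakian

end RiemGeom

namespace Coord

/-! ### Hypersurfaces of a warped product -/

section Hypersurface

variable {E : Type*} [NormedAddCommGroup E] [NormedSpace ℝ E] [FiniteDimensional ℝ E]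
  {F : Type*} [NormedAddCommGroup F] [NormedSpace ℝ F] [FiniteDimensional ℝ F]
  {E₁ : Type*} [NormedAddCommGroup E₁] [NormedSpace ℝ E₁] [FiniteDimensional ℝ E₁]
  {E₂ : Type*} [NormedAddCommGroup E₂] [NormedSpace ℝ E₂] [FiniteDimensional ℝ E₂]

theorem trace_of_finrank_eq_zero (hd : Module.finrank ℝ E = 0) (b : E →L[ℝ] E →L[ℝ] ℝ)
    (T : E → E → F) : trace b T = 0 :=
  Finset.sum_eq_zero fun i _ => absurd i.2 (by omega)

theorem covDerivGrad_zero (g : E → E →L[ℝ] E →L[ℝ] ℝ) (a : E → ℝ) (y : E) :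
    covDerivGrad g a y 0 = 0 := by
  rw [covDerivGrad_eq, map_zero, map_zero, zero_apply, add_zero]

variable {g : E → E →L[ℝ] E →L[ℝ] ℝ} {h : E₁ × E₂ → E₁ × E₂ →L[ℝ] E₁ × E₂ →L[ℝ] ℝ}
  {ψ : E → E₁ × E₂} {U : Set E} {U₁ : Set E₁} {U₂ : Set E₂}
  {g₁ : E₁ → E₁ →L[ℝ] E₁ →L[ℝ] ℝ} {g₂ : E₂ → E₂ →L[ℝ] E₂ →L[ℝ] ℝ} {f : E₁ → ℝ}
  {φ : E₁ → E₁ →L[ℝ] E₁} {ξ : E₁ → E₁} {x : E} {c : ℝ}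

/-- The biharmonic equation of a hypersurface with horizontal mean curvature vector, tangent to the
Reeb field, of the warped product of a Sasakian space form and a Riemannian manifold. -/
theorem IsIsometricOn.bitension_eq_zero_iff_of_warp (S : IsIsometricOn g h ψ U (U₁ ×ˢ U₂))
    (W : IsWarpedOn g₁ g₂ f U₁ U₂) (K : IsSasakianOn g₁ φ ξ U₁)
    (hh : ∀ y ∈ U₁ ×ˢ U₂, h y = warp g₁ g₂ f y) (hx : x ∈ U)
    (hdim : Module.finrank ℝ E₁ + Module.finrank ℝ E₂ = Module.finrank ℝ E + 1)
    (hc : ∀ X, g₁ (ψ x).1 (ξ (ψ x).1) X = 0 →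
      g₁ (ψ x).1 (curvature g₁ (ψ x).1 X (φ (ψ x).1 X) (φ (ψ x).1 X)) X
        = c * g₁ (ψ x).1 X X ^ 2)
    {w : E} (hw : fderiv ℝ ψ x w = (ξ (ψ x).1, 0)) (hH : (meanCurv g h ψ x).2 = 0) :
    bitension g h ψ x = 0 ↔
      normalLaplacian g h ψ (meanCurv g h ψ) x
          = traceSffShape g h ψ x (meanCurv g h ψ x)
            - ((c + 3) / 4 * (Module.finrank ℝ E₁ - 2) + 3 * (c - 1) / 4 + 1) • meanCurv g h ψ x
            + ((Module.finrank ℝ E₂ : ℝ) / f (ψ x).1) • norPart g h ψ x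
              (covDerivGrad h (fun z => f z.1) (ψ x) (meanCurv g h ψ x)) ∧
        (-2 : ℝ) • traceShapeNormalDeriv g h ψ (meanCurv g h ψ) x
            - ((Module.finrank ℝ E : ℝ) / 2) • gradNormSq g h ψ (meanCurv g h ψ) x
            - (2 * (Module.finrank ℝ E₂ : ℝ) / f (ψ x).1) • tanPart g h ψ x
              (covDerivGrad h (fun z => f z.1) (ψ x) (meanCurv g h ψ x)) = 0 := by
  have hy := S.mapsTo x hx
  -- On a zero-dimensional hypersurface all traces are empty, so both sides hold trivially; the
  -- factor dim E of τ₂ can be cancelled only in the other case.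
  by_cases hd : Module.finrank ℝ E = 0
  · have : Subsingleton E := Module.finrank_zero_iff.1 hd
    have t : ∀ T : E → E → E₁ × E₂, trace (g x) T = 0 := trace_of_finrank_eq_zero hd _
    have hH0 : meanCurv g h ψ x = 0 := by rw [meanCurv, t, smul_zero]
    have t1 : normalLaplacian g h ψ (meanCurv g h ψ) x = 0 := t _
    have t2 : traceSffShape g h ψ x 0 = 0 := t _
    refine iff_of_true ?_ ⟨?_, Subsingleton.elim _ _⟩
    · rw [bitension, laplacianAlong, t, t]
      simp
    · rw [t1, hH0, t2, covDerivGrad_zero, norPart, Subsingleton.elim (tanPart g h ψ x 0) 0]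
      simp
  have hn := S.meanCurv_normal hx
  rw [S.bitension_eq_zero_iff hx hd]
  set ν := meanCurv g h ψ x with hν
  have hν1 : ν = (ν.1, 0) := Prod.ext rfl hH
  have e : h =ᶠ[nhds (ψ x)] warp g₁ g₂ f :=
    Filter.eventuallyEq_of_mem (S.target.isOpen.mem_nhds hy) hh
  -- H is normal to the tangent vector (ξ, 0), so its horizontal component lies in the contact
  -- distribution, where the Ricci operator is scalar.
  have hξ : g₁ (ψ x).1 (ξ (ψ x).1) ν.1 = 0 := by
    have h1 := hn w
    rw [hw, hh _ hy, warp_apply] at h1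
    rw [(W.fst.inner _ hy.1).symm]
    simpa using h1
  have key : traceCurv g h ψ x ν
      = (-((c + 3) / 4 * (Module.finrank ℝ E₁ - 2) + 3 * (c - 1) / 4 + 1)) • ν
        + ((Module.finrank ℝ E₂ : ℝ) / f (ψ x).1) •
          covDerivGrad h (fun z => f z.1) (ψ x) ν := by
    rw [S.traceCurv_eq_of_hypersurface hx (by rw [Module.finrank_prod, hdim]) hn]
    simp only [curvature_congr e]
    rw [covDerivGrad_congr e Filter.EventuallyEq.rfl, hh _ hy, hν1, W.trace_curvature_warp hy,
      K.trace_curvature hy.1 hc hξ]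
    simp
  rw [key, S.norPart_add hx, S.norPart_smul hx, S.norPart_smul hx, S.norPart_of_normal hx hn,
    S.tanPart_add hx, S.tanPart_smul hx, S.tanPart_smul hx, S.tanPart_of_normal hx hn, smul_zero,
    zero_add, smul_smul, neg_smul, ← add_assoc, ← sub_eq_add_neg, ← mul_div_assoc 2]

end Hypersurface

end Coord

end

/-! ### The theorem, read in the charts at `p` and `ψ p` -/

theorem theorem3p1 (m n : ℕ) (c k : ℝ)
    {M₁ : Type*} [TopologicalSpace M₁] [ChartedSpace (EuclideanSpace ℝ (Fin (2 * m + 1))) M₁]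
    [IsManifold (𝓡 (2 * m + 1)) ∞ M₁]
    {M₂ : Type*} [TopologicalSpace M₂] [ChartedSpace (EuclideanSpace ℝ (Fin (2 * n))) M₂]
    [IsManifold (𝓡 (2 * n)) ∞ M₂]
    {M : Type*} [TopologicalSpace M] [ChartedSpace (EuclideanSpace ℝ (Fin (2 * (m + n)))) M]
    [IsManifold (𝓡 (2 * (m + n))) ∞ M]
    -- the Sasakian space form `M₁(c)` and the complex space form `M₂`
    (g₁ : RiemGeom.RiemannianMetric (2 * m + 1) M₁)
    (φ : RiemGeom.SmoothEndoField (2 * m + 1) M₁) (ξ : RiemGeom.SmoothVectorField (2 * m + 1) M₁)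
    (η : ∀ x : M₁, TangentSpace (𝓡 (2 * m + 1)) x →L[ℝ] ℝ)
    (hM₁ : RiemGeom.IsSasakianSpaceForm g₁ φ ξ η c)
    (g₂ : RiemGeom.RiemannianMetric (2 * n) M₂) (J : RiemGeom.SmoothEndoField (2 * n) M₂)
    (hM₂ : RiemGeom.IsComplexSpaceForm g₂ J k)
    -- the warping function and the warped product metric
    (f : M₁ → ℝ) (hf : ContMDiff (𝓡 (2 * m + 1)) 𝓘(ℝ, ℝ) ∞ f) (hf_pos : ∀ x, 0 < f x)
    (gf : RiemGeom.BilinField ((𝓡 (2 * m + 1)).prod (𝓡 (2 * n))) (M₁ × M₂))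
    (hgf : gf = RiemGeom.warpedMetric g₁.inner g₂.inner f)
    -- the isometrically immersed hypersurface
    (g : RiemGeom.RiemannianMetric (2 * (m + n)) M) (ψ : M → M₁ × M₂)
    (hψ : ContMDiff (𝓡 (2 * (m + n))) ((𝓡 (2 * m + 1)).prod (𝓡 (2 * n))) ∞ ψ)
    (hψ_iso : RiemGeom.IsIsometric g.inner gf ψ)
    -- `ξ` is tangent to `M`
    (hξ : ∀ p : M, ∃ w : TangentSpace (𝓡 (2 * (m + n))) p,
      mfderiv ((𝓡 (2 * m + 1)).prod (𝓡 (2 * n))) (𝓡 (2 * m + 1)) Prod.fst (ψ p)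
          (mfderiv (𝓡 (2 * (m + n))) ((𝓡 (2 * m + 1)).prod (𝓡 (2 * n))) ψ p w) = ξ (ψ p).1 ∧
        mfderiv ((𝓡 (2 * m + 1)).prod (𝓡 (2 * n))) (𝓡 (2 * n)) Prod.snd (ψ p)
          (mfderiv (𝓡 (2 * (m + n))) ((𝓡 (2 * m + 1)).prod (𝓡 (2 * n))) ψ p w) = 0)
    -- `H` is horizontal
    (hH : ∀ p : M, mfderiv ((𝓡 (2 * m + 1)).prod (𝓡 (2 * n))) (𝓡 (2 * n)) Prod.snd (ψ p)
      (RiemGeom.meanCurvature g.inner gf ψ p) = 0) :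
    RiemGeom.IsBiharmonic g.inner gf ψ ↔
      ∀ p : M,
        RiemGeom.normalLaplacianH g.inner gf ψ p
            = RiemGeom.traceSffShapeH g.inner gf ψ p
              - ((c * (m + 1) + 3 * m - 1) / 2 : ℝ) • RiemGeom.meanCurvature g.inner gf ψ p
              + (2 * n / f (ψ p).1 : ℝ) • RiemGeom.normalPart g.inner gf ψ p
                  (RiemGeom.covDerivGrad gf (fun x => f x.1) (ψ p)
                    (RiemGeom.meanCurvature g.inner gf ψ p)) ∧
          (-2 : ℝ) • RiemGeom.traceShapeNormalDerivH g.inner gf ψ p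
              - (m + n : ℝ) • RiemGeom.gradNormSqH g.inner gf ψ p
              - (4 * n / f (ψ p).1 : ℝ) • RiemGeom.tangentialPart g.inner gf ψ p
                  (RiemGeom.covDerivGrad gf (fun x => f x.1) (ψ p)
                    (RiemGeom.meanCurvature g.inner gf ψ p)) = 0 := by
  subst hgf
  refine forall_congr' fun p => ?_
  obtain ⟨w, hw₁, hw₂⟩ := hξ p
  have hHp := hH p
  have ht : (extChartAt ((𝓡 (2 * m + 1)).prod (𝓡 (2 * n))) (ψ p)).target
      = (extChartAt (𝓡 (2 * m + 1)) (ψ p).1).target ×ˢ (extChartAt (𝓡 (2 * n)) (ψ p).2).target := by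
    rw [extChartAt_prod]; rfl
  have hb : writtenInExtChartAt (𝓡 (2 * (m + n))) ((𝓡 (2 * m + 1)).prod (𝓡 (2 * n))) p ψ
      (extChartAt (𝓡 (2 * (m + n))) p p)
      = (extChartAt (𝓡 (2 * m + 1)) (ψ p).1 (ψ p).1, extChartAt (𝓡 (2 * n)) (ψ p).2 (ψ p).2) := by
    simp only [writtenInExtChartAt, Function.comp_apply, extChartAt_to_inv, extChartAt_prod]
    rfl
  have hwarp : ∀ y ∈ (extChartAt (𝓡 (2 * m + 1)) (ψ p).1).target
      ×ˢ (extChartAt (𝓡 (2 * n)) (ψ p).2).target, _ := fun y hy =>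
    RiemGeom.inChartBilin_warpedMetric g₁.inner g₂.inner f (ψ p) (ht ▸ hy)
  have W := RiemGeom.isWarpedOn_inChart g₁ g₂ hf hf_pos (ψ p)
  have S := RiemGeom.isIsometricOn_written hψ hψ_iso p (g.isMetricOn p)
    (by rw [ht]; exact W.isMetricOn.congr hwarp)
  rw [ht] at S
  have K := hM₁.toIsSasakian.isSasakianOn (ψ p).1
  have key := S.bitension_eq_zero_iff_of_warp (c := c) W K hwarp
    (RiemGeom.mem_chartDomain ψ p) (by simp only [finrank_euclideanSpace_fin]; omega)
    (by rw [hb]; exact hM₁.phi_sectional_inChart (ψ p).1) (w := w)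
    (by
      rw [hb, RiemGeom.inChartVec_self]
      refine (RiemGeom.fderiv_written_self hψ p w).trans (Prod.ext ?_ ?_)
      · rw [mfderiv_fst] at hw₁
        exact hw₁
      · rw [mfderiv_snd] at hw₂
        exact hw₂)
    (by
      rw [mfderiv_snd] at hHp
      exact hHp)
  have hf₀ : (f ∘ (extChartAt (𝓡 (2 * m + 1)) (ψ p).1).symm)
      (writtenInExtChartAt (𝓡 (2 * (m + n))) ((𝓡 (2 * m + 1)).prod (𝓡 (2 * n))) p ψ
        (extChartAt (𝓡 (2 * (m + n))) p p)).1 = f (ψ p).1 := by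
    rw [hb]
    exact congrArg f (extChartAt_to_inv (ψ p).1)
  -- The gradient term of the coordinate lemma uses f read in the chart of M₁, that of the theorem
  -- uses f ∘ π read in the product chart; the two functions coincide.
  have hcov : ∀ X, Coord.covDerivGrad
      (RiemGeom.inChartBilin (RiemGeom.warpedMetric g₁.inner g₂.inner f) (ψ p))
      (fun z => (f ∘ (extChartAt (𝓡 (2 * m + 1)) (ψ p).1).symm) z.1)
      (writtenInExtChartAt (𝓡 (2 * (m + n))) ((𝓡 (2 * m + 1)).prod (𝓡 (2 * n))) p ψ
        (extChartAt (𝓡 (2 * (m + n))) p p)) X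
      = RiemGeom.covDerivGrad (RiemGeom.warpedMetric g₁.inner g₂.inner f) (fun x => f x.1) (ψ p)
        X := fun X => by
    have e : extChartAt ((𝓡 (2 * m + 1)).prod (𝓡 (2 * n))) (ψ p) (ψ p) = (extChartAt
        (𝓡 (2 * m + 1)) (ψ p).1 (ψ p).1, extChartAt (𝓡 (2 * n)) (ψ p).2 (ψ p).2) := by
      rw [extChartAt_prod]; rfl
    have e' : (fun x : M₁ × M₂ => f x.1) ∘ (extChartAt ((𝓡 (2 * m + 1)).prod (𝓡 (2 * n)))
        (ψ p)).symm = fun z => (f ∘ (extChartAt (𝓡 (2 * m + 1)) (ψ p).1).symm) z.1 := by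
      rw [extChartAt_prod]; rfl
    rw [hb, ← e, ← e']
    rfl
  -- The Ricci constant of the contact distribution in dimension 2m + 1.
  have hC : (c + 3) / 4 * (((2 * m + 1 : ℕ) : ℝ) - 2) + 3 * (c - 1) / 4 + 1
      = (c * (m + 1) + 3 * m - 1) / 2 := by
    push_cast; ring
  have hd : ((2 * (m + n) : ℕ) : ℝ) / 2 = m + n := by
    push_cast; ring
  have hn₂ : (2 : ℝ) * ((2 * n : ℕ) : ℝ) = 4 * n := by
    push_cast; ring
  simp only [finrank_euclideanSpace_fin] at key
  rw [hf₀, hcov, hC, hd, hn₂, Nat.cast_mul, Nat.cast_ofNat] at key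
  exact key
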